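/- **Hopf algebroid symmetry of a depth 2 Frobenius 1-morphism.** Let $\mathcal C$ be an additive 2-category (closed under direct sums and subobjects of 1-morphisms; only the following is used: $\mathcal C$ is a bicategory, its categories of 1-morphisms are preadditive, and the horizontal product is biadditive on 2-morphisms). Write $\times$ for the horizontal and $\circ$ for the vertical product, $\mathcal C^2(f,g)$ for the 2-morphisms $f\to g$, a 1-morphism for its identity 2-morphism, and suppress coherence isomorphisms. Let $\iota$ be a Frobenius 1-morphism from $s_0$ to $t_0$ with two-sided dual $\bar\iota$: there are 2-morphisms $ev_L:\bar\iota\times\iota\to s_0$, $coev_L:t_0\to\iota\times\bar\iota$, $ev_R:\iota\times\bar\iota\to t_0$, $coev_R:s_0\to\bar\iota\times\iota$ with $$(\iota\times ev_L)\circ(coev_L\times\iota)=\iota,\quad (ev_L\times\bar\iota)\circ(\bar\iota\times coev_L)=\bar\iota,\quad (ev_R\times\iota)\circ(\iota\times coev_R)=\iota,\quad (\bar\iota\times ev_R)\circ(coev_R\times\bar\iota)=\bar\iota .$$ Call $\iota$ left D2 if there are finitely many $\beta_i\in\mathcal C^2(\iota\times\bar\iota\times\iota,\iota)$, $\beta_i'\in\mathcal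 C^2(\iota,\iota\times\bar\iota\times\iota)$ with $\sum_i\beta_i'\circ\beta_i=\iota\times\bar\iota\times\iota$, and right D2 if there are finitely many $\hat\beta_i\in\mathcal C^2(\bar\iota\times\iota\times\bar\iota,\bar\iota)$, $\hat\beta_i'\in\mathcal C^2(\bar\iota,\bar\iota\times\iota\times\bar\iota)$ with $\sum_i\hat\beta_i'\circ\hat\beta_i=\bar\iota\times\iota\times\bar\iota$. Assume that $\iota$ is left D2 or right D2. Then it is both, and the following hold, where for $l\in\mathcal C^2(\iota,\iota)$ we put $\bar l=(ev_L\times\bar\iota)\circ(\bar\iota\times l\times\bar\iota)\circ(\bar\iota\times coev_L)$. **(A)** The ring $A=\mathcal C^2(\iota\times\bar\iota,\iota\times\bar\iota)$ is the total ring of a left bialgebroid $\mathcal A_L=(A,L,s_L,t_L,\gamma_L,\pi_L)$ over $L=\mathcal C^2(\iota,\iota)$ with $s_L(l)=l\times\bar\iota$, $t_L(l)=\iota\times\bar l$, $\pi_L(a)=(\iota\times ev_L)\circ(a\times\iota)\circ(coev_L\times\iota)$ and, for every choice of $\beta_i,\beta_i'$, $$\gamma_L(a)=\sum_i(\iota\times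 ev_L\times\bar\iota)\circ(a\times\iota\times\bar\iota)\circ(\iota\times ev_L\times\bar\iota\times\iota\times\bar\iota)\circ(\iota\times\bar\iota\times\beta_i'\times\bar\iota)\circ(\iota\times\bar\iota\times coev_L)\ \otimes\ (\beta_i\times\bar\iota)\circ(\iota\times\bar\iota\times coev_L).$$ The element $\Upsilon=coev_L\circ ev_R$ is a non-degenerate right integral in $\mathcal A_L$, that is: ${}_LA$ (with $l\cdot a=s_L(l)a$) and $A_L$ (with $a\cdot l=t_L(l)a$) are finitely generated projective; the maps $\phi\mapsto\Upsilon\leftharpoondown\phi=t_L(\phi(\Upsilon_{(2)}))\Upsilon_{(1)}$, for left $L$-module maps $\phi:{}_LA\to{}_LL$, and $\phi\mapsto\Upsilon\leftharpoonup\phi=s_L(\phi(\Upsilon_{(1)}))\Upsilon_{(2)}$, for right $L$-module maps $\phi:A_L\to L_L$, are bijections onto $A$; and, with $\Upsilon\leftharpoondown{}_*\rho=1=\Upsilon\leftharpoonup\rho_*$, for all $a\in A$ $$\Upsilon_{(1)}a\otimes\Upsilon_{(2)}=\Upsilon_{(1)}\otimes\Upsilon_{(2)}[\Upsilon\leftharpoonup\rho_*(\,\cdot\,a)],\qquad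 \Upsilon_{(1)}\otimes\Upsilon_{(2)}a=\Upsilon_{(1)}[\Upsilon\leftharpoondown{}_*\rho(\,\cdot\,a)]\otimes\Upsilon_{(2)} .$$ The associated map $S_A(a)=\Upsilon\leftharpoonup\rho_*(\,\cdot\,a)$ equals $$S_A(a)=(\iota\times\bar\iota\times ev_R)\circ(\iota\times\bar\iota\times\iota\times ev_L\times\bar\iota)\circ(\iota\times\bar\iota\times a\times\iota\times\bar\iota)\circ(\iota\times coev_R\times\bar\iota\times\iota\times\bar\iota)\circ(coev_L\times\iota\times\bar\iota);$$ it is a bijective ring anti-automorphism, and it is an antipode making $\mathcal A_L$ a Hopf algebroid $(\mathcal A_L,\mathcal A_R,S_A)$, where $\mathcal A_R$ is the right bialgebroid over $L^{op}$ with $s_R=S_A\circ s_L$, $t_R=s_L$, $\pi_R=\pi_L\circ S_A^{-1}$, $\gamma_R(S_A(a))=S_A(a_{(2)})\otimes S_A(a_{(1)})$. Moreover $S_A(\Upsilon)=\Upsilon$, and $\Upsilon$ is a non-degenerate left and a non-degenerate right integral in this Hopf algebroid. **(B)** The ring $B=\mathcal C^2(\bar\iota\times\iota,\bar\iota\times\iota)$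 is the total ring of a right bialgebroid $\mathcal B_R=(B,R,s_R,t_R,\gamma_R,\pi_R)$ over $R=\mathcal C^2(\iota,\iota)$ with $s_R(r)=\bar\iota\times r$, $t_R(r)=\bar r\times\iota$, $\pi_R(b)=(\iota\times ev_L)\circ(\iota\times b)\circ(coev_L\times\iota)$ and, for every choice of $\hat\beta_i,\hat\beta_i'$, $$\gamma_R(b)=\sum_i(\bar\iota\times\iota\times ev_L)\circ(\bar\iota\times\iota\times\hat\beta_i\times\iota)\circ(\bar\iota\times coev_L\times\iota\times\bar\iota\times\iota)\circ(b\times\bar\iota\times\iota)\circ(\bar\iota\times coev_L\times\iota)\ \otimes\ (\bar\iota\times\iota\times ev_L)\circ(\hat\beta_i'\times\iota).$$ The element $\ell=coev_R\circ ev_L$ is a non-degenerate left integral in $\mathcal B_R$, that is: $B^R$ (with $b\cdot r=b\,s_R(r)$) and ${}^RB$ (with $r\cdot b=b\,t_R(r)$) are finitely generated projective; the maps $\phi\mapsto\phi\rightharpoonup\ell=\ell^{(2)}t_R(\phi(\ell^{(1)}))$, for right $R$-module maps $\phi:B^R\to R^R$, and $\phi\mapsto\phi\rightharpoondown\ell=\ell^{(1)}s_R(\phi(\ell^{(2)}))$,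 for left $R$-module maps $\phi:{}^RB\to{}^RR$, are bijections onto $B$; and, with $\lambda^*\rightharpoonup\ell=1={}^*\lambda\rightharpoondown\ell$, for all $b\in B$ $$\ell^{(1)}\otimes b\,\ell^{(2)}=[{}^*\lambda(b\,\cdot\,)\rightharpoondown\ell]\,\ell^{(1)}\otimes\ell^{(2)},\qquad b\,\ell^{(1)}\otimes\ell^{(2)}=\ell^{(1)}\otimes[\lambda^*(b\,\cdot\,)\rightharpoonup\ell]\,\ell^{(2)} .$$ The associated map $S_B(b)={}^*\lambda(b\,\cdot\,)\rightharpoondown\ell$ equals $$S_B(b)=(\bar\iota\times\iota\times ev_L)\circ(\bar\iota\times\iota\times\bar\iota\times ev_R\times\iota)\circ(\bar\iota\times\iota\times b\times\bar\iota\times\iota)\circ(\bar\iota\times coev_L\times\iota\times\bar\iota\times\iota)\circ(coev_R\times\bar\iota\times\iota);$$ it is a bijective ring anti-automorphism, and it is an antipode making $\mathcal B_R$ a Hopf algebroid $(\mathcal B_L,\mathcal B_R,S_B)$, where $\mathcal B_L$ is the left bialgebroid over $R^{op}$ with $s_L=t_R$, $t_L=S_B^{-1}\circ t_R$, $\pi_L=\pi_R\circ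 S_B$, $\gamma_L(S_B(b))=S_B(b^{(2)})\otimes S_B(b^{(1)})$. Moreover $S_B(\ell)=\ell$, and $\ell$ is a non-degenerate left and a non-degenerate right integral in this Hopf algebroid. Here a Hopf algebroid $(\mathcal A_L,\mathcal A_R,S)$ consists of a left bialgebroid and a right bialgebroid with the same total ring $A$ and anti-isomorphic base rings $L$, $R$ such that $s_L(L)=t_R(R)$, $t_L(L)=s_R(R)$, $(\gamma_L\otimes id)\circ\gamma_R=(id\otimes\gamma_R)\circ\gamma_L$, $(\gamma_R\otimes id)\circ\gamma_L=(id\otimes\gamma_L)\circ\gamma_R$, and an additive bijection $S:A\to A$ with $S(t_L(l)a\,t_L(l'))=s_L(l')S(a)s_L(l)$, $S(t_R(r')a\,t_R(r))=s_R(r)S(a)s_R(r')$, $S(a_{(1)})a_{(2)}=s_R(\pi_R(a))$ and $a^{(1)}S(a^{(2)})=s_L(\pi_L(a))$. A left integral in it is an $\ell$ with $a\ell=s_L(\pi_L(a))\ell$ for all $a$, non-degenerate if $\phi\mapsto\phi\rightharpoonup\ell$ and $\phi\mapsto\phi\rightharpoondown\ell$ (formed in $\mathcal A_R$) are bijective;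 a right integral is an $\Upsilon$ with $\Upsilon a=\Upsilon s_R(\pi_R(a))$ for all $a$, non-degenerate if $\phi\mapsto\Upsilon\leftharpoondown\phi$ and $\phi\mapsto\Upsilon\leftharpoonup\phi$ (formed in $\mathcal A_L$) are bijective. -/

import Mathlib

open CategoryTheory Bicategory MulOpposite
open scoped TensorProduct

universe w v u

/-! ## Tensor products over noncommutative base rings

The total ring `A` of a bialgebroid carries several actions of the base ring.  A right action of
the base `K` on the first factor and a left action on the second factor are given by maps
`ρ σ : K → A → A`. -/

section Balanced

variable {A K K' : Type*} [Ring A]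

/-- The tensor product `A ⊗_K A`: the quotient of `A ⊗_ℤ A` by the relations
`(a · k) ⊗ b = a ⊗ (k · b)`, where `a · k = ρ k a` and `k · b = σ k b`. -/
abbrev BalTensor (ρ σ : K → A → A) : Type _ :=
  (A ⊗[ℤ] A) ⧸ Submodule.span ℤ
    {x : A ⊗[ℤ] A | ∃ (k : K) (a b : A), x = ρ k a ⊗ₜ[ℤ] b - a ⊗ₜ[ℤ] σ k b}

/-- The canonical projection `A ⊗_ℤ A → A ⊗_K A`. -/
def BalTensor.mk (ρ σ : K → A → A) : (A ⊗[ℤ] A) →ₗ[ℤ] BalTensor ρ σ :=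
  Submodule.mkQ _

/-- Additive maps out of `A ⊗_K A`. -/
def BalTensor.lift {M : Type*} [AddCommGroup M] (ρ σ : K → A → A) (f : (A ⊗[ℤ] A) →ₗ[ℤ] M)
    (hf : ∀ k a b, f (ρ k a ⊗ₜ[ℤ] b) = f (a ⊗ₜ[ℤ] σ k b)) : BalTensor ρ σ →ₗ[ℤ] M :=
  Submodule.liftQ _ f (by
    rw [Submodule.span_le]
    rintro _ ⟨k, a, b, rfl⟩
    simp [hf])

/-- The threefold tensor product `A ⊗_K A ⊗_{K'} A`. -/
abbrev BalTensor₃ (ρ σ : K → A → A) (ρ' σ' : K' → A → A) : Type _ :=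
  (A ⊗[ℤ] (A ⊗[ℤ] A)) ⧸ Submodule.span ℤ
    ({x : A ⊗[ℤ] (A ⊗[ℤ] A) | ∃ (k : K) (a b c : A),
        x = ρ k a ⊗ₜ[ℤ] (b ⊗ₜ[ℤ] c) - a ⊗ₜ[ℤ] (σ k b ⊗ₜ[ℤ] c)} ∪
      {x : A ⊗[ℤ] (A ⊗[ℤ] A) | ∃ (k : K') (a b c : A),
        x = a ⊗ₜ[ℤ] (ρ' k b ⊗ₜ[ℤ] c) - a ⊗ₜ[ℤ] (b ⊗ₜ[ℤ] σ' k c)})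

/-- The canonical projection `A ⊗_ℤ A ⊗_ℤ A → A ⊗_K A ⊗_{K'} A`. -/
def BalTensor₃.mk (ρ σ : K → A → A) (ρ' σ' : K' → A → A) :
    (A ⊗[ℤ] (A ⊗[ℤ] A)) →ₗ[ℤ] BalTensor₃ ρ σ ρ' σ' :=
  Submodule.mkQ _

/-- `x ↦ (c ↦ x ⊗ c)`, from `A ⊗_K A` to maps `A → A ⊗_K A ⊗_{K'} A`. -/
def BalTensor.append (ρ σ : K → A → A) (ρ' σ' : K' → A → A) :
    BalTensor ρ σ →ₗ[ℤ] A →ₗ[ℤ] BalTensor₃ ρ σ ρ' σ' :=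
  BalTensor.lift ρ σ
    (TensorProduct.curry
      (BalTensor₃.mk ρ σ ρ' σ' ∘ₗ (TensorProduct.assoc ℤ A A A).toLinearMap)) (by
    intro k a b
    ext c
    refine (Submodule.Quotient.eq _).2 (Submodule.subset_span (Or.inl ⟨k, a, b, c, rfl⟩)))

/-- `x ↦ (a ↦ a ⊗ x)`, from `A ⊗_{K'} A` to maps `A → A ⊗_K A ⊗_{K'} A`. -/
def BalTensor.prepend (ρ σ : K → A → A) (ρ' σ' : K' → A → A) :
    BalTensor ρ' σ' →ₗ[ℤ] A →ₗ[ℤ] BalTensor₃ ρ σ ρ' σ' :=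
  BalTensor.lift ρ' σ'
    ((TensorProduct.mk ℤ A (A ⊗[ℤ] A)).compr₂ (BalTensor₃.mk ρ σ ρ' σ')).flip (by
    intro k b c
    ext a
    refine (Submodule.Quotient.eq _).2 (Submodule.subset_span (Or.inr ⟨k, a, b, c, rfl⟩)))

/-- `γ ⊗ id : a ⊗ c ↦ γ(a) ⊗ c`, with values in `A ⊗_K A ⊗_{K'} A`, for `γ : A → A ⊗_K A`. -/
def comulTensorId {ρ σ : K → A → A} (ρ' σ' : K' → A → A) (γ : A →ₗ[ℤ] BalTensor ρ σ) :
    (A ⊗[ℤ] A) →ₗ[ℤ] BalTensor₃ ρ σ ρ' σ' :=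
  TensorProduct.lift (BalTensor.append ρ σ ρ' σ' ∘ₗ γ)

/-- `id ⊗ γ : a ⊗ c ↦ a ⊗ γ(c)`, with values in `A ⊗_K A ⊗_{K'} A`, for `γ : A → A ⊗_{K'} A`. -/
def idTensorComul (ρ σ : K → A → A) {ρ' σ' : K' → A → A} (γ : A →ₗ[ℤ] BalTensor ρ' σ') :
    (A ⊗[ℤ] A) →ₗ[ℤ] BalTensor₃ ρ σ ρ' σ' :=
  TensorProduct.lift (BalTensor.prepend ρ σ ρ' σ' ∘ₗ γ).flip

/-- `a ⊗ b ↦ f(a) g(b)` on `A ⊗_ℤ A`. -/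
noncomputable def mulMap (f g : A →+ A) : (A ⊗[ℤ] A) →ₗ[ℤ] A :=
  LinearMap.mul' ℤ A ∘ₗ TensorProduct.map f.toIntLinearMap g.toIntLinearMap

/-- `a ⊗ b ↦ g(b) f(a)` on `A ⊗_ℤ A`. -/
noncomputable def mulMapOp (f g : A →+ A) : (A ⊗[ℤ] A) →ₗ[ℤ] A :=
  mulMap g f ∘ₗ (TensorProduct.comm ℤ A A).toLinearMap

/-- `a ⊗ b ↦ f(b) ⊗ f(a)` on `A ⊗_ℤ A`. -/
noncomputable def flipMap (f : A →+ A) : (A ⊗[ℤ] A) →ₗ[ℤ] (A ⊗[ℤ] A) :=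
  TensorProduct.map f.toIntLinearMap f.toIntLinearMap ∘ₗ (TensorProduct.comm ℤ A A).toLinearMap

@[simp]
theorem mulMap_tmul (f g : A →+ A) (a b : A) : mulMap f g (a ⊗ₜ[ℤ] b) = f a * g b := rfl

@[simp]
theorem mulMapOp_tmul (f g : A →+ A) (a b : A) : mulMapOp f g (a ⊗ₜ[ℤ] b) = g b * f a := rfl

@[simp]
theorem flipMap_tmul (f : A →+ A) (a b : A) : flipMap f (a ⊗ₜ[ℤ] b) = f b ⊗ₜ[ℤ] f a := rfl

end Balanced

/-! ## Bialgebroids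

An identity between expressions such as `f(a₍₁₎) g(a₍₂₎)` is stated for every representative
`x : A ⊗_ℤ A` of the coproduct of `a`.  In each case below the preceding conditions make the
expression independent of the representative, so that this is the identity of the induced maps. -/

/-- A left bialgebroid `(A, L, s, t, γ, π)` with total ring `A` and base ring `L`. -/
structure LeftBialgebroid (A L : Type*) [Ring A] [Ring L] where
  /-- the source map -/
  s : L →+* A
  /-- the target map -/
  t : Lᵐᵒᵖ →+* A
  comm : ∀ l l' : L, s l * t (op l') = t (op l') * s l
  /-- the coproduct, with values in `A_L ⊗ _L A`, where `a · l = t(l) a` and `l · a = s(l) a` -/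
  γ : A →ₗ[ℤ] BalTensor (fun (l : L) (a : A) => t (op l) * a) (fun (l : L) (a : A) => s l * a)
  /-- the counit -/
  π : A →+ L
  /-- `γ` is an `L`-`L` bimodule map, where `l · a · l' = s(l) t(l') a` -/
  γ_bimod : ∀ (l l' : L) (a : A) (x : A ⊗[ℤ] A), BalTensor.mk _ _ x = γ a →
    γ (s l * t (op l') * a) = BalTensor.mk _ _ ((s l ⊗ₜ[ℤ] t (op l')) * x)
  /-- `π` is an `L`-`L` bimodule map -/
  π_bimod : ∀ (l l' : L) (a : A), π (s l * t (op l') * a) = l * π a * l'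
  coassoc : ∀ (a : A) (x : A ⊗[ℤ] A), BalTensor.mk _ _ x = γ a →
    comulTensorId (fun (l : L) (a : A) => t (op l) * a) (fun (l : L) (a : A) => s l * a) γ x =
      idTensorComul (fun (l : L) (a : A) => t (op l) * a) (fun (l : L) (a : A) => s l * a) γ x
  /-- `s(π(a₍₁₎)) a₍₂₎ = a` -/
  counit_left : ∀ (a : A) (x : A ⊗[ℤ] A), BalTensor.mk _ _ x = γ a →
    mulMap (s.toAddMonoidHom.comp π) (AddMonoidHom.id A) x = a
  /-- `t(π(a₍₂₎)) a₍₁₎ = a` -/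
  counit_right : ∀ (a : A) (x : A ⊗[ℤ] A), BalTensor.mk _ _ x = γ a →
    mulMapOp (AddMonoidHom.id A)
      ((t.toAddMonoidHom.comp (opAddEquiv : L ≃+ Lᵐᵒᵖ).toAddMonoidHom).comp π) x = a
  /-- `a₍₁₎ t(l) ⊗ a₍₂₎ = a₍₁₎ ⊗ a₍₂₎ s(l)` -/
  takeuchi : ∀ (a : A) (l : L) (x : A ⊗[ℤ] A), BalTensor.mk _ _ x = γ a →
    BalTensor.mk (fun (l : L) (a : A) => t (op l) * a) (fun (l : L) (a : A) => s l * a)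
        (x * (t (op l) ⊗ₜ[ℤ] 1)) =
      BalTensor.mk _ _ (x * (1 ⊗ₜ[ℤ] s l))
  γ_one : γ 1 = BalTensor.mk _ _ (1 ⊗ₜ[ℤ] 1)
  γ_mul : ∀ (a b : A) (x y : A ⊗[ℤ] A), BalTensor.mk _ _ x = γ a → BalTensor.mk _ _ y = γ b →
    γ (a * b) = BalTensor.mk _ _ (x * y)
  π_one : π 1 = 1
  π_mul_s : ∀ a b : A, π (a * s (π b)) = π (a * b)
  π_mul_t : ∀ a b : A, π (a * t (op (π b))) = π (a * b)

/-- A right bialgebroid `(A, R, s, t, γ, π)` with total ring `A` and base ring `R`. -/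
structure RightBialgebroid (A R : Type*) [Ring A] [Ring R] where
  /-- the source map -/
  s : R →+* A
  /-- the target map -/
  t : Rᵐᵒᵖ →+* A
  comm : ∀ r r' : R, s r * t (op r') = t (op r') * s r
  /-- the coproduct, with values in `A^R ⊗ ^R A`, where `a · r = a s(r)` and `r · a = a t(r)` -/
  γ : A →ₗ[ℤ] BalTensor (fun (r : R) (a : A) => a * s r) (fun (r : R) (a : A) => a * t (op r))
  /-- the counit -/
  π : A →+ R
  /-- `γ` is an `R`-`R` bimodule map, where `r · a · r' = a s(r') t(r)` -/
  γ_bimod : ∀ (r r' : R) (a : A) (x : A ⊗[ℤ] A), BalTensor.mk _ _ x = γ a →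
    γ (a * (s r' * t (op r))) = BalTensor.mk _ _ (x * (t (op r) ⊗ₜ[ℤ] s r'))
  /-- `π` is an `R`-`R` bimodule map -/
  π_bimod : ∀ (r r' : R) (a : A), π (a * (s r' * t (op r))) = r * π a * r'
  coassoc : ∀ (a : A) (x : A ⊗[ℤ] A), BalTensor.mk _ _ x = γ a →
    comulTensorId (fun (r : R) (a : A) => a * s r) (fun (r : R) (a : A) => a * t (op r)) γ x =
      idTensorComul (fun (r : R) (a : A) => a * s r) (fun (r : R) (a : A) => a * t (op r)) γ x
  /-- `a⁽²⁾ t(π(a⁽¹⁾)) = a` -/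
  counit_left : ∀ (a : A) (x : A ⊗[ℤ] A), BalTensor.mk _ _ x = γ a →
    mulMapOp ((t.toAddMonoidHom.comp (opAddEquiv : R ≃+ Rᵐᵒᵖ).toAddMonoidHom).comp π)
      (AddMonoidHom.id A) x = a
  /-- `a⁽¹⁾ s(π(a⁽²⁾)) = a` -/
  counit_right : ∀ (a : A) (x : A ⊗[ℤ] A), BalTensor.mk _ _ x = γ a →
    mulMap (AddMonoidHom.id A) (s.toAddMonoidHom.comp π) x = a
  /-- `s(r) a⁽¹⁾ ⊗ a⁽²⁾ = a⁽¹⁾ ⊗ t(r) a⁽²⁾` -/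
  takeuchi : ∀ (a : A) (r : R) (x : A ⊗[ℤ] A), BalTensor.mk _ _ x = γ a →
    BalTensor.mk (fun (r : R) (a : A) => a * s r) (fun (r : R) (a : A) => a * t (op r))
        ((s r ⊗ₜ[ℤ] 1) * x) =
      BalTensor.mk _ _ ((1 ⊗ₜ[ℤ] t (op r)) * x)
  γ_one : γ 1 = BalTensor.mk _ _ (1 ⊗ₜ[ℤ] 1)
  γ_mul : ∀ (a b : A) (x y : A ⊗[ℤ] A), BalTensor.mk _ _ x = γ a → BalTensor.mk _ _ y = γ b →
    γ (a * b) = BalTensor.mk _ _ (x * y)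
  π_one : π 1 = 1
  π_s_mul : ∀ a b : A, π (s (π a) * b) = π (a * b)
  π_t_mul : ∀ a b : A, π (t (op (π a)) * b) = π (a * b)

/-! ## Duals, integrals and non-degeneracy -/

namespace LeftBialgebroid

variable {A L : Type*} [Ring A] [Ring L] (𝓛 : LeftBialgebroid A L)

/-- The projection `A ⊗_ℤ A → A_L ⊗ _L A`. -/
def proj : (A ⊗[ℤ] A) →ₗ[ℤ]
    BalTensor (fun (l : L) (a : A) => 𝓛.t (op l) * a) (fun (l : L) (a : A) => 𝓛.s l * a) :=
  BalTensor.mk _ _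

/-- The dual `𝓐_*` of right `L`-module maps `A_L → L_L`. -/
def DualStar : Type _ := {φ : A →+ L // ∀ (l : L) (a : A), φ (𝓛.t (op l) * a) = φ a * l}

/-- The dual `_*𝓐` of left `L`-module maps `_L A → _L L`. -/
def StarDual : Type _ := {φ : A →+ L // ∀ (l : L) (a : A), φ (𝓛.s l * a) = l * φ a}

/-- `(a ⇀ φ)(b) = φ(b a)` on `𝓐_*`. -/
def actDualStar (a : A) (φ : 𝓛.DualStar) : 𝓛.DualStar :=
  ⟨φ.1.comp (AddMonoidHom.mulRight a), fun l b => by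
    simpa [mul_assoc] using φ.2 l (b * a)⟩

/-- `(a ⇁ φ)(b) = φ(b a)` on `_*𝓐`. -/
def actStarDual (a : A) (φ : 𝓛.StarDual) : 𝓛.StarDual :=
  ⟨φ.1.comp (AddMonoidHom.mulRight a), fun l b => by
    simpa [mul_assoc] using φ.2 l (b * a)⟩

/-- `a ↼ φ = s(φ(a₍₁₎)) a₍₂₎` for `φ` in `𝓐_*`. -/
noncomputable def hitDualStar (a : A) (φ : 𝓛.DualStar) : A :=
  BalTensor.lift (fun (l : L) (a : A) => 𝓛.t (op l) * a) (fun (l : L) (a : A) => 𝓛.s l * a)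
    (mulMap (𝓛.s.toAddMonoidHom.comp φ.1) (AddMonoidHom.id A))
    (fun l a b => by simp [φ.2, mul_assoc]) (𝓛.γ a)

/-- `a ↽ φ = t(φ(a₍₂₎)) a₍₁₎` for `φ` in `_*𝓐`. -/
noncomputable def hitStarDual (a : A) (φ : 𝓛.StarDual) : A :=
  BalTensor.lift (fun (l : L) (a : A) => 𝓛.t (op l) * a) (fun (l : L) (a : A) => 𝓛.s l * a)
    (mulMapOp (AddMonoidHom.id A)
      ((𝓛.t.toAddMonoidHom.comp (opAddEquiv : L ≃+ Lᵐᵒᵖ).toAddMonoidHom).comp φ.1))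
    (fun l a b => by simp [φ.2, mul_assoc]) (𝓛.γ a)

/-- Both `_L A` (a left `L`-module) and `A_L` (a right `L`-module) are finitely generated
projective. -/
def IsFinite : Prop :=
  (letI : Module L A := Module.compHom A 𝓛.s
   Module.Finite L A ∧ Module.Projective L A) ∧
  (letI : Module Lᵐᵒᵖ A := Module.compHom A 𝓛.t
   Module.Finite Lᵐᵒᵖ A ∧ Module.Projective Lᵐᵒᵖ A)

/-- `ℓ` is a left integral of the left bialgebroid. -/
def IsLeftIntegral (ℓ : A) : Prop := ∀ a : A, a * ℓ = 𝓛.s (𝓛.π a) * ℓ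

/-- `Υ` is a non-degenerate right integral of the (finite) left bialgebroid. -/
structure IsNondegenerateRightIntegral (Υ : A) : Prop where
  finite : 𝓛.IsFinite
  bijective_star : Function.Bijective fun φ : 𝓛.StarDual => 𝓛.hitStarDual Υ φ
  bijective_dual : Function.Bijective fun φ : 𝓛.DualStar => 𝓛.hitDualStar Υ φ
  /-- `Υ₍₁₎ a ⊗ Υ₍₂₎ = Υ₍₁₎ ⊗ Υ₍₂₎ [Υ ↼ (a ⇀ ρ)]`, where `Υ ↼ ρ = 1` -/
  slide_left : ∀ ρ : 𝓛.DualStar, 𝓛.hitDualStar Υ ρ = 1 →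
    ∀ (a : A) (x : A ⊗[ℤ] A), 𝓛.proj x = 𝓛.γ Υ →
      𝓛.proj (x * (a ⊗ₜ[ℤ] 1)) =
        𝓛.proj (x * (1 ⊗ₜ[ℤ] 𝓛.hitDualStar Υ (𝓛.actDualStar a ρ)))
  /-- `Υ₍₁₎ ⊗ Υ₍₂₎ a = Υ₍₁₎ [Υ ↽ (a ⇁ ρ)] ⊗ Υ₍₂₎`, where `Υ ↽ ρ = 1` -/
  slide_right : ∀ ρ : 𝓛.StarDual, 𝓛.hitStarDual Υ ρ = 1 →
    ∀ (a : A) (x : A ⊗[ℤ] A), 𝓛.proj x = 𝓛.γ Υ →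
      𝓛.proj (x * (1 ⊗ₜ[ℤ] a)) =
        𝓛.proj (x * (𝓛.hitStarDual Υ (𝓛.actStarDual a ρ) ⊗ₜ[ℤ] 1))

end LeftBialgebroid

namespace RightBialgebroid

variable {A R : Type*} [Ring A] [Ring R] (𝓡 : RightBialgebroid A R)

/-- The projection `A ⊗_ℤ A → A^R ⊗ ^R A`. -/
def proj : (A ⊗[ℤ] A) →ₗ[ℤ]
    BalTensor (fun (r : R) (a : A) => a * 𝓡.s r) (fun (r : R) (a : A) => a * 𝓡.t (op r)) :=
  BalTensor.mk _ _

/-- The dual `𝓐^*` of right `R`-module maps `A^R → R^R`. -/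
def DualStar : Type _ := {φ : A →+ R // ∀ (r : R) (a : A), φ (a * 𝓡.s r) = φ a * r}

/-- The dual `^*𝓐` of left `R`-module maps `^R A → ^R R`. -/
def StarDual : Type _ := {φ : A →+ R // ∀ (r : R) (a : A), φ (a * 𝓡.t (op r)) = r * φ a}

/-- `(φ ↼ a)(b) = φ(a b)` on `𝓐^*`. -/
def actDualStar (φ : 𝓡.DualStar) (a : A) : 𝓡.DualStar :=
  ⟨φ.1.comp (AddMonoidHom.mulLeft a), fun r b => by
    simpa [mul_assoc] using φ.2 r (a * b)⟩

/-- `(φ ↽ a)(b) = φ(a b)` on `^*𝓐`. -/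
def actStarDual (φ : 𝓡.StarDual) (a : A) : 𝓡.StarDual :=
  ⟨φ.1.comp (AddMonoidHom.mulLeft a), fun r b => by
    simpa [mul_assoc] using φ.2 r (a * b)⟩

/-- `φ ⇀ a = a⁽²⁾ t(φ(a⁽¹⁾))` for `φ` in `𝓐^*`. -/
noncomputable def hitDualStar (φ : 𝓡.DualStar) (a : A) : A :=
  BalTensor.lift (fun (r : R) (a : A) => a * 𝓡.s r) (fun (r : R) (a : A) => a * 𝓡.t (op r))
    (mulMapOp
      ((𝓡.t.toAddMonoidHom.comp (opAddEquiv : R ≃+ Rᵐᵒᵖ).toAddMonoidHom).comp φ.1)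
      (AddMonoidHom.id A))
    (fun r a b => by simp [φ.2, mul_assoc]) (𝓡.γ a)

/-- `φ ⇁ a = a⁽¹⁾ s(φ(a⁽²⁾))` for `φ` in `^*𝓐`. -/
noncomputable def hitStarDual (φ : 𝓡.StarDual) (a : A) : A :=
  BalTensor.lift (fun (r : R) (a : A) => a * 𝓡.s r) (fun (r : R) (a : A) => a * 𝓡.t (op r))
    (mulMap (AddMonoidHom.id A) (𝓡.s.toAddMonoidHom.comp φ.1))
    (fun r a b => by simp [φ.2, mul_assoc]) (𝓡.γ a)

/-- The target map as a ring homomorphism `R → Aᵒᵖ`. -/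
def tOp : R →+* Aᵐᵒᵖ where
  toFun r := op (𝓡.t (op r))
  map_one' := by simp
  map_mul' x y := by simp
  map_zero' := by simp
  map_add' x y := by simp

/-- Both `A^R` (a right `R`-module, `a · r = a s(r)`) and `^R A` (a left `R`-module,
`r · a = a t(r)`) are finitely generated projective. -/
def IsFinite : Prop :=
  (letI : Module Rᵐᵒᵖ A := Module.compHom A (RingHom.op 𝓡.s)
   Module.Finite Rᵐᵒᵖ A ∧ Module.Projective Rᵐᵒᵖ A) ∧
  (letI : Module R A := Module.compHom A 𝓡.tOp
   Module.Finite R A ∧ Module.Projective R A)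

/-- `Υ` is a right integral of the right bialgebroid. -/
def IsRightIntegral (Υ : A) : Prop := ∀ a : A, Υ * a = Υ * 𝓡.s (𝓡.π a)

/-- `ℓ` is a non-degenerate left integral of the (finite) right bialgebroid. -/
structure IsNondegenerateLeftIntegral (ℓ : A) : Prop where
  finite : 𝓡.IsFinite
  bijective_dual : Function.Bijective fun φ : 𝓡.DualStar => 𝓡.hitDualStar φ ℓ
  bijective_star : Function.Bijective fun φ : 𝓡.StarDual => 𝓡.hitStarDual φ ℓ
  /-- `ℓ⁽¹⁾ ⊗ a ℓ⁽²⁾ = [(λ ↽ a) ⇁ ℓ] ℓ⁽¹⁾ ⊗ ℓ⁽²⁾`, where `λ ⇁ ℓ = 1` -/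
  slide_right : ∀ lam : 𝓡.StarDual, 𝓡.hitStarDual lam ℓ = 1 →
    ∀ (a : A) (x : A ⊗[ℤ] A), 𝓡.proj x = 𝓡.γ ℓ →
      𝓡.proj ((1 ⊗ₜ[ℤ] a) * x) =
        𝓡.proj ((𝓡.hitStarDual (𝓡.actStarDual lam a) ℓ ⊗ₜ[ℤ] 1) * x)
  /-- `a ℓ⁽¹⁾ ⊗ ℓ⁽²⁾ = ℓ⁽¹⁾ ⊗ [(λ ↼ a) ⇀ ℓ] ℓ⁽²⁾`, where `λ ⇀ ℓ = 1` -/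
  slide_left : ∀ lam : 𝓡.DualStar, 𝓡.hitDualStar lam ℓ = 1 →
    ∀ (a : A) (x : A ⊗[ℤ] A), 𝓡.proj x = 𝓡.γ ℓ →
      𝓡.proj ((a ⊗ₜ[ℤ] 1) * x) =
        𝓡.proj ((1 ⊗ₜ[ℤ] 𝓡.hitDualStar (𝓡.actDualStar lam a) ℓ) * x)

end RightBialgebroid

/-! ## Hopf algebroids -/

section Hopf

variable {A L R : Type*} [Ring A] [Ring L] [Ring R]

/-- `(𝓛, 𝓡, S)` is a Hopf algebroid; the antipode `S` is a bijection of additive groups. -/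
structure IsHopfAlgebroid (𝓛 : LeftBialgebroid A L) (𝓡 : RightBialgebroid A R) (S : A ≃+ A) :
    Prop where
  base : Nonempty (R ≃+* Lᵐᵒᵖ)
  range_s : Set.range 𝓛.s = Set.range 𝓡.t
  range_t : Set.range 𝓛.t = Set.range 𝓡.s
  /-- `(γ_L ⊗ id) ∘ γ_R = (id ⊗ γ_R) ∘ γ_L` in `A_L ⊗ _L A^R ⊗ ^R A` -/
  mixed_left : ∀ (a : A) (x y : A ⊗[ℤ] A), 𝓡.proj x = 𝓡.γ a → 𝓛.proj y = 𝓛.γ a →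
    comulTensorId (fun (r : R) (a : A) => a * 𝓡.s r) (fun (r : R) (a : A) => a * 𝓡.t (op r))
        𝓛.γ x =
      idTensorComul (fun (l : L) (a : A) => 𝓛.t (op l) * a) (fun (l : L) (a : A) => 𝓛.s l * a)
        𝓡.γ y
  /-- `(γ_R ⊗ id) ∘ γ_L = (id ⊗ γ_L) ∘ γ_R` in `A^R ⊗ ^R A_L ⊗ _L A` -/
  mixed_right : ∀ (a : A) (x y : A ⊗[ℤ] A), 𝓛.proj x = 𝓛.γ a → 𝓡.proj y = 𝓡.γ a →
    comulTensorId (fun (l : L) (a : A) => 𝓛.t (op l) * a) (fun (l : L) (a : A) => 𝓛.s l * a)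
        𝓡.γ x =
      idTensorComul (fun (r : R) (a : A) => a * 𝓡.s r) (fun (r : R) (a : A) => a * 𝓡.t (op r))
        𝓛.γ y
  twist_left : ∀ (l l' : L) (a : A),
    S (𝓛.t (op l) * a * 𝓛.t (op l')) = 𝓛.s l' * S a * 𝓛.s l
  twist_right : ∀ (r r' : R) (a : A),
    S (𝓡.t (op r') * a * 𝓡.t (op r)) = 𝓡.s r * S a * 𝓡.s r'
  /-- `S(a₍₁₎) a₍₂₎ = s_R(π_R(a))` -/
  antipode_left : ∀ (a : A) (x : A ⊗[ℤ] A), 𝓛.proj x = 𝓛.γ a →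
    mulMap S.toAddMonoidHom (AddMonoidHom.id A) x = 𝓡.s (𝓡.π a)
  /-- `a⁽¹⁾ S(a⁽²⁾) = s_L(π_L(a))` -/
  antipode_right : ∀ (a : A) (x : A ⊗[ℤ] A), 𝓡.proj x = 𝓡.γ a →
    mulMap (AddMonoidHom.id A) S.toAddMonoidHom x = 𝓛.s (𝓛.π a)

/-- `ℓ` is a non-degenerate left integral in the Hopf algebroid with constituents `𝓛`, `𝓡`. -/
structure IsNondegLeftIntegralHopf (𝓛 : LeftBialgebroid A L) (𝓡 : RightBialgebroid A R) (ℓ : A) :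
    Prop where
  integral : 𝓛.IsLeftIntegral ℓ
  bijective_dual : Function.Bijective fun φ : 𝓡.DualStar => 𝓡.hitDualStar φ ℓ
  bijective_star : Function.Bijective fun φ : 𝓡.StarDual => 𝓡.hitStarDual φ ℓ

/-- `Υ` is a non-degenerate right integral in the Hopf algebroid with constituents `𝓛`, `𝓡`. -/
structure IsNondegRightIntegralHopf (𝓛 : LeftBialgebroid A L) (𝓡 : RightBialgebroid A R) (Υ : A) :
    Prop where
  integral : 𝓡.IsRightIntegral Υ
  bijective_star : Function.Bijective fun φ : 𝓛.StarDual => 𝓛.hitStarDual Υ φ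
  bijective_dual : Function.Bijective fun φ : 𝓛.DualStar => 𝓛.hitDualStar Υ φ

/-- The right bialgebroid that a left bialgebroid `𝓛` and an antipode `S` determine, with the
base ring `Lᵐᵒᵖ`: `s_R = S ∘ s_L`, `t_R = s_L`, `π_R = π_L ∘ S⁻¹` and
`γ_R(S a) = S(a₍₂₎) ⊗ S(a₍₁₎)`. -/
structure IsRightPartner (𝓛 : LeftBialgebroid A L) (S : A ≃+ A) (𝓡 : RightBialgebroid A Lᵐᵒᵖ) :
    Prop where
  s_eq : ∀ l : L, 𝓡.s (op l) = S (𝓛.s l)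
  t_eq : ∀ l : L, 𝓡.t (op (op l)) = 𝓛.s l
  π_eq : ∀ a : A, 𝓡.π a = op (𝓛.π (S.symm a))
  γ_eq : ∀ (a : A) (x : A ⊗[ℤ] A), 𝓛.proj x = 𝓛.γ a →
    𝓡.γ (S a) = 𝓡.proj (flipMap S.toAddMonoidHom x)

/-- The left bialgebroid that a right bialgebroid `𝓡` and an antipode `S` determine, with the
base ring `Rᵐᵒᵖ`: `s_L = t_R`, `t_L = S⁻¹ ∘ t_R`, `π_L = π_R ∘ S` and
`γ_L(S a) = S(a⁽²⁾) ⊗ S(a⁽¹⁾)`. -/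
structure IsLeftPartner (𝓡 : RightBialgebroid A R) (S : A ≃+ A) (𝓛 : LeftBialgebroid A Rᵐᵒᵖ) :
    Prop where
  s_eq : ∀ r : R, 𝓛.s (op r) = 𝓡.t (op r)
  t_eq : ∀ r : R, 𝓛.t (op (op r)) = S.symm (𝓡.t (op r))
  π_eq : ∀ a : A, 𝓛.π a = op (𝓡.π (S a))
  γ_eq : ∀ (a : A) (x : A ⊗[ℤ] A), 𝓡.proj x = 𝓡.γ a →
    𝓛.γ (S a) = 𝓛.proj (flipMap S.toAddMonoidHom x)

end Hopf

/-! ## Frobenius 1-morphisms of depth 2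

The horizontal product `f × g` of 1-morphisms (first `g`, then `f`) is `g ≫ f` in Mathlib, so
`ι × ῑ` is `ῑ ≫ ι`, and a 2-morphism `f × η × g` is `g ◁ η ▷ f`.  The vertical product `η ∘ θ` is
`θ ≫ η`, and it is the multiplication of `End f`.  The composition `⊗≫` is `≫` with the coherence
isomorphisms of the bicategory inserted (they are identities in a strict 2-category). -/

/-- A bicategory whose categories of 1-morphisms are preadditive and whose horizontal composition
is additive in both arguments. -/
class PreadditiveBicategory (𝒞 : Type u) [Bicategory.{w, v} 𝒞] where
  [homPreadditive : ∀ X Y : 𝒞, Preadditive (X ⟶ Y)]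
  whiskerLeft_add : ∀ {X Y Z : 𝒞} (f : X ⟶ Y) {g h : Y ⟶ Z} (η θ : g ⟶ h),
    f ◁ (η + θ) = f ◁ η + f ◁ θ
  add_whiskerRight : ∀ {X Y Z : 𝒞} {f g : X ⟶ Y} (η θ : f ⟶ g) (h : Y ⟶ Z),
    (η + θ) ▷ h = η ▷ h + θ ▷ h

attribute [reducible, instance] PreadditiveBicategory.homPreadditive

/-- A presentation of `X` as a direct summand of a finite direct sum of copies of `Y`:
morphisms `β i : X ⟶ Y` and `β' i : Y ⟶ X` with `∑ β' i ∘ β i = 𝟙 X`. -/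
structure SummandData {C : Type*} [Category C] [Preadditive C] (X Y : C) where
  n : ℕ
  β : Fin n → (X ⟶ Y)
  β' : Fin n → (Y ⟶ X)
  sum_eq : ∑ i, β i ≫ β' i = 𝟙 X

namespace DepthTwo

variable {𝒞 : Type u} [Bicategory.{w, v} 𝒞] {a b : 𝒞} {ι : a ⟶ b} {ιbar : b ⟶ a}

section

variable [PreadditiveBicategory 𝒞]

variable (ι ιbar) in
/-- `ι` is left D2: `ι × ῑ × ι` is a direct summand of a finite direct sum of copies of `ι`. -/
def IsLeftD2 : Prop := Nonempty (SummandData (ι ≫ ιbar ≫ ι) ι)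

variable (ι ιbar) in
/-- `ι` is right D2: `ῑ × ι × ῑ` is a direct summand of a finite direct sum of copies of `ῑ`. -/
def IsRightD2 : Prop := Nonempty (SummandData (ιbar ≫ ι ≫ ιbar) ιbar)

end

/-- `(ev_L × ῑ) ∘ (ῑ × l × ῑ) ∘ (ῑ × coev_L)` -/
def mate (adjL : ιbar ⊣ ι) (l : End ι) : End ιbar :=
  𝟙 ιbar ⊗≫ adjL.unit ▷ ιbar ⊗≫ ιbar ◁ l.asHom ▷ ιbar ⊗≫ ιbar ◁ adjL.counit ⊗≫ 𝟙 ιbar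

/-! ### The ring `A = End (ι × ῑ)` over `L = End ι` -/

variable (ιbar) in
/-- `s_L(l) = l × ῑ` -/
def sL (l : End ι) : End (ιbar ≫ ι) := ιbar ◁ l.asHom

/-- `t_L(l) = ι × [(ev_L × ῑ) ∘ (ῑ × l × ῑ) ∘ (ῑ × coev_L)]` -/
def tL (adjL : ιbar ⊣ ι) (l : End ι) : End (ιbar ≫ ι) := (mate adjL l).asHom ▷ ι

/-- `π_L(x) = (ι × ev_L) ∘ (x × ι) ∘ (coev_L × ι)` -/
def piL (adjL : ιbar ⊣ ι) (x : End (ιbar ≫ ι)) : End ι :=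
  𝟙 ι ⊗≫ ι ◁ adjL.unit ⊗≫ ι ◁ x.asHom ⊗≫ adjL.counit ▷ ι ⊗≫ 𝟙 ι

/-- The first leg of `γ_L(x)`:
`(ι × ev_L × ῑ) ∘ (x × ι × ῑ) ∘ (ι × ev_L × ῑ × ι × ῑ) ∘ (ι × ῑ × β' × ῑ) ∘ (ι × ῑ × coev_L)`. -/
def gammaL₁ (adjL : ιbar ⊣ ι) (β' : ι ⟶ ι ≫ ιbar ≫ ι) (x : End (ιbar ≫ ι)) :
    End (ιbar ≫ ι) :=
  𝟙 (ιbar ≫ ι) ⊗≫ adjL.unit ▷ (ιbar ≫ ι) ⊗≫ ιbar ◁ β' ▷ (ιbar ≫ ι) ⊗≫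
    (ιbar ≫ ι ≫ ιbar) ◁ adjL.counit ▷ ι ⊗≫ (ιbar ≫ ι) ◁ x.asHom ⊗≫
    ιbar ◁ adjL.counit ▷ ι ⊗≫ 𝟙 (ιbar ≫ ι)

/-- The second leg of `γ_L`: `(β × ῑ) ∘ (ι × ῑ × coev_L)`. -/
def gammaL₂ (adjL : ιbar ⊣ ι) (β : ι ≫ ιbar ≫ ι ⟶ ι) : End (ιbar ≫ ι) :=
  𝟙 (ιbar ≫ ι) ⊗≫ adjL.unit ▷ (ιbar ≫ ι) ⊗≫ ιbar ◁ β ⊗≫ 𝟙 (ιbar ≫ ι)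

/-- `Υ = coev_L ∘ ev_R` -/
def upsilon (adjL : ιbar ⊣ ι) (adjR : ι ⊣ ιbar) : End (ιbar ≫ ι) := adjR.counit ≫ adjL.unit

/-- `S_A(x) = (ι × ῑ × ev_R) ∘ (ι × ῑ × ι × ev_L × ῑ) ∘ (ι × ῑ × x × ι × ῑ) ∘
(ι × coev_R × ῑ × ι × ῑ) ∘ (coev_L × ι × ῑ)` -/
def antipodeA (adjL : ιbar ⊣ ι) (adjR : ι ⊣ ιbar) (x : End (ιbar ≫ ι)) : End (ιbar ≫ ι) :=
  𝟙 (ιbar ≫ ι) ⊗≫ (ιbar ≫ ι) ◁ adjL.unit ⊗≫ (ιbar ≫ ι ≫ ιbar) ◁ adjR.unit ▷ ι ⊗≫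
    (ιbar ≫ ι) ◁ x.asHom ▷ (ιbar ≫ ι) ⊗≫ ιbar ◁ adjL.counit ▷ (ι ≫ ιbar ≫ ι) ⊗≫
    adjR.counit ▷ (ιbar ≫ ι) ⊗≫ 𝟙 (ιbar ≫ ι)

/-! ### The ring `B = End (ῑ × ι)` over `R = End ι` -/

variable (ιbar) in
/-- `s_R(r) = ῑ × r` -/
def sR (r : End ι) : End (ι ≫ ιbar) := r.asHom ▷ ιbar

/-- `t_R(r) = [(ev_L × ῑ) ∘ (ῑ × r × ῑ) ∘ (ῑ × coev_L)] × ι` -/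
def tR (adjL : ιbar ⊣ ι) (r : End ι) : End (ι ≫ ιbar) := ι ◁ (mate adjL r).asHom

/-- `π_R(y) = (ι × ev_L) ∘ (ι × y) ∘ (coev_L × ι)` -/
def piR (adjL : ιbar ⊣ ι) (y : End (ι ≫ ιbar)) : End ι :=
  𝟙 ι ⊗≫ ι ◁ adjL.unit ⊗≫ y.asHom ▷ ι ⊗≫ adjL.counit ▷ ι ⊗≫ 𝟙 ι

/-- The first leg of `γ_R(y)`:
`(ῑ × ι × ev_L) ∘ (ῑ × ι × β × ι) ∘ (ῑ × coev_L × ι × ῑ × ι) ∘ (y × ῑ × ι) ∘ (ῑ × coev_L × ι)`. -/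
def gammaR₁ (adjL : ιbar ⊣ ι) (β : ιbar ≫ ι ≫ ιbar ⟶ ιbar) (y : End (ι ≫ ιbar)) :
    End (ι ≫ ιbar) :=
  𝟙 (ι ≫ ιbar) ⊗≫ ι ◁ adjL.unit ▷ ιbar ⊗≫ (ι ≫ ιbar) ◁ y.asHom ⊗≫
    (ι ≫ ιbar ≫ ι) ◁ adjL.unit ▷ ιbar ⊗≫ ι ◁ β ▷ (ι ≫ ιbar) ⊗≫
    adjL.counit ▷ (ι ≫ ιbar) ⊗≫ 𝟙 (ι ≫ ιbar)

/-- The second leg of `γ_R`: `(ῑ × ι × ev_L) ∘ (β' × ι)`. -/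
def gammaR₂ (adjL : ιbar ⊣ ι) (β' : ιbar ⟶ ιbar ≫ ι ≫ ιbar) : End (ι ≫ ιbar) :=
  ι ◁ β' ⊗≫ adjL.counit ▷ (ι ≫ ιbar) ⊗≫ 𝟙 (ι ≫ ιbar)

/-- `ℓ = coev_R ∘ ev_L` -/
def ell (adjL : ιbar ⊣ ι) (adjR : ι ⊣ ιbar) : End (ι ≫ ιbar) := adjL.counit ≫ adjR.unit

/-- `S_B(y) = (ῑ × ι × ev_L) ∘ (ῑ × ι × ῑ × ev_R × ι) ∘ (ῑ × ι × y × ῑ × ι) ∘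
(ῑ × coev_L × ι × ῑ × ι) ∘ (coev_R × ῑ × ι)` -/
def antipodeB (adjL : ιbar ⊣ ι) (adjR : ι ⊣ ιbar) (y : End (ι ≫ ιbar)) : End (ι ≫ ιbar) :=
  𝟙 (ι ≫ ιbar) ⊗≫ (ι ≫ ιbar) ◁ adjR.unit ⊗≫ (ι ≫ ιbar ≫ ι) ◁ adjL.unit ▷ ιbar ⊗≫
    (ι ≫ ιbar) ◁ y.asHom ▷ (ι ≫ ιbar) ⊗≫ ι ◁ adjR.counit ▷ (ιbar ≫ ι ≫ ιbar) ⊗≫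
    adjL.counit ▷ (ι ≫ ιbar) ⊗≫ 𝟙 (ι ≫ ιbar)

variable [PreadditiveBicategory 𝒞]

/-- `𝓐` is the left bialgebroid `𝓐_L` of the left D2 1-morphism `ι`, i.e. its structural maps are
the ones above, with `γ_L` computed from the quasi-basis `Q`. -/
structure IsCanonicalLeft (adjL : ιbar ⊣ ι) (Q : SummandData (ι ≫ ιbar ≫ ι) ι)
    (𝓐 : LeftBialgebroid (End (ιbar ≫ ι)) (End ι)) : Prop where
  s_eq : ∀ l : End ι, 𝓐.s l = sL ιbar l
  t_eq : ∀ l : End ι, 𝓐.t (op l) = tL adjL l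
  π_eq : ∀ x : End (ιbar ≫ ι), 𝓐.π x = piL adjL x
  γ_eq : ∀ x : End (ιbar ≫ ι),
    𝓐.γ x = 𝓐.proj (∑ i, gammaL₁ adjL (Q.β' i) x ⊗ₜ[ℤ] gammaL₂ adjL (Q.β i))

/-- `𝓑` is the right bialgebroid `𝓑_R` of the right D2 1-morphism `ι`, i.e. its structural maps
are the ones above, with `γ_R` computed from the quasi-basis `P`. -/
structure IsCanonicalRight (adjL : ιbar ⊣ ι) (P : SummandData (ιbar ≫ ι ≫ ιbar) ιbar)
    (𝓑 : RightBialgebroid (End (ι ≫ ιbar)) (End ι)) : Prop where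
  s_eq : ∀ r : End ι, 𝓑.s r = sR ιbar r
  t_eq : ∀ r : End ι, 𝓑.t (op r) = tR adjL r
  π_eq : ∀ y : End (ι ≫ ιbar), 𝓑.π y = piR adjL y
  γ_eq : ∀ y : End (ι ≫ ιbar),
    𝓑.γ y = 𝓑.proj (∑ i, gammaR₁ adjL (P.β i) y ⊗ₜ[ℤ] gammaR₂ adjL (P.β' i))

end DepthTwo

/-!
Write `ῑ ≫ ι` for the composite of which `A` is the endomorphism ring.  The two adjunctions make it
a Frobenius algebra in the monoidal category of endo-1-morphisms of `b`: a monoid with product `μ`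
and unit `η`, and a comonoid with coproduct `δ` and counit `e`.  Besides composition, `A` therefore
carries the convolution product `a ⋆ b = μ ∘ (a ⊗ b) ∘ δ`, whose unit is `Υ = η ∘ e`.  The base
ring `L` is the ring of points of this monoid: `s` and `t` are left and right multiplication by a
point, and `π` is evaluation at the unit.  The antipode `S` and the map `S'`, which turns out to be its
inverse, are the two transposes with respect to the Frobenius form `e ∘ μ`.  In these terms
`a ⋆ 1` and `1 ⋆ a` are left and right multiplications by points, and `S` is adjoint for the
`L`-valued form `⟨a, c⟩ = π (a ⋆ c)`, that is, `⟨a * S b, c⟩ = ⟨a, c * b⟩`.  These facts, which hold without any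
depth condition, are collected in `FrobeniusDoubleRing`.

Depth 2 says that there are `W i`, `b i` in `A` with `∑ W i (x) · b i (y) = Υ (x · y)`.  Such
families are dual bases for the form: `a = ∑ s ⟨a, W i⟩ b i` and `c = ∑ t ⟨b i, c⟩ W i`.  The
coproduct is `γ a = ∑ (a ⋆ W i) ⊗ b i`.  The functionals `a ⊗ b ↦ t ⟨b, c⟩ a` separate the points
of `A ⊗_L A` (`extL`), and `γ a` is the element on which they take the values `a ⋆ c`
(`testL_gammaL`); hence `γ` does not depend on the choice of the dual bases, and the bialgebroid
axioms become identities in `A`.  Multiplicativity is the statement that composition distributes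
over convolution, `(a * x) ⋆ c = ∑ (a ⋆ (c * S' (b i))) * (x ⋆ W i)`; coassociativity and the two
mixed coassociativities are instances of one criterion (`comulTensorId_eq_idTensorComul`), which
uses that `γ` is colinear for convolution by a fixed element.

As `Υ` is the unit of `⋆`, `γ Υ = ∑ W i ⊗ b i`, so the two maps that pair a functional with a leg of
`Υ` are inverse to `c ↦ ⟨c, -⟩` and `c ↦ ⟨-, c⟩`, and `Υ` is non-degenerate.  The functionals sent
to `1` are `⟨1, -⟩` and `⟨-, 1⟩`, and adjointness of `S` turns `⟨1, - * a⟩` into `⟨S a, -⟩`; this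
identifies the antipode of the integral with the transpose.  The right bialgebroid is the left one
transported along `S`.

Part (B) is the same theorem for `ῑ` in place of `ι`, where `B` is the total ring of a left
bialgebroid over the endomorphism ring of `ῑ`.  That ring is identified with `(End ι)ᵐᵒᵖ` by taking
mates (`representationB`), and the right bialgebroid of the statement is the right partner.  Its
coproduct in the stated form is computed by a second pair of dual bases, which comes from `δ`
instead of `μ` (`gammaR_eq`, `sum_gammaR`).  That left D2 implies right D2 follows from
`sum_summand`: a family `W i`, `b i` as above also presents `ῑ ≫ ι ≫ ῑ`, up to the order of
composition, as a direct summand of a power of `ῑ`.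

To avoid coherence isomorphisms, the identities between 2-morphisms are proved for a
`FrobeniusMonad` on a category and applied to the functor `Y ↦ (Y ≫ ῑ) ≫ ι` on a hom category, on
which the elements of `A` act faithfully (`FrobeniusMonad.Representation`, `DepthTwo.act`).
-/

universe v₁ u₁

/-! ### Balanced tensor products -/

section BalancedLemmas

variable {A K K' : Type*} [Ring A]

theorem BalTensor.mk_surjective (ρ σ : K → A → A) : Function.Surjective (BalTensor.mk ρ σ) :=
  Submodule.mkQ_surjective _

theorem BalTensor.mk_rel (ρ σ : K → A → A) (k : K) (a b : A) :
    BalTensor.mk ρ σ (ρ k a ⊗ₜ[ℤ] b) = BalTensor.mk ρ σ (a ⊗ₜ[ℤ] σ k b) :=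
  (Submodule.Quotient.eq _).2 (Submodule.subset_span ⟨k, a, b, rfl⟩)

@[simp]
theorem BalTensor.lift_mk {M : Type*} [AddCommGroup M] (ρ σ : K → A → A)
    (f : (A ⊗[ℤ] A) →ₗ[ℤ] M) (hf : ∀ k a b, f (ρ k a ⊗ₜ[ℤ] b) = f (a ⊗ₜ[ℤ] σ k b))
    (x : A ⊗[ℤ] A) : BalTensor.lift ρ σ f hf (BalTensor.mk ρ σ x) = f x := rfl

theorem BalTensor.hom_ext {M : Type*} [AddCommGroup M] {ρ σ : K → A → A}
    {f g : BalTensor ρ σ →ₗ[ℤ] M}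
    (h : ∀ a b, f (BalTensor.mk ρ σ (a ⊗ₜ[ℤ] b)) = g (BalTensor.mk ρ σ (a ⊗ₜ[ℤ] b))) : f = g := by
  have : f ∘ₗ BalTensor.mk ρ σ = g ∘ₗ BalTensor.mk ρ σ := TensorProduct.ext' h
  refine LinearMap.ext fun x => ?_
  obtain ⟨x, rfl⟩ := BalTensor.mk_surjective ρ σ x
  exact LinearMap.congr_fun this x

theorem BalTensor.append_mk (ρ σ : K → A → A) (ρ' σ' : K' → A → A) (a b c : A) :
    BalTensor.append ρ σ ρ' σ' (BalTensor.mk ρ σ (a ⊗ₜ[ℤ] b)) c =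
      BalTensor₃.mk ρ σ ρ' σ' (a ⊗ₜ[ℤ] (b ⊗ₜ[ℤ] c)) := rfl

theorem BalTensor₃.mk_rel_right (ρ σ : K → A → A) (ρ' σ' : K' → A → A) (k : K') (a b c : A) :
    BalTensor₃.mk ρ σ ρ' σ' (a ⊗ₜ[ℤ] (ρ' k b ⊗ₜ[ℤ] c)) =
      BalTensor₃.mk ρ σ ρ' σ' (a ⊗ₜ[ℤ] (b ⊗ₜ[ℤ] σ' k c)) :=
  (Submodule.Quotient.eq _).2 (Submodule.subset_span (Or.inr ⟨k, a, b, c, rfl⟩))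

theorem BalTensor₃.hom_ext {M : Type*} [AddCommGroup M] {ρ σ : K → A → A} {ρ' σ' : K' → A → A}
    {f g : BalTensor₃ ρ σ ρ' σ' →ₗ[ℤ] M}
    (h : ∀ a b c, f (BalTensor₃.mk ρ σ ρ' σ' (a ⊗ₜ[ℤ] (b ⊗ₜ[ℤ] c))) =
      g (BalTensor₃.mk ρ σ ρ' σ' (a ⊗ₜ[ℤ] (b ⊗ₜ[ℤ] c)))) : f = g := by
  have : f ∘ₗ BalTensor₃.mk ρ σ ρ' σ' = g ∘ₗ BalTensor₃.mk ρ σ ρ' σ' :=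
    TensorProduct.ext (by
      ext a : 1
      exact TensorProduct.ext' (h a))
  refine LinearMap.ext fun x => ?_
  obtain ⟨x, rfl⟩ := Submodule.mkQ_surjective _ x
  exact LinearMap.congr_fun this x

/-- `a ⊗ b ↦ a ⊗ h(b)` on `A ⊗_K A`. -/
noncomputable def BalTensor.mapRight (ρ σ : K → A → A) (h : A →ₗ[ℤ] A)
    (hh : ∀ k b, h (σ k b) = σ k (h b)) : BalTensor ρ σ →ₗ[ℤ] BalTensor ρ σ :=
  BalTensor.lift ρ σ (BalTensor.mk ρ σ ∘ₗ TensorProduct.map LinearMap.id h) (fun k a b => by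
    change BalTensor.mk ρ σ (ρ k a ⊗ₜ[ℤ] h b) = BalTensor.mk ρ σ (a ⊗ₜ[ℤ] h (σ k b))
    rw [hh, BalTensor.mk_rel])

@[simp]
theorem BalTensor.mapRight_mk (ρ σ : K → A → A) (h : A →ₗ[ℤ] A)
    (hh : ∀ k b, h (σ k b) = σ k (h b)) (a b : A) :
    BalTensor.mapRight ρ σ h hh (BalTensor.mk ρ σ (a ⊗ₜ[ℤ] b)) =
      BalTensor.mk ρ σ (a ⊗ₜ[ℤ] h b) := rfl

/-- `b ⊗ c ↦ g(c)(b)`, from `A ⊗_K A` to `A`. -/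
noncomputable def BalTensor.fold (ρ σ : K → A → A) (g : A →ₗ[ℤ] A →ₗ[ℤ] A)
    (hg : ∀ k b c, g c (ρ k b) = g (σ k c) b) : BalTensor ρ σ →ₗ[ℤ] A :=
  BalTensor.lift ρ σ (TensorProduct.lift g.flip) (fun k a b => hg k a b)

@[simp]
theorem BalTensor.fold_mk (ρ σ : K → A → A) (g : A →ₗ[ℤ] A →ₗ[ℤ] A)
    (hg : ∀ k b c, g c (ρ k b) = g (σ k c) b) (b c : A) :
    BalTensor.fold ρ σ g hg (BalTensor.mk ρ σ (b ⊗ₜ[ℤ] c)) = g c b := rfl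

/-- `a ⊗ b ⊗ c ↦ a ⊗ g(c)(b)`, from `A ⊗_K A ⊗_{K'} A` to `A ⊗_K A`. -/
noncomputable def BalTensor₃.contract (ρ σ : K → A → A) (ρ' σ' : K' → A → A)
    (g : A →ₗ[ℤ] A →ₗ[ℤ] A) (hg : ∀ k b c, g c (ρ' k b) = g (σ' k c) b)
    (hσ : ∀ k b c, g c (σ k b) = σ k (g c b)) :
    BalTensor₃ ρ σ ρ' σ' →ₗ[ℤ] BalTensor ρ σ :=
  Submodule.liftQ _
    (BalTensor.mk ρ σ ∘ₗ TensorProduct.map LinearMap.id (TensorProduct.lift g.flip)) (by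
      rw [Submodule.span_le]
      rintro _ (⟨k, a, b, c, rfl⟩ | ⟨k, a, b, c, rfl⟩)
      · refine (map_sub _ _ _).trans (sub_eq_zero.2 ?_)
        change BalTensor.mk ρ σ (ρ k a ⊗ₜ[ℤ] g c b) = BalTensor.mk ρ σ (a ⊗ₜ[ℤ] g c (σ k b))
        rw [hσ, BalTensor.mk_rel]
      · refine (map_sub _ _ _).trans (sub_eq_zero.2 ?_)
        change BalTensor.mk ρ σ (a ⊗ₜ[ℤ] g c (ρ' k b)) = BalTensor.mk ρ σ (a ⊗ₜ[ℤ] g (σ' k c) b)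
        rw [hg])

@[simp]
theorem BalTensor₃.contract_mk (ρ σ : K → A → A) (ρ' σ' : K' → A → A)
    (g : A →ₗ[ℤ] A →ₗ[ℤ] A) (hg : ∀ k b c, g c (ρ' k b) = g (σ' k c) b)
    (hσ : ∀ k b c, g c (σ k b) = σ k (g c b)) (a b c : A) :
    BalTensor₃.contract ρ σ ρ' σ' g hg hσ (BalTensor₃.mk ρ σ ρ' σ' (a ⊗ₜ[ℤ] (b ⊗ₜ[ℤ] c))) =
      BalTensor.mk ρ σ (a ⊗ₜ[ℤ] g c b) := rfl

/-- A criterion for the mixed coassociativity `(γ ⊗ id) ∘ γ' = (id ⊗ γ') ∘ γ`.  The third tensor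
factor has a finite generating family `B i` whose coordinate functionals, acting on the second
factor, are the maps `g i`; thus elements of the threefold tensor product can be tested by
contracting the last two factors along the `g i`.  Both sides contract to the two sides of
`γ (h a) = (id ⊗ h) (γ a)`, where `h` is `γ'` followed by the contraction. -/
theorem comulTensorId_eq_idTensorComul {ρ σ : K → A → A} {ρ' σ' : K' → A → A}
    (γ : A →ₗ[ℤ] BalTensor ρ σ) (γ' : A →ₗ[ℤ] BalTensor ρ' σ') {n : ℕ}
    (g : Fin n → A →ₗ[ℤ] A →ₗ[ℤ] A) (h : Fin n → A →ₗ[ℤ] A) (B : Fin n → A)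
    (hg : ∀ i k b c, g i c (ρ' k b) = g i (σ' k c) b)
    (hσ : ∀ i k b c, g i c (σ k b) = σ k (g i c b))
    (hhσ : ∀ i k b, h i (σ k b) = σ k (h i b))
    (hsep : ∀ a b c, BalTensor₃.mk ρ σ ρ' σ' (a ⊗ₜ[ℤ] (b ⊗ₜ[ℤ] c)) =
      ∑ i, BalTensor₃.mk ρ σ ρ' σ' (a ⊗ₜ[ℤ] (g i c b ⊗ₜ[ℤ] B i)))
    (h₁ : ∀ i c a, BalTensor.mapRight ρ σ (g i c) (fun k b => hσ i k b c) (γ a) = γ (g i c a))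
    (h₂ : ∀ i a, BalTensor.fold ρ' σ' (g i) (hg i) (γ' a) = h i a)
    (h₃ : ∀ i a, γ (h i a) = BalTensor.mapRight ρ σ (h i) (hhσ i) (γ a))
    (a : A) (x y : A ⊗[ℤ] A) (hx : BalTensor.mk ρ' σ' x = γ' a) (hy : BalTensor.mk ρ σ y = γ a) :
    comulTensorId ρ' σ' γ x = idTensorComul ρ σ γ' y := by
  have sep : ∀ z : BalTensor₃ ρ σ ρ' σ', z = ∑ i, BalTensor.append ρ σ ρ' σ'
      (BalTensor₃.contract ρ σ ρ' σ' (g i) (hg i) (hσ i) z) (B i) := by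
    intro z
    have : (LinearMap.id : BalTensor₃ ρ σ ρ' σ' →ₗ[ℤ] _) = ∑ i,
        (BalTensor.append ρ σ ρ' σ').flip (B i) ∘ₗ
          BalTensor₃.contract ρ σ ρ' σ' (g i) (hg i) (hσ i) := by
      apply BalTensor₃.hom_ext
      intro a b c
      refine (hsep a b c).trans ?_
      simp [BalTensor.append_mk]
    simpa using LinearMap.congr_fun this z
  have left : ∀ i, BalTensor₃.contract ρ σ ρ' σ' (g i) (hg i) (hσ i) (comulTensorId ρ' σ' γ x) =
      γ (BalTensor.fold ρ' σ' (g i) (hg i) (BalTensor.mk ρ' σ' x)) := by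
    intro i
    have : BalTensor₃.contract ρ σ ρ' σ' (g i) (hg i) (hσ i) ∘ₗ comulTensorId ρ' σ' γ =
        γ ∘ₗ BalTensor.fold ρ' σ' (g i) (hg i) ∘ₗ BalTensor.mk ρ' σ' := by
      apply TensorProduct.ext'
      intro a c
      have : ∀ y : BalTensor ρ σ, BalTensor₃.contract ρ σ ρ' σ' (g i) (hg i) (hσ i)
          (BalTensor.append ρ σ ρ' σ' y c) =
            BalTensor.mapRight ρ σ (g i c) (fun k b => hσ i k b c) y := by
        intro y
        refine LinearMap.congr_fun (f := BalTensor₃.contract ρ σ ρ' σ' (g i) (hg i) (hσ i) ∘ₗ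
          (BalTensor.append ρ σ ρ' σ').flip c) (BalTensor.hom_ext fun a b => ?_) y
        simp [BalTensor.append_mk]
      exact (this (γ a)).trans (h₁ i c a)
    exact LinearMap.congr_fun this x
  have right : ∀ i, BalTensor₃.contract ρ σ ρ' σ' (g i) (hg i) (hσ i) (idTensorComul ρ σ γ' y) =
      BalTensor.mapRight ρ σ (h i) (hhσ i) (BalTensor.mk ρ σ y) := by
    intro i
    have : BalTensor₃.contract ρ σ ρ' σ' (g i) (hg i) (hσ i) ∘ₗ idTensorComul ρ σ γ' =
        BalTensor.mapRight ρ σ (h i) (hhσ i) ∘ₗ BalTensor.mk ρ σ := by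
      apply TensorProduct.ext'
      intro a c
      have : ∀ y : BalTensor ρ' σ', BalTensor₃.contract ρ σ ρ' σ' (g i) (hg i) (hσ i)
          (BalTensor.prepend ρ σ ρ' σ' y a) =
            BalTensor.mk ρ σ (a ⊗ₜ[ℤ] BalTensor.fold ρ' σ' (g i) (hg i) y) := by
        intro y
        refine LinearMap.congr_fun (f := BalTensor₃.contract ρ σ ρ' σ' (g i) (hg i) (hσ i) ∘ₗ
          (BalTensor.prepend ρ σ ρ' σ').flip a) (g := BalTensor.mk ρ σ ∘ₗ
            TensorProduct.mk ℤ A A a ∘ₗ BalTensor.fold ρ' σ' (g i) (hg i))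
          (BalTensor.hom_ext fun a b => rfl) y
      refine (this (γ' c)).trans ?_
      rw [h₂]
      rfl
    exact LinearMap.congr_fun this y
  rw [sep (comulTensorId ρ' σ' γ x), sep (idTensorComul ρ σ γ' y)]
  refine Finset.sum_congr rfl fun i _ => ?_
  rw [left, right, hx, hy, h₂, h₃]

end BalancedLemmas

/-- A finite dual basis: a module with elements `B i` and linear functionals `ψ i` such that
`m = ∑ ψ i m • B i` is finitely generated projective. -/
theorem Module.finite_and_projective_of_dualBasis {K M : Type*} [Ring K] [AddCommGroup M]
    [Module K M] {n : ℕ} (B : Fin n → M) (ψ : Fin n → M → K)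
    (hadd : ∀ i x y, ψ i (x + y) = ψ i x + ψ i y) (hsmul : ∀ i k x, ψ i (k • x) = k * ψ i x)
    (hsum : ∀ x, ∑ i, ψ i x • B i = x) : Module.Finite K M ∧ Module.Projective K M := by
  let p : M →ₗ[K] (Fin n → K) :=
    { toFun := fun x i => ψ i x
      map_add' := fun x y => funext fun i => hadd i x y
      map_smul' := fun k x => funext fun i => hsmul i k x }
  have hp : Fintype.linearCombination K B ∘ₗ p = LinearMap.id := by
    ext x
    simpa [Fintype.linearCombination_apply, p] using hsum x
  refine ⟨Module.Finite.of_surjective (Fintype.linearCombination K B) fun x => ⟨p x, ?_⟩,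
    Module.Projective.of_split p _ hp⟩
  exact LinearMap.congr_fun hp x

section FlipMap

variable {A : Type*} [Ring A]

theorem flipMap_mul (f : A →+ A) (hf : ∀ a b, f (a * b) = f b * f a) (x y : A ⊗[ℤ] A) :
    flipMap f (x * y) = flipMap f y * flipMap f x := by
  induction x with
  | zero => simp
  | add x x' hx hx' => simp [add_mul, mul_add, hx, hx']
  | tmul a b =>
    induction y with
    | zero => simp
    | add y y' hy hy' => simp [add_mul, mul_add, hy, hy']
    | tmul c d => simp [hf]

theorem flipMap_flipMap (f g : A →+ A) (h : ∀ a, f (g a) = a) (x : A ⊗[ℤ] A) :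
    flipMap f (flipMap g x) = x := by
  induction x with
  | zero => simp
  | add x x' hx hx' => simp [hx, hx']
  | tmul a b => simp [h]

end FlipMap

/-! ### Frobenius double rings -/

/-- A ring `A` with a second, convolution product `star`, as it occurs on the endomorphisms of a
Frobenius algebra `X` in a monoidal category.  The base ring `L` consists of the points of `X`;
`s` and `t` are left and right multiplication by a point, `π` evaluates an endomorphism at the unit
of `X`, and `Υ`, the unit of `star`, is the counit of `X` followed by its unit.  The maps `S` and
`S'` are the two transpositions with respect to the Frobenius form of `X`; they are adjoint to
right multiplications for the `L`-valued form `⟨a, c⟩ = π (star a c)`. -/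
structure FrobeniusDoubleRing (A L : Type*) [Ring A] [Ring L] where
  s : L →+* A
  t : Lᵐᵒᵖ →+* A
  π : A →+ L
  star : A →ₗ[ℤ] A →ₗ[ℤ] A
  Υ : A
  S : A →+ A
  S' : A →+ A
  comm : ∀ l l' : L, s l * t (op l') = t (op l') * s l
  π_bimod : ∀ (l l' : L) (a : A), π (s l * t (op l') * a) = l * π a * l'
  π_one : π 1 = 1
  π_mul_s : ∀ a b : A, π (a * s (π b)) = π (a * b)
  π_mul_t : ∀ a b : A, π (a * t (op (π b))) = π (a * b)
  mul_Υ_s : ∀ a : A, a * Υ = s (π a) * Υ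
  mul_Υ_t : ∀ a : A, a * Υ = t (op (π a)) * Υ
  star_assoc : ∀ a b c : A, star (star a b) c = star a (star b c)
  Υ_star : ∀ a : A, star Υ a = a
  star_Υ : ∀ a : A, star a Υ = a
  s_mul_star : ∀ (l : L) (a b : A), s l * star a b = star (s l * a) b
  t_mul_star : ∀ (l : L) (a b : A), t (op l) * star a b = star a (t (op l) * b)
  t_star : ∀ (l : L) (a b : A), star (t (op l) * a) b = star a (s l * b)
  star_mul_t : ∀ (l : L) (a b : A), star a b * t (op l) = star a (b * t (op l))
  one_star : ∀ a : A, star 1 a = t (op (π (star 1 a)))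
  star_one : ∀ a : A, star a 1 = s (π (star a 1))
  form_S : ∀ a b c : A, π (star (a * S b) c) = π (star a (c * b))
  form_S' : ∀ a b c : A, π (star (a * b) c) = π (star a (c * S' b))
  S_star : ∀ a b : A, S (star a b) = star (S b) (S a)

namespace FrobeniusDoubleRing

variable {A L : Type*} [Ring A] [Ring L] (D : FrobeniusDoubleRing A L)

/-- Dual bases for the form `⟨a, c⟩ = π (star a c)`, subject to the distributive law
`star (a x) c = star a (c S'(x₂)) x₁`, where `x₁ ⊗ x₂ = ∑ star x (W i) ⊗ b i`. -/
structure DualBasis (n : ℕ) where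
  W : Fin n → A
  b : Fin n → A
  left : ∀ a : A, ∑ i, D.s (D.π (D.star a (W i))) * b i = a
  right : ∀ c : A, ∑ i, D.t (op (D.π (D.star (b i) c))) * W i = c
  distrib : ∀ a x c : A, D.star (a * x) c = ∑ i, D.star a (c * D.S' (b i)) * D.star x (W i)

theorem π_s_mul (l : L) (a : A) : D.π (D.s l * a) = l * D.π a := by
  simpa using D.π_bimod l 1 a

theorem π_t_mul (l : L) (a : A) : D.π (D.t (op l) * a) = D.π a * l := by
  simpa using D.π_bimod 1 l a

theorem π_s (l : L) : D.π (D.s l) = l := by simpa [D.π_one] using D.π_s_mul l 1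

theorem π_t (l : L) : D.π (D.t (op l)) = l := by simpa [D.π_one] using D.π_t_mul l 1

namespace DualBasis

variable {D} {n : ℕ}

theorem ext_left (E : D.DualBasis n) {a b : A}
    (h : ∀ c, D.π (D.star a c) = D.π (D.star b c)) : a = b := by
  rw [← E.left a, ← E.left b]
  simp [h]

theorem ext_right (E : D.DualBasis n) {a b : A}
    (h : ∀ c, D.π (D.star c a) = D.π (D.star c b)) : a = b := by
  rw [← E.right a, ← E.right b]
  simp [h]

theorem S_S' (E : D.DualBasis n) (a : A) : D.S (D.S' a) = a := by
  refine E.ext_left fun c => ?_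
  have h := D.form_S 1 (D.S' a) c
  rw [one_mul] at h
  rw [h, ← D.form_S', one_mul]

theorem S'_S (E : D.DualBasis n) (a : A) : D.S' (D.S a) = a := by
  refine E.ext_right fun c => ?_
  have h := D.form_S' c (D.S a) 1
  rw [one_mul] at h
  rw [← h, D.form_S, one_mul]

theorem S_mul (E : D.DualBasis n) (a b : A) : D.S (a * b) = D.S b * D.S a := by
  refine E.ext_left fun c => ?_
  have h₁ := D.form_S 1 (a * b) c
  have h₂ := D.form_S 1 b (c * a)
  rw [one_mul] at h₁ h₂
  rw [h₁, D.form_S, h₂, mul_assoc]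

theorem S_one (E : D.DualBasis n) : D.S 1 = 1 := by
  refine E.ext_left fun c => ?_
  have h := D.form_S 1 1 c
  rwa [one_mul, mul_one] at h

theorem S'_one (E : D.DualBasis n) : D.S' 1 = 1 := by
  conv_lhs => rw [← E.S_one, E.S'_S]

theorem S_t (E : D.DualBasis n) (l : L) : D.S (D.t (op l)) = D.s l := by
  refine E.ext_left fun c => ?_
  have h := D.form_S 1 (D.t (op l)) c
  rw [one_mul, ← D.star_mul_t, D.one_star, ← map_mul, ← op_mul, D.π_t] at h
  have h' := congrArg D.π (D.s_mul_star l 1 c)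
  rw [D.π_s_mul, mul_one] at h'
  rw [h, ← h']

theorem S'_s (E : D.DualBasis n) (l : L) : D.S' (D.s l) = D.t (op l) := by
  rw [← E.S_t, E.S'_S]

theorem S_Υ (E : D.DualBasis n) : D.S D.Υ = D.Υ := by
  refine E.ext_left fun c => ?_
  have h := D.form_S 1 D.Υ c
  rw [one_mul] at h
  rw [h, D.mul_Υ_t, ← D.t_mul_star, D.star_Υ, D.π_t_mul, D.π_one, one_mul, D.Υ_star]

theorem S'_Υ (E : D.DualBasis n) : D.S' D.Υ = D.Υ := by
  conv_lhs => rw [← E.S_Υ, E.S'_S]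

theorem S'_mul (E : D.DualBasis n) (a b : A) : D.S' (a * b) = D.S' b * D.S' a := by
  rw [← E.S'_S (D.S' b * D.S' a), E.S_mul, E.S_S', E.S_S']

theorem S'_star (E : D.DualBasis n) (a b : A) :
    D.S' (D.star a b) = D.star (D.S' b) (D.S' a) := by
  rw [← E.S'_S (D.star (D.S' b) _), D.S_star, E.S_S', E.S_S']

/-- `(Υ b) ⋆ 1` is left multiplication by the value of `S' b` at the unit. -/
theorem star_Υ_mul_one (E : D.DualBasis n) (b : A) :
    D.star (D.Υ * b) 1 = D.s (D.π (D.S' b)) := by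
  have h : D.t (op (D.π (D.S' b))) = D.star 1 (D.S' b * D.Υ) := by
    rw [D.mul_Υ_t, ← D.t_mul_star, D.star_Υ, mul_one]
  rw [← E.S_t, h, D.S_star, E.S_mul, E.S_S', E.S_Υ, E.S_one]

/-- `1 ⋆ (Υ b)` is right multiplication by the value of `S b` at the unit. -/
theorem S_s_π_S' (E : D.DualBasis n) (b : A) :
    D.S (D.s (D.π (D.S' b))) = D.t (op (D.π (D.S b))) := by
  rw [← E.star_Υ_mul_one, D.S_star, E.S_mul, E.S_Υ, E.S_one, D.mul_Υ_t, ← D.t_mul_star, D.star_Υ,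
    mul_one]

end DualBasis

end FrobeniusDoubleRing

/-! ### The left bialgebroid -/

namespace FrobeniusDoubleRing

variable {A L : Type*} [Ring A] [Ring L] (D : FrobeniusDoubleRing A L)

/-- The tensor product `A_L ⊗ _L A`, where `a · l = t(l) a` and `l · a = s(l) a`. -/
abbrev LTensor : Type _ :=
  BalTensor (fun (l : L) (a : A) => D.t (op l) * a) (fun (l : L) (a : A) => D.s l * a)

/-- The projection `A ⊗_ℤ A → A_L ⊗ _L A`. -/
def mkL : (A ⊗[ℤ] A) →ₗ[ℤ] D.LTensor := BalTensor.mk _ _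

theorem mkL_surjective : Function.Surjective D.mkL := BalTensor.mk_surjective _ _

theorem mkL_rel (l : L) (a b : A) :
    D.mkL ((D.t (op l) * a) ⊗ₜ[ℤ] b) = D.mkL (a ⊗ₜ[ℤ] (D.s l * b)) :=
  BalTensor.mk_rel _ _ l a b

/-- `b ↦ t(⟨b, c⟩)` -/
noncomputable def tForm (c : A) : A →ₗ[ℤ] A :=
  ((D.t.toAddMonoidHom.comp (opAddEquiv : L ≃+ Lᵐᵒᵖ).toAddMonoidHom).comp D.π).toIntLinearMap ∘ₗ
    D.star.flip c

@[simp]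
theorem tForm_apply (c b : A) : D.tForm c b = D.t (op (D.π (D.star b c))) := rfl

theorem tForm_s_mul (l : L) (b c : A) :
    D.tForm c (D.s l * b) = D.tForm c b * D.t (op l) := by
  simp only [tForm_apply]
  rw [← D.s_mul_star, D.π_s_mul, op_mul, map_mul]

/-- The test functional `a ⊗ b ↦ t(⟨b, c⟩) a` on `A_L ⊗ _L A`. -/
noncomputable def testL (c : A) : D.LTensor →ₗ[ℤ] A :=
  BalTensor.fold _ _ (LinearMap.mul ℤ A ∘ₗ D.tForm c) (fun l a b => by
    change D.tForm c b * (D.t (op l) * a) = D.tForm c (D.s l * b) * a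
    rw [tForm_s_mul, mul_assoc])

@[simp]
theorem testL_mk (c a b : A) :
    D.testL c (D.mkL (a ⊗ₜ[ℤ] b)) = D.t (op (D.π (D.star b c))) * a := rfl

variable {D} {n : ℕ} (E : D.DualBasis n)

theorem DualBasis.mkL_tmul (a b : A) :
    D.mkL (a ⊗ₜ[ℤ] b) = ∑ i, D.mkL (D.testL (E.W i) (D.mkL (a ⊗ₜ[ℤ] b)) ⊗ₜ[ℤ] E.b i) := by
  simp only [testL_mk, mkL_rel]
  rw [← map_sum, ← TensorProduct.tmul_sum, E.left]

/-- The functionals `D.testL c` separate the points of `A_L ⊗ _L A`. -/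
theorem DualBasis.extL (E : D.DualBasis n) {z w : D.LTensor}
    (h : ∀ c, D.testL c z = D.testL c w) : z = w := by
  have key : ∀ z : D.LTensor, z = ∑ i, D.mkL (D.testL (E.W i) z ⊗ₜ[ℤ] E.b i) := by
    intro z
    obtain ⟨x, rfl⟩ := D.mkL_surjective z
    induction x with
    | zero => simp
    | tmul a b => exact E.mkL_tmul a b
    | add x y hx hy =>
      conv_lhs => rw [map_add, hx, hy]
      simp only [map_add, TensorProduct.add_tmul, Finset.sum_add_distrib]
  rw [key z, key w]
  simp [h]

/-- The coproduct `γ(a) = ∑ (a ⋆ W i) ⊗ b i`. -/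
noncomputable def DualBasis.gammaL : A →ₗ[ℤ] D.LTensor :=
  ∑ i, D.mkL ∘ₗ ((TensorProduct.mk ℤ A A).flip (E.b i) ∘ₗ D.star.flip (E.W i))

theorem DualBasis.gammaL_apply (a : A) :
    E.gammaL a = D.mkL (∑ i, D.star a (E.W i) ⊗ₜ[ℤ] E.b i) := by
  simp only [gammaL, LinearMap.sum_apply, map_sum]
  rfl

/-- The coproduct of `a` is characterized by its values `a ⋆ c` on the test functionals. -/
@[simp]
theorem DualBasis.testL_gammaL (a c : A) : D.testL c (E.gammaL a) = D.star a c := by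
  rw [gammaL_apply]
  simp only [map_sum, testL_mk, D.t_mul_star]
  rw [← map_sum, E.right]

theorem DualBasis.gammaL_eq_iff {a : A} {z : D.LTensor} :
    z = E.gammaL a ↔ ∀ c, D.testL c z = D.star a c :=
  ⟨fun h c => by rw [h, testL_gammaL], fun h => E.extL fun c => by rw [h, testL_gammaL]⟩

theorem testL_bimod (l l' : L) (c : A) (x : A ⊗[ℤ] A) :
    D.testL c (D.mkL ((D.s l ⊗ₜ[ℤ] D.t (op l')) * x)) =
      D.s l * D.testL (D.s l' * c) (D.mkL x) := by
  induction x with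
  | zero => simp
  | add x y hx hy => simp only [mul_add, map_add, hx, hy]
  | tmul a b =>
    simp only [Algebra.TensorProduct.tmul_mul_tmul, testL_mk, D.t_star]
    rw [← mul_assoc, ← mul_assoc, D.comm]

theorem testL_mul_t (l : L) (c : A) (x : A ⊗[ℤ] A) :
    D.testL c (D.mkL (x * (D.t (op l) ⊗ₜ[ℤ] 1))) = D.testL c (D.mkL x) * D.t (op l) := by
  induction x with
  | zero => simp
  | add x y hx hy => simp only [add_mul, map_add, hx, hy]
  | tmul a b => simp [mul_assoc]

theorem testL_mul_tmul (c a' b' : A) (x : A ⊗[ℤ] A) :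
    D.testL c (D.mkL (x * (a' ⊗ₜ[ℤ] b'))) = D.testL (c * D.S' b') (D.mkL x) * a' := by
  induction x with
  | zero => simp
  | add x y hx hy => simp only [add_mul, map_add, hx, hy]
  | tmul a b => simp [mul_assoc, D.form_S']

theorem DualBasis.gammaL_mul (a b : A) (x y : A ⊗[ℤ] A) (hx : D.mkL x = E.gammaL a)
    (hy : D.mkL y = E.gammaL b) : E.gammaL (a * b) = D.mkL (x * y) := by
  symm
  rw [gammaL_eq_iff]
  intro c
  let g : A →ₗ[ℤ] A →ₗ[ℤ] A := LinearMap.mul ℤ A ∘ₗ (D.star a) ∘ₗ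
    LinearMap.mulLeft ℤ c ∘ₗ D.S'.toIntLinearMap
  let F : D.LTensor →ₗ[ℤ] A := BalTensor.fold _ _ g (fun l a' b' => by
    change D.star a (c * D.S' b') * (D.t (op l) * a') = D.star a (c * D.S' (D.s l * b')) * a'
    rw [E.S'_mul, E.S'_s, ← mul_assoc, ← mul_assoc, D.star_mul_t])
  have hF : ∀ y : A ⊗[ℤ] A, D.testL c (D.mkL (x * y)) = F (D.mkL y) := by
    intro y
    induction y with
    | zero => simp
    | add y z hy hz => simp only [mul_add, map_add, hy, hz]
    | tmul a' b' => rw [testL_mul_tmul, hx, testL_gammaL]; rfl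
  rw [hF, hy, gammaL_apply, E.distrib]
  simp only [map_sum]
  rfl

/-- The coproduct is colinear for right convolution: `γ(a ⋆ c) = a₍₁₎ ⊗ (a₍₂₎ ⋆ c)`. -/
theorem DualBasis.gammaL_star (a c : A) :
    E.gammaL (D.star a c) = BalTensor.mapRight _ _ (D.star.flip c)
      (fun l b => (D.s_mul_star l b c).symm) (E.gammaL a) := by
  symm
  rw [gammaL_eq_iff]
  intro d
  have : ∀ z : D.LTensor, D.testL d (BalTensor.mapRight _ _ (D.star.flip c)
      (fun l b => (D.s_mul_star l b c).symm) z) = D.testL (D.star c d) z := by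
    intro z
    refine LinearMap.congr_fun (f := D.testL d ∘ₗ BalTensor.mapRight _ _ (D.star.flip c)
      (fun l b => (D.s_mul_star l b c).symm)) (BalTensor.hom_ext fun a b => ?_) z
    change D.t (op (D.π (D.star (D.star b c) d))) * a = D.t (op (D.π (D.star b (D.star c d)))) * a
    rw [D.star_assoc]
  rw [this, testL_gammaL, D.star_assoc]

theorem DualBasis.gammaL_bimod (l l' : L) (a : A) (x : A ⊗[ℤ] A) (hx : D.mkL x = E.gammaL a) :
    E.gammaL (D.s l * D.t (op l') * a) = D.mkL ((D.s l ⊗ₜ[ℤ] D.t (op l')) * x) := by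
  symm
  rw [gammaL_eq_iff]
  intro c
  rw [testL_bimod, hx, testL_gammaL, D.s_mul_star, ← D.t_star, ← mul_assoc, D.comm]

theorem DualBasis.gammaL_one : E.gammaL 1 = D.mkL (1 ⊗ₜ[ℤ] 1) := by
  symm
  rw [gammaL_eq_iff]
  intro c
  rw [testL_mk, mul_one, ← D.one_star]

theorem DualBasis.gammaL_takeuchi (a : A) (l : L) (x : A ⊗[ℤ] A) (hx : D.mkL x = E.gammaL a) :
    D.mkL (x * (D.t (op l) ⊗ₜ[ℤ] 1)) = D.mkL (x * (1 ⊗ₜ[ℤ] D.s l)) := by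
  refine E.extL fun c => ?_
  rw [testL_mul_t, testL_mul_tmul, hx, testL_gammaL, testL_gammaL, E.S'_s, D.star_mul_t, mul_one]

/-- The elements `b i` generate the right factor of a tensor product over `L`, with coordinates
`⟨-, W i⟩`. -/
theorem DualBasis.mk_tForm {K : Type*} (ρ σ : K → A → A) (a b c : A) :
    BalTensor₃.mk ρ σ (fun (l : L) (a : A) => D.t (op l) * a) (fun (l : L) (a : A) => D.s l * a)
        (a ⊗ₜ[ℤ] (b ⊗ₜ[ℤ] c)) =
      ∑ i, BalTensor₃.mk ρ σ (fun (l : L) (a : A) => D.t (op l) * a)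
        (fun (l : L) (a : A) => D.s l * a)
        (a ⊗ₜ[ℤ] ((LinearMap.mul ℤ A ∘ₗ D.tForm (E.W i)) c b ⊗ₜ[ℤ] E.b i)) := by
  conv_lhs => rw [← E.left c]
  simp only [TensorProduct.tmul_sum, map_sum]
  refine Finset.sum_congr rfl fun i _ => ?_
  exact (BalTensor₃.mk_rel_right ρ σ (fun (l : L) (a : A) => D.t (op l) * a)
    (fun (l : L) (a : A) => D.s l * a) (D.π (D.star c (E.W i))) a b (E.b i)).symm

theorem DualBasis.gammaL_coassoc (a : A) (x y : A ⊗[ℤ] A) (hx : D.mkL x = E.gammaL a)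
    (hy : D.mkL y = E.gammaL a) :
    comulTensorId (fun (l : L) (a : A) => D.t (op l) * a) (fun (l : L) (a : A) => D.s l * a)
        E.gammaL x =
      idTensorComul (fun (l : L) (a : A) => D.t (op l) * a) (fun (l : L) (a : A) => D.s l * a)
        E.gammaL y := by
  refine comulTensorId_eq_idTensorComul E.gammaL E.gammaL
    (fun i => LinearMap.mul ℤ A ∘ₗ D.tForm (E.W i)) (fun i => D.star.flip (E.W i)) E.b
    ?_ ?_ ?_ ?_ ?_ ?_ ?_ a x y hx hy
  · intro i l b c
    change D.tForm _ c * (D.t (op l) * b) = D.tForm _ (D.s l * c) * b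
    rw [tForm_s_mul, mul_assoc]
  · intro i l b c
    change D.tForm _ c * (D.s l * b) = D.s l * (D.tForm _ c * b)
    rw [tForm_apply, ← mul_assoc, ← D.comm, mul_assoc]
  · intro i l b
    exact (D.s_mul_star l b _).symm
  · exact fun a b c => E.mk_tForm _ _ a b c
  · intro i c a
    have h := E.gammaL_bimod 1 (D.π (D.star c (E.W i))) a _ (E.gammaL_apply a).symm
    rw [map_one, one_mul] at h
    refine Eq.trans ?_ h.symm
    rw [gammaL_apply]
    simp only [Finset.mul_sum, map_sum, Algebra.TensorProduct.tmul_mul_tmul, one_mul]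
    rfl
  · intro i a
    exact E.testL_gammaL a (E.W i)
  · intro i a
    exact E.gammaL_star a (E.W i)

/-- The left bialgebroid of a Frobenius double ring with dual bases. -/
noncomputable def DualBasis.leftBialgebroid : LeftBialgebroid A L where
  s := D.s
  t := D.t
  comm := D.comm
  γ := E.gammaL
  π := D.π
  γ_bimod l l' a x hx := E.gammaL_bimod l l' a x hx
  π_bimod := D.π_bimod
  coassoc a x hx := E.gammaL_coassoc a x x hx hx
  counit_left a x hx := by
    have : mulMap (D.s.toAddMonoidHom.comp D.π) (AddMonoidHom.id A) x =
        BalTensor.lift (fun (l : L) (a : A) => D.t (op l) * a) (fun (l : L) (a : A) => D.s l * a)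
          (mulMap (D.s.toAddMonoidHom.comp D.π) (AddMonoidHom.id A))
          (fun l a b => by simp [D.π_t_mul, mul_assoc]) (BalTensor.mk _ _ x) := rfl
    rw [this, hx, gammaL_apply]
    refine Eq.trans ?_ (E.left a)
    simp only [map_sum]
    rfl
  counit_right a x hx := by
    have h := E.testL_gammaL a D.Υ
    rw [D.star_Υ] at h
    refine Eq.trans ?_ ((congrArg (D.testL D.Υ) hx).trans h)
    clear hx h
    induction x with
    | zero => simp
    | add x y hx hy => simp only [map_add, hx, hy]
    | tmul a b =>
      refine Eq.trans ?_ (D.testL_mk D.Υ a b).symm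
      simp [D.star_Υ]
  takeuchi a l x hx := E.gammaL_takeuchi a l x hx
  γ_one := E.gammaL_one
  γ_mul a b x y hx hy := E.gammaL_mul a b x y hx hy
  π_one := D.π_one
  π_mul_s := D.π_mul_s
  π_mul_t := D.π_mul_t

end FrobeniusDoubleRing

/-! ### The integral of the left bialgebroid -/

namespace FrobeniusDoubleRing

namespace DualBasis

variable {A L : Type*} [Ring A] [Ring L] {D : FrobeniusDoubleRing A L} {n : ℕ} (E : D.DualBasis n)

theorem gammaL_Υ : E.gammaL D.Υ = D.mkL (∑ i, E.W i ⊗ₜ[ℤ] E.b i) := by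
  rw [gammaL_apply]
  simp only [D.Υ_star]

theorem hitDualStar_Υ (φ : E.leftBialgebroid.DualStar) :
    E.leftBialgebroid.hitDualStar D.Υ φ = ∑ i, D.s (φ.1 (E.W i)) * E.b i := by
  change BalTensor.lift _ _ _ _ (E.gammaL D.Υ) = _
  rw [gammaL_Υ]
  simp only [map_sum]
  rfl

theorem hitStarDual_Υ (φ : E.leftBialgebroid.StarDual) :
    E.leftBialgebroid.hitStarDual D.Υ φ = ∑ i, D.t (op (φ.1 (E.b i))) * E.W i := by
  change BalTensor.lift _ _ _ _ (E.gammaL D.Υ) = _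
  rw [gammaL_Υ]
  simp only [map_sum]
  rfl

/-- The functional `⟨c, -⟩`. -/
noncomputable def dualStarOf (c : A) : E.leftBialgebroid.DualStar :=
  ⟨D.π.comp (D.star c).toAddMonoidHom, fun l a => by
    change D.π (D.star c (D.t (op l) * a)) = D.π (D.star c a) * l
    rw [← D.t_mul_star, D.π_t_mul]⟩

/-- The functional `⟨-, c⟩`. -/
noncomputable def starDualOf (c : A) : E.leftBialgebroid.StarDual :=
  ⟨D.π.comp (D.star.flip c).toAddMonoidHom, fun l a => by
    change D.π (D.star (D.s l * a) c) = l * D.π (D.star a c)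
    rw [← D.s_mul_star, D.π_s_mul]⟩

theorem dualStarOf_apply (c a : A) : (E.dualStarOf c).1 a = D.π (D.star c a) := rfl

theorem starDualOf_apply (c a : A) : (E.starDualOf c).1 a = D.π (D.star a c) := rfl

theorem hitDualStar_dualStarOf (c : A) :
    E.leftBialgebroid.hitDualStar D.Υ (E.dualStarOf c) = c := by
  rw [hitDualStar_Υ]
  exact E.left c

theorem hitStarDual_starDualOf (c : A) :
    E.leftBialgebroid.hitStarDual D.Υ (E.starDualOf c) = c := by
  rw [hitStarDual_Υ]
  exact E.right c

theorem dualStarOf_hitDualStar (φ : E.leftBialgebroid.DualStar) :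
    E.dualStarOf (E.leftBialgebroid.hitDualStar D.Υ φ) = φ := by
  refine Subtype.ext (AddMonoidHom.ext fun a => ?_)
  rw [dualStarOf_apply, hitDualStar_Υ]
  conv_rhs => rw [← E.right a]
  simp only [map_sum, LinearMap.sum_apply]
  refine Finset.sum_congr rfl fun i _ => ?_
  rw [← D.s_mul_star, D.π_s_mul]
  exact (φ.2 _ _).symm

theorem starDualOf_hitStarDual (φ : E.leftBialgebroid.StarDual) :
    E.starDualOf (E.leftBialgebroid.hitStarDual D.Υ φ) = φ := by
  refine Subtype.ext (AddMonoidHom.ext fun a => ?_)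
  rw [starDualOf_apply, hitStarDual_Υ]
  conv_rhs => rw [← E.left a]
  simp only [map_sum]
  refine Finset.sum_congr rfl fun i _ => ?_
  rw [← D.t_mul_star, D.π_t_mul]
  exact (φ.2 _ _).symm

theorem hitDualStar_bijective :
    Function.Bijective fun φ : E.leftBialgebroid.DualStar =>
      E.leftBialgebroid.hitDualStar D.Υ φ :=
  Function.bijective_iff_has_inverse.2
    ⟨E.dualStarOf, E.dualStarOf_hitDualStar, E.hitDualStar_dualStarOf⟩

theorem hitStarDual_bijective :
    Function.Bijective fun φ : E.leftBialgebroid.StarDual =>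
      E.leftBialgebroid.hitStarDual D.Υ φ :=
  Function.bijective_iff_has_inverse.2
    ⟨E.starDualOf, E.starDualOf_hitStarDual, E.hitStarDual_starDualOf⟩

theorem hitDualStar_act (ρ : E.leftBialgebroid.DualStar)
    (hρ : E.leftBialgebroid.hitDualStar D.Υ ρ = 1) (a : A) :
    E.leftBialgebroid.hitDualStar D.Υ (E.leftBialgebroid.actDualStar a ρ) = D.S a := by
  rw [← E.hitDualStar_dualStarOf (D.S a)]
  congr 1
  rw [← E.dualStarOf_hitDualStar ρ, hρ]
  refine Subtype.ext (AddMonoidHom.ext fun b => ?_)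
  change D.π (D.star 1 (b * a)) = D.π (D.star (D.S a) b)
  rw [← D.form_S, one_mul]

theorem hitStarDual_act (ρ : E.leftBialgebroid.StarDual)
    (hρ : E.leftBialgebroid.hitStarDual D.Υ ρ = 1) (a : A) :
    E.leftBialgebroid.hitStarDual D.Υ (E.leftBialgebroid.actStarDual a ρ) = D.S' a := by
  rw [← E.hitStarDual_starDualOf (D.S' a)]
  congr 1
  rw [← E.starDualOf_hitStarDual ρ, hρ]
  refine Subtype.ext (AddMonoidHom.ext fun b => ?_)
  change D.π (D.star (b * a) 1) = D.π (D.star b (D.S' a))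
  rw [D.form_S', one_mul]

theorem leftBialgebroid_isFinite : E.leftBialgebroid.IsFinite := by
  constructor
  · let _ : Module L A := Module.compHom A E.leftBialgebroid.s
    exact Module.finite_and_projective_of_dualBasis E.b (fun i a => D.π (D.star a (E.W i)))
      (fun i x y => by simp) (fun i l x => (E.starDualOf (E.W i)).2 l x) (fun x => E.left x)
  · let _ : Module Lᵐᵒᵖ A := Module.compHom A E.leftBialgebroid.t
    exact Module.finite_and_projective_of_dualBasis E.W
      (fun i a => op (D.π (D.star (E.b i) a))) (fun i x y => by simp)
      (fun i l x => congrArg op ((E.dualStarOf (E.b i)).2 (unop l) x)) (fun x => E.right x)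

theorem slide_left (a : A) (x : A ⊗[ℤ] A) (hx : D.mkL x = E.gammaL D.Υ) :
    D.mkL (x * (a ⊗ₜ[ℤ] 1)) = D.mkL (x * (1 ⊗ₜ[ℤ] D.S a)) := by
  refine E.extL fun c => ?_
  rw [testL_mul_tmul, testL_mul_tmul, hx, testL_gammaL, testL_gammaL, E.S'_S, D.Υ_star, D.Υ_star,
    E.S'_one, mul_one, mul_one]

theorem slide_right (a : A) (x : A ⊗[ℤ] A) (hx : D.mkL x = E.gammaL D.Υ) :
    D.mkL (x * (1 ⊗ₜ[ℤ] a)) = D.mkL (x * (D.S' a ⊗ₜ[ℤ] 1)) := by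
  rw [E.slide_left _ x hx, E.S_S']

/-- `Υ` is a non-degenerate right integral: the Frobenius form identifies `c` with the functionals
`⟨c, -⟩` and `⟨-, c⟩`, and the Fourier transforms defined by `Υ` are the inverse maps. -/
theorem isNondegenerateRightIntegral :
    E.leftBialgebroid.IsNondegenerateRightIntegral D.Υ where
  finite := E.leftBialgebroid_isFinite
  bijective_star := E.hitStarDual_bijective
  bijective_dual := E.hitDualStar_bijective
  slide_left ρ hρ a x hx := by
    rw [E.hitDualStar_act ρ hρ]
    exact E.slide_left a x hx
  slide_right ρ hρ a x hx := by
    rw [E.hitStarDual_act ρ hρ]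
    exact E.slide_right a x hx

/-- The map `D.S` as an additive equivalence; in the presence of dual bases, `D.S'` is its inverse. -/
def antipode : A ≃+ A where
  toFun := D.S
  invFun := D.S'
  left_inv := E.S'_S
  right_inv := E.S_S'
  map_add' := D.S.map_add

end DualBasis

end FrobeniusDoubleRing

/-! ### The right bialgebroid -/

namespace FrobeniusDoubleRing

namespace DualBasis

variable {A L : Type*} [Ring A] [Ring L] {D : FrobeniusDoubleRing A L} {n : ℕ} (E : D.DualBasis n)
variable {R : Type*} [Ring R] (f : Lᵐᵒᵖ ≃+* R)

/-- The source map `f(l) ↦ S(s(l))` of the right bialgebroid. -/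
def sR : R →+* A where
  toFun r := D.S (D.s (unop (f.symm r)))
  map_one' := by simp [E.S_one]
  map_mul' x y := by simp [E.S_mul]
  map_zero' := by simp
  map_add' x y := by simp

/-- The target map `f(l) ↦ s(l)` of the right bialgebroid. -/
def tR (_ : D.DualBasis n) (f : Lᵐᵒᵖ ≃+* R) : Rᵐᵒᵖ →+* A where
  toFun r := D.s (unop (f.symm (unop r)))
  map_one' := by simp
  map_mul' x y := by simp
  map_zero' := by simp
  map_add' x y := by simp

theorem sR_apply (l : L) : E.sR f (f (op l)) = D.S (D.s l) := by simp [sR]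

theorem tR_apply (l : L) : E.tR f (op (f (op l))) = D.s l := by simp [tR]

/-- The tensor product `A^R ⊗ ^R A`, where `a · r = a s_R(r)` and `r · a = a t_R(r)`. -/
abbrev RTensor : Type _ :=
  BalTensor (fun (r : R) (a : A) => a * E.sR f r) (fun (r : R) (a : A) => a * E.tR f (op r))

/-- The projection `A ⊗_ℤ A → A^R ⊗ ^R A`. -/
def mkR : (A ⊗[ℤ] A) →ₗ[ℤ] E.RTensor f := BalTensor.mk _ _

theorem mkR_surjective : Function.Surjective (E.mkR f) := BalTensor.mk_surjective _ _

theorem mkR_rel (l : L) (a b : A) :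
    E.mkR f ((a * D.S (D.s l)) ⊗ₜ[ℤ] b) = E.mkR f (a ⊗ₜ[ℤ] (b * D.s l)) := by
  have := BalTensor.mk_rel (fun (r : R) (a : A) => a * E.sR f r)
    (fun (r : R) (a : A) => a * E.tR f (op r)) (f (op l)) a b
  rwa [sR_apply, tR_apply] at this

/-- `a ⊗ b ↦ S(b) ⊗ S(a)`, from `A_L ⊗ _L A` to `A^R ⊗ ^R A`. -/
noncomputable def flipL : D.LTensor →ₗ[ℤ] E.RTensor f :=
  BalTensor.lift _ _ (E.mkR f ∘ₗ flipMap D.S) (fun l a b => by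
    change E.mkR f (D.S b ⊗ₜ[ℤ] D.S (D.t (op l) * a)) = E.mkR f (D.S (D.s l * b) ⊗ₜ[ℤ] D.S a)
    rw [E.S_mul, E.S_mul, E.S_t, mkR_rel])

/-- `a ⊗ b ↦ S'(b) ⊗ S'(a)`, from `A^R ⊗ ^R A` to `A_L ⊗ _L A`. -/
noncomputable def flipR : E.RTensor f →ₗ[ℤ] D.LTensor :=
  BalTensor.lift _ _ (D.mkL ∘ₗ flipMap D.S') (fun r a b => by
    obtain ⟨⟨l⟩, rfl⟩ := f.surjective r
    change D.mkL (D.S' b ⊗ₜ[ℤ] D.S' (a * E.sR f (f (op l)))) =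
      D.mkL (D.S' (b * E.tR f (op (f (op l)))) ⊗ₜ[ℤ] D.S' a)
    rw [sR_apply, tR_apply, E.S'_mul, E.S'_mul, E.S'_S, E.S'_s, mkL_rel])

@[simp]
theorem flipL_mkL (x : A ⊗[ℤ] A) : E.flipL f (D.mkL x) = E.mkR f (flipMap D.S x) := rfl

@[simp]
theorem flipR_mkR (x : A ⊗[ℤ] A) : E.flipR f (E.mkR f x) = D.mkL (flipMap D.S' x) := rfl

@[simp]
theorem flipL_flipR (z : E.RTensor f) : E.flipL f (E.flipR f z) = z := by
  obtain ⟨x, rfl⟩ := E.mkR_surjective f z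
  rw [flipR_mkR, flipL_mkL, flipMap_flipMap _ _ E.S_S']

@[simp]
theorem flipR_flipL (z : D.LTensor) : E.flipR f (E.flipL f z) = z := by
  obtain ⟨x, rfl⟩ := D.mkL_surjective z
  rw [flipL_mkL, flipR_mkR, flipMap_flipMap _ _ E.S'_S]

theorem mkR_eq_iff {x y : A ⊗[ℤ] A} :
    E.mkR f x = E.mkR f y ↔ D.mkL (flipMap D.S' x) = D.mkL (flipMap D.S' y) := by
  rw [← E.flipR_mkR f, ← E.flipR_mkR f]
  exact ⟨fun h => by rw [h], fun h => by rw [← E.flipL_flipR f (E.mkR f x), h, flipL_flipR]⟩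

/-- The coproduct `γ_R(S a) = S(a₍₂₎) ⊗ S(a₍₁₎)`. -/
noncomputable def gammaR : A →ₗ[ℤ] E.RTensor f :=
  E.flipL f ∘ₗ E.gammaL ∘ₗ D.S'.toIntLinearMap

theorem gammaR_S (a : A) : E.gammaR f (D.S a) = E.flipL f (E.gammaL a) := by
  change E.flipL f (E.gammaL (D.S' (D.S a))) = _
  rw [E.S'_S]

theorem mkR_eq_gammaR {a : A} {x : A ⊗[ℤ] A} :
    E.mkR f x = E.gammaR f a ↔ D.mkL (flipMap D.S' x) = E.gammaL (D.S' a) := by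
  conv_lhs => rw [← E.S_S' a, gammaR_S]
  rw [← E.flipR_mkR f]
  exact ⟨fun h => by rw [h, flipR_flipL], fun h => by rw [← h, flipL_flipR]⟩

theorem gammaR_apply (a : A) :
    E.gammaR f a = E.mkR f (∑ i, D.S (E.b i) ⊗ₜ[ℤ] D.star (D.S (E.W i)) a) := by
  conv_lhs => rw [← E.S_S' a, gammaR_S, gammaL_apply, flipL_mkL]
  simp only [map_sum, flipMap_tmul, D.S_star, E.S_S']

theorem gammaR_mul (a b : A) (x y : A ⊗[ℤ] A) (hx : E.mkR f x = E.gammaR f a)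
    (hy : E.mkR f y = E.gammaR f b) : E.gammaR f (a * b) = E.mkR f (x * y) := by
  symm
  rw [mkR_eq_gammaR] at *
  rw [flipMap_mul _ E.S'_mul, E.S'_mul, E.gammaL_mul _ _ _ _ hy hx]

theorem gammaR_bimod (l l' : L) (a : A) (x : A ⊗[ℤ] A) (hx : E.mkR f x = E.gammaR f a) :
    E.gammaR f (a * (D.S (D.s l') * D.s l)) = E.mkR f (x * (D.s l ⊗ₜ[ℤ] D.S (D.s l'))) := by
  symm
  rw [mkR_eq_gammaR] at *
  rw [flipMap_mul _ E.S'_mul, flipMap_tmul, E.S'_mul, E.S'_mul, E.S'_S, E.S'_s, ← D.comm,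
    E.gammaL_bimod _ _ _ _ hx]

theorem gammaR_one : E.gammaR f 1 = E.mkR f (1 ⊗ₜ[ℤ] 1) := by
  symm
  rw [mkR_eq_gammaR, flipMap_tmul, E.S'_one, gammaL_one]

theorem gammaR_takeuchi (a : A) (l : L) (x : A ⊗[ℤ] A) (hx : E.mkR f x = E.gammaR f a) :
    E.mkR f ((D.S (D.s l) ⊗ₜ[ℤ] 1) * x) = E.mkR f ((1 ⊗ₜ[ℤ] D.s l) * x) := by
  rw [mkR_eq_gammaR] at hx
  rw [mkR_eq_iff, flipMap_mul _ E.S'_mul, flipMap_mul _ E.S'_mul, flipMap_tmul, flipMap_tmul,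
    E.S'_S, E.S'_s, E.S'_one, E.gammaL_takeuchi _ _ _ hx]

theorem star_mul_s (E : D.DualBasis n) (l : L) (a b : A) : D.star a b * D.s l = D.star (a * D.s l) b := by
  rw [← E.S_S' (D.star a b * D.s l), E.S'_mul, E.S'_s, E.S'_star, D.t_mul_star, D.S_star, E.S_mul,
    E.S_t, E.S_S', E.S_S']

/-- `b ↦ S(s(⟨c, S'(b)⟩))` -/
noncomputable def sForm (_ : D.DualBasis n) (c : A) : A →ₗ[ℤ] A :=
  ((D.S.comp D.s.toAddMonoidHom).comp D.π).toIntLinearMap ∘ₗ D.star c ∘ₗ D.S'.toIntLinearMap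

theorem sForm_apply (c b : A) : E.sForm c b = D.S (D.s (D.π (D.star c (D.S' b)))) := rfl

theorem sForm_mul_s (l : L) (b c : A) :
    E.sForm c (b * D.s l) = D.S (D.s l) * E.sForm c b := by
  rw [sForm_apply, sForm_apply, E.S'_mul, E.S'_s, ← D.t_mul_star, D.π_t_mul, map_mul, E.S_mul]

theorem S_s_comm (E : D.DualBasis n) (l l' : L) : D.S (D.s l') * D.s l = D.s l * D.S (D.s l') := by
  rw [← E.S_t l, ← E.S_mul, ← E.S_mul, D.comm]

/-- The contraction `y ⊗ z ↦ y S(s(⟨c, S'(z)⟩))` on `A^R ⊗ ^R A`, applied to `γ_R(a)`. -/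
theorem fold_gammaR (c a : A)
    (h : ∀ (r : R) (y z : A), ((LinearMap.mul ℤ A).flip ∘ₗ E.sForm c) z (y * E.sR f r) =
      ((LinearMap.mul ℤ A).flip ∘ₗ E.sForm c) (z * E.tR f (op r)) y) :
    BalTensor.fold _ _ ((LinearMap.mul ℤ A).flip ∘ₗ E.sForm c) h (E.gammaR f a) =
      D.star a (D.S c) := by
  rw [gammaR_apply]
  simp only [map_sum]
  change ∑ i, D.S (E.b i) * D.S (D.s (D.π (D.star c (D.S' (D.star (D.S (E.W i)) a))))) = _
  have : ∀ i, D.S (E.b i) * D.S (D.s (D.π (D.star c (D.S' (D.star (D.S (E.W i)) a))))) =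
      D.S (D.s (D.π (D.star (D.star c (D.S' a)) (E.W i))) * E.b i) := by
    intro i
    rw [E.S_mul, E.S'_star, E.S'_S, D.star_assoc]
  simp only [this]
  rw [← map_sum, E.left, D.S_star, E.S_S']

theorem contract_sForm_rel (c : A) (r : R) (y z : A) :
    ((LinearMap.mul ℤ A).flip ∘ₗ E.sForm c) z (y * E.sR f r) =
      ((LinearMap.mul ℤ A).flip ∘ₗ E.sForm c) (z * E.tR f (op r)) y := by
  obtain ⟨⟨l⟩, rfl⟩ := f.surjective r
  change y * E.sR f (f (op l)) * E.sForm c z = y * E.sForm c (z * E.tR f (op (f (op l))))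
  rw [sR_apply, tR_apply, sForm_mul_s, mul_assoc]

/-- The elements `S(W i)` generate the right factor of a tensor product over `R`, with
coordinates `⟨b i, S'(-)⟩`. -/
theorem mk_sForm {K : Type*} (ρ σ : K → A → A) (a b c : A) :
    BalTensor₃.mk ρ σ (fun (r : R) (a : A) => a * E.sR f r)
        (fun (r : R) (a : A) => a * E.tR f (op r)) (a ⊗ₜ[ℤ] (b ⊗ₜ[ℤ] c)) =
      ∑ i, BalTensor₃.mk ρ σ (fun (r : R) (a : A) => a * E.sR f r)
        (fun (r : R) (a : A) => a * E.tR f (op r))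
        (a ⊗ₜ[ℤ] (((LinearMap.mul ℤ A).flip ∘ₗ E.sForm (E.b i)) c b ⊗ₜ[ℤ] D.S (E.W i))) := by
  have hc : c = ∑ i, D.S (E.W i) * D.s (D.π (D.star (E.b i) (D.S' c))) := by
    conv_lhs => rw [← E.S_S' c, ← E.right (D.S' c)]
    simp only [map_sum, E.S_mul, E.S_t]
  conv_lhs => rw [hc]
  simp only [TensorProduct.tmul_sum, map_sum]
  refine Finset.sum_congr rfl fun i _ => ?_
  have := BalTensor₃.mk_rel_right ρ σ (fun (r : R) (a : A) => a * E.sR f r)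
    (fun (r : R) (a : A) => a * E.tR f (op r)) (f (op (D.π (D.star (E.b i) (D.S' c))))) a b
    (D.S (E.W i))
  rw [sR_apply, tR_apply] at this
  exact this.symm

theorem star_flip_mul_tR (d : A) (r : R) (b : A) :
    D.star.flip d (b * E.tR f (op r)) = D.star.flip d b * E.tR f (op r) := by
  obtain ⟨⟨l⟩, rfl⟩ := f.surjective r
  change D.star (b * E.tR f (op (f (op l)))) d = D.star b d * E.tR f (op (f (op l)))
  rw [tR_apply, E.star_mul_s]

/-- The coproduct is colinear for right convolution: `γ_R(a ⋆ d) = a⁽¹⁾ ⊗ (a⁽²⁾ ⋆ d)`. -/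
theorem gammaR_star (a d : A) :
    E.gammaR f (D.star a d) =
      BalTensor.mapRight _ _ (D.star.flip d) (E.star_flip_mul_tR f d) (E.gammaR f a) := by
  rw [gammaR_apply, gammaR_apply]
  simp only [map_sum, ← D.star_assoc]
  rfl

theorem mapRight_sForm_gammaR (c z a : A)
    (h : ∀ (r : R) (b : A), ((LinearMap.mul ℤ A).flip ∘ₗ E.sForm c) z (b * E.tR f (op r)) =
      ((LinearMap.mul ℤ A).flip ∘ₗ E.sForm c) z b * E.tR f (op r)) :
    BalTensor.mapRight _ _ (((LinearMap.mul ℤ A).flip ∘ₗ E.sForm c) z) h (E.gammaR f a) =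
      E.gammaR f (a * E.sForm c z) := by
  have := E.gammaR_bimod f 1 (D.π (D.star c (D.S' z))) a _ (E.gammaR_apply f a).symm
  rw [map_one, mul_one] at this
  rw [sForm_apply, this, gammaR_apply]
  simp only [Finset.sum_mul, map_sum, Algebra.TensorProduct.tmul_mul_tmul, mul_one]
  rfl

theorem gammaR_coassoc (a : A) (x y : A ⊗[ℤ] A) (hx : E.mkR f x = E.gammaR f a)
    (hy : E.mkR f y = E.gammaR f a) :
    comulTensorId (fun (r : R) (a : A) => a * E.sR f r) (fun (r : R) (a : A) => a * E.tR f (op r))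
        (E.gammaR f) x =
      idTensorComul (fun (r : R) (a : A) => a * E.sR f r)
        (fun (r : R) (a : A) => a * E.tR f (op r)) (E.gammaR f) y := by
  have hσ : ∀ (c : A) (r : R) (b z : A),
      ((LinearMap.mul ℤ A).flip ∘ₗ E.sForm c) z (b * E.tR f (op r)) =
        ((LinearMap.mul ℤ A).flip ∘ₗ E.sForm c) z b * E.tR f (op r) := by
    intro c r b z
    obtain ⟨⟨l⟩, rfl⟩ := f.surjective r
    change b * E.tR f (op (f (op l))) * E.sForm c z = b * E.sForm c z * E.tR f (op (f (op l)))
    rw [tR_apply, sForm_apply, mul_assoc, mul_assoc, E.S_s_comm]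
  exact comulTensorId_eq_idTensorComul (E.gammaR f) (E.gammaR f)
    (fun i => (LinearMap.mul ℤ A).flip ∘ₗ E.sForm (E.b i)) (fun i => D.star.flip (D.S (E.b i)))
    (fun i => D.S (E.W i)) (fun i => E.contract_sForm_rel f (E.b i)) (fun i => hσ (E.b i))
    (fun i => E.star_flip_mul_tR f _) (fun a b c => E.mk_sForm f _ _ a b c)
    (fun i c a => E.mapRight_sForm_gammaR f (E.b i) c a _)
    (fun i a => E.fold_gammaR f (E.b i) a _) (fun i a => E.gammaR_star f a _) a x y hx hy

/-- The counit of the right bialgebroid. -/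
def piR (_ : D.DualBasis n) (f : Lᵐᵒᵖ ≃+* R) : A →+ R where
  toFun a := f (op (D.π (D.S' a)))
  map_zero' := by simp
  map_add' x y := by simp

theorem piR_apply (a : A) : E.piR f a = f (op (D.π (D.S' a))) := rfl

/-- The right bialgebroid that corresponds to the left bialgebroid under the anti-automorphism `S`,
over a base ring `R` that is identified with the opposite of `L`. -/
noncomputable def rightBialgebroid : RightBialgebroid A R where
  s := E.sR f
  t := E.tR f
  comm r r' := by
    obtain ⟨⟨l⟩, rfl⟩ := f.surjective r
    obtain ⟨⟨l'⟩, rfl⟩ := f.surjective r'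
    exact (congrArg₂ _ (E.sR_apply f l) (E.tR_apply f l')).trans ((E.S_s_comm l' l).trans
      (congrArg₂ _ (E.tR_apply f l') (E.sR_apply f l)).symm)
  γ := E.gammaR f
  π := E.piR f
  γ_bimod r r' a x hx := by
    obtain ⟨⟨l⟩, rfl⟩ := f.surjective r
    obtain ⟨⟨l'⟩, rfl⟩ := f.surjective r'
    have := E.gammaR_bimod f l l' a x hx
    rw [← E.sR_apply f, ← E.tR_apply f] at this
    exact this
  π_bimod r r' a := by
    obtain ⟨⟨l⟩, rfl⟩ := f.surjective r
    obtain ⟨⟨l'⟩, rfl⟩ := f.surjective r'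
    have h : D.S' (a * (D.S (D.s l') * D.s l)) = D.s l' * D.t (op l) * D.S' a := by
      rw [E.S'_mul, E.S'_mul, E.S'_S, E.S'_s, D.comm]
    have := congrArg (fun x => f (op (D.π x))) h
    rw [← E.sR_apply f, ← E.tR_apply f] at this
    refine this.trans ?_
    rw [D.π_bimod, op_mul, op_mul, map_mul, map_mul, ← mul_assoc]
    rfl
  coassoc a x hx := E.gammaR_coassoc f a x x hx hx
  counit_left a x hx := by
    have h := E.leftBialgebroid.counit_right _ _ ((E.mkR_eq_gammaR f).1 hx)
    refine Eq.trans ?_ ((congrArg D.S h).trans (E.S_S' a))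
    clear h hx
    induction x with
    | zero => simp
    | add x y hx hy => simp only [map_add, hx, hy]
    | tmul a b =>
      change b * D.s (unop (f.symm (f (op (D.π (D.S' a)))))) =
        D.S (D.t (op (D.π (D.S' a))) * D.S' b)
      rw [E.S_mul, E.S_t, E.S_S', RingEquiv.symm_apply_apply, unop_op]
  counit_right a x hx := by
    have h := E.leftBialgebroid.counit_left _ _ ((E.mkR_eq_gammaR f).1 hx)
    refine Eq.trans ?_ ((congrArg D.S h).trans (E.S_S' a))
    clear h hx
    induction x with
    | zero => simp
    | add x y hx hy => simp only [map_add, hx, hy]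
    | tmul a b =>
      change a * D.S (D.s (unop (f.symm (f (op (D.π (D.S' b))))))) =
        D.S (D.s (D.π (D.S' b)) * D.S' a)
      rw [E.S_mul, E.S_S', RingEquiv.symm_apply_apply, unop_op]
  takeuchi a r x hx := by
    obtain ⟨⟨l⟩, rfl⟩ := f.surjective r
    have := E.gammaR_takeuchi f a l x hx
    rw [← E.sR_apply f, ← E.tR_apply f] at this
    exact this
  γ_one := E.gammaR_one f
  γ_mul a b x y hx hy := E.gammaR_mul f a b x y hx hy
  π_one := by
    rw [piR_apply, E.S'_one, D.π_one, op_one, map_one]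
  π_s_mul a b := by
    change f (op (D.π (D.S' (D.S (D.s (unop (f.symm (f (op (D.π (D.S' a))))))) * b)))) =
      f (op (D.π (D.S' (a * b))))
    rw [RingEquiv.symm_apply_apply, unop_op, E.S'_mul, E.S'_S, D.π_mul_s, E.S'_mul]
  π_t_mul a b := by
    change f (op (D.π (D.S' (D.s (unop (f.symm (f (op (D.π (D.S' a)))))) * b)))) =
      f (op (D.π (D.S' (a * b))))
    rw [RingEquiv.symm_apply_apply, unop_op, E.S'_mul, E.S'_s, D.π_mul_t, E.S'_mul]

end DualBasis

end FrobeniusDoubleRing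

/-! ### The Hopf algebroid -/

namespace FrobeniusDoubleRing

namespace DualBasis

variable {A L : Type*} [Ring A] [Ring L] {D : FrobeniusDoubleRing A L} {n : ℕ} (E : D.DualBasis n)
variable {R : Type*} [Ring R] (f : Lᵐᵒᵖ ≃+* R)

theorem exists_S_s_eq_t (E : D.DualBasis n) (l : L) : ∃ l', D.S (D.s l') = D.t (op l) :=
  ⟨D.π (D.S' (D.S' (D.t (op l)))), by rw [E.S_s_π_S', E.S_S', D.π_t]⟩

theorem exists_t_eq_S_s (E : D.DualBasis n) (l : L) : ∃ l', D.t (op l') = D.S (D.s l) :=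
  ⟨D.π (D.S (D.S (D.s l))), by rw [← E.S_s_π_S', E.S'_S, D.π_s]⟩

theorem range_s : Set.range D.s = Set.range (E.tR f) := by
  ext a
  constructor
  · rintro ⟨l, rfl⟩
    exact ⟨_, E.tR_apply f l⟩
  · rintro ⟨⟨r⟩, rfl⟩
    obtain ⟨⟨l⟩, rfl⟩ := f.surjective r
    exact ⟨l, (E.tR_apply f l).symm⟩

theorem range_t : Set.range D.t = Set.range (E.sR f) := by
  ext a
  constructor
  · rintro ⟨⟨l⟩, rfl⟩
    obtain ⟨l', h⟩ := E.exists_S_s_eq_t l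
    exact ⟨_, (E.sR_apply f l').trans h⟩
  · rintro ⟨r, rfl⟩
    obtain ⟨⟨l⟩, rfl⟩ := f.surjective r
    obtain ⟨l', h⟩ := E.exists_t_eq_S_s l
    exact ⟨_, h.trans (E.sR_apply f l).symm⟩

theorem mixed_left (a : A) (x y : A ⊗[ℤ] A) (hx : E.mkR f x = E.gammaR f a)
    (hy : D.mkL y = E.gammaL a) :
    comulTensorId (fun (r : R) (a : A) => a * E.sR f r) (fun (r : R) (a : A) => a * E.tR f (op r))
        E.gammaL x =
      idTensorComul (fun (l : L) (a : A) => D.t (op l) * a) (fun (l : L) (a : A) => D.s l * a)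
        (E.gammaR f) y := by
  refine comulTensorId_eq_idTensorComul E.gammaL (E.gammaR f)
    (fun i => (LinearMap.mul ℤ A).flip ∘ₗ E.sForm (E.b i)) (fun i => D.star.flip (D.S (E.b i)))
    (fun i => D.S (E.W i)) (fun i => E.contract_sForm_rel f (E.b i)) (fun i l b c => ?_)
    (fun i l b => (D.s_mul_star l b _).symm) (fun a b c => E.mk_sForm f _ _ a b c)
    (fun i c a => ?_) (fun i a => E.fold_gammaR f (E.b i) a _) (fun i a => E.gammaL_star a _)
    a x y hx hy
  · change D.s l * b * E.sForm (E.b i) c = D.s l * (b * E.sForm (E.b i) c)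
    rw [mul_assoc]
  · change _ = E.gammaL (a * E.sForm (E.b i) c)
    obtain ⟨l, hl⟩ := E.exists_t_eq_S_s (D.π (D.star (E.b i) (D.S' c)))
    have ht : E.gammaL (D.t (op l)) = D.mkL (1 ⊗ₜ[ℤ] D.t (op l)) := by
      have := E.gammaL_bimod 1 l 1 _ E.gammaL_one.symm
      simpa using this
    have h := E.gammaL_mul _ _ _ _ (E.gammaL_apply a).symm ht.symm
    rw [hl] at h
    refine Eq.trans ?_ h.symm
    rw [gammaL_apply]
    simp only [Finset.sum_mul, map_sum, Algebra.TensorProduct.tmul_mul_tmul, mul_one]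
    rfl

theorem mixed_right (a : A) (x y : A ⊗[ℤ] A) (hx : D.mkL x = E.gammaL a)
    (hy : E.mkR f y = E.gammaR f a) :
    comulTensorId (fun (l : L) (a : A) => D.t (op l) * a) (fun (l : L) (a : A) => D.s l * a)
        (E.gammaR f) x =
      idTensorComul (fun (r : R) (a : A) => a * E.sR f r)
        (fun (r : R) (a : A) => a * E.tR f (op r)) E.gammaL y := by
  refine comulTensorId_eq_idTensorComul (E.gammaR f) E.gammaL
    (fun i => LinearMap.mul ℤ A ∘ₗ D.tForm (E.W i)) (fun i => D.star.flip (E.W i)) E.b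
    ?_ ?_ (fun i => E.star_flip_mul_tR f _) (fun a b c => E.mk_tForm _ _ a b c) ?_
    (fun i a => E.testL_gammaL a (E.W i)) (fun i a => E.gammaR_star f a _) a x y hx hy
  · intro i l b c
    change D.tForm _ c * (D.t (op l) * b) = D.tForm _ (D.s l * c) * b
    rw [tForm_s_mul, mul_assoc]
  · intro i r b c
    exact (mul_assoc _ _ _).symm
  · intro i c a
    change _ = E.gammaR f (D.tForm (E.W i) c * a)
    obtain ⟨l, hl⟩ := E.exists_S_s_eq_t (D.π (D.star c (E.W i)))
    have ht : E.gammaR f (D.S (D.s l)) = E.mkR f (1 ⊗ₜ[ℤ] D.S (D.s l)) := by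
      have := E.gammaR_bimod f 1 l 1 _ (E.gammaR_one f).symm
      simpa using this
    have h := E.gammaR_mul f _ _ _ _ ht.symm (E.gammaR_apply f a).symm
    rw [hl] at h
    refine Eq.trans ?_ h.symm
    rw [gammaR_apply]
    simp only [Finset.mul_sum, map_sum, Algebra.TensorProduct.tmul_mul_tmul, one_mul]
    rfl

theorem antipode_left (a : A) (x : A ⊗[ℤ] A) (hx : D.mkL x = E.gammaL a) :
    mulMap D.S (AddMonoidHom.id A) x = D.S (D.s (D.π (D.S' a))) := by
  let F : D.LTensor →ₗ[ℤ] A := BalTensor.lift _ _ (mulMap D.S (AddMonoidHom.id A)) (fun l a b => by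
    simp [E.S_mul, E.S_t, mul_assoc])
  have hF : mulMap D.S (AddMonoidHom.id A) x = F (D.mkL x) := rfl
  rw [hF, hx, gammaL_apply, ← E.star_Υ_mul_one, E.distrib]
  simp only [map_sum, E.S_mul, D.Υ_star, one_mul, E.S_S']
  rfl

theorem antipode_right (a : A) (x : A ⊗[ℤ] A) (hx : E.mkR f x = E.gammaR f a) :
    mulMap (AddMonoidHom.id A) D.S x = D.s (D.π a) := by
  have h := E.antipode_left _ _ ((E.mkR_eq_gammaR f).1 hx)
  rw [E.S_s_π_S', E.S_S'] at h
  refine Eq.trans ?_ ((congrArg D.S h).trans (E.S_t _))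
  clear h hx
  induction x with
  | zero => simp
  | add x y hx hy => simp only [map_add, hx, hy]
  | tmul a b => simp [E.S_mul, E.S_S']

theorem isHopfAlgebroid :
    IsHopfAlgebroid E.leftBialgebroid (E.rightBialgebroid f) E.antipode where
  base := ⟨f.symm⟩
  range_s := E.range_s f
  range_t := E.range_t f
  mixed_left a x y hx hy := E.mixed_left f a x y hx hy
  mixed_right a x y hx hy := E.mixed_right f a x y hx hy
  twist_left l l' a := by
    change D.S (D.t (op l) * a * D.t (op l')) = D.s l' * D.S a * D.s l
    rw [E.S_mul, E.S_mul, E.S_t, E.S_t, mul_assoc]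
  twist_right r r' a := by
    change D.S (D.s _ * a * D.s _) = D.S (D.s _) * D.S a * D.S (D.s _)
    rw [E.S_mul, E.S_mul, mul_assoc]
    rfl
  antipode_left a x hx := by
    refine (E.antipode_left a x hx).trans ?_
    change _ = D.S (D.s (unop (f.symm (f (op (D.π (D.S' a)))))))
    rw [RingEquiv.symm_apply_apply, unop_op]
  antipode_right a x hx := E.antipode_right f a x hx

/-- The antipode turns the coproduct of the right bialgebroid into that of the left one:
`γ_L(S a) = S(a⁽²⁾) ⊗ S(a⁽¹⁾)`. -/
theorem gammaL_S (a : A) (x : A ⊗[ℤ] A) (hx : E.mkR f x = E.gammaR f a) :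
    E.gammaL (D.S a) = D.mkL (flipMap D.S x) := by
  have hx' := (E.mkR_eq_gammaR f).1 hx
  -- The square of `S` is compatible with `star` and with `π`, hence with `γ_L`.
  have hπ : ∀ b : A, D.S (D.S (D.t (op (D.π b)))) = D.t (op (D.π (D.S (D.S b)))) := by
    intro b
    rw [E.S_t, ← E.S_s_π_S', E.S'_S]
  have key : ∀ (c : A) (y : A ⊗[ℤ] A),
      D.testL (D.S (D.S c)) (D.mkL (flipMap D.S (flipMap D.S y))) =
        D.S (D.S (D.testL c (D.mkL y))) := by
    intro c y
    induction y with
    | zero => simp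
    | add x y hx hy => simp only [map_add, hx, hy]
    | tmul a b =>
      simp only [flipMap_tmul, testL_mk]
      rw [← D.S_star, ← D.S_star, ← hπ, E.S_mul, E.S_mul]
  symm
  rw [gammaL_eq_iff]
  intro c
  obtain ⟨c, rfl⟩ : ∃ d, c = D.S (D.S d) := ⟨D.S' (D.S' c), by rw [E.S_S', E.S_S']⟩
  rw [← flipMap_flipMap D.S D.S' E.S_S' x, key, hx', testL_gammaL, D.S_star, D.S_star, E.S_S']

/-! ### Integrals of the Hopf algebroid -/

theorem isLeftIntegral : E.leftBialgebroid.IsLeftIntegral D.Υ := D.mul_Υ_s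

theorem isRightIntegral : (E.rightBialgebroid f).IsRightIntegral D.Υ := by
  intro a
  change D.Υ * a = D.Υ * D.S (D.s (unop (f.symm (f (op (D.π (D.S' a)))))))
  rw [RingEquiv.symm_apply_apply, unop_op, ← E.S_S' (D.Υ * a), E.S'_mul, E.S'_Υ, D.mul_Υ_s,
    E.S_mul, E.S_Υ]

/-- Functionals on `A^R` correspond to functionals on `_L A` under the antipode. -/
def dualStarEquiv : (E.rightBialgebroid f).DualStar ≃ E.leftBialgebroid.StarDual where
  toFun φ := ⟨((opAddEquiv (α := L)).symm.toAddMonoidHom.comp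
      (f.symm.toAddEquiv.toAddMonoidHom.comp φ.1)).comp D.S, fun l a => by
    change unop (f.symm (φ.1 (D.S (D.s l * a)))) = l * unop (f.symm (φ.1 (D.S a)))
    have := φ.2 (f (op l)) (D.S a)
    change φ.1 (D.S a * E.sR f (f (op l))) = _ at this
    rw [sR_apply, ← E.S_mul] at this
    rw [this]
    simp⟩
  invFun ψ := ⟨(f.toAddEquiv.toAddMonoidHom.comp
      ((opAddEquiv (α := L)).toAddMonoidHom.comp ψ.1)).comp D.S', fun r a => by
    obtain ⟨⟨l⟩, rfl⟩ := f.surjective r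
    change f (op (ψ.1 (D.S' (a * E.sR f (f (op l)))))) = f (op (ψ.1 (D.S' a))) * f (op l)
    rw [sR_apply, E.S'_mul, E.S'_S, ← map_mul, ← op_mul]
    exact congrArg (fun x => f (op x)) (ψ.2 l (D.S' a))⟩
  left_inv φ := by
    refine Subtype.ext (AddMonoidHom.ext fun a => ?_)
    change f (op (unop (f.symm (φ.1 (D.S (D.S' a)))))) = φ.1 a
    rw [E.S_S', op_unop, RingEquiv.apply_symm_apply]
  right_inv ψ := by
    refine Subtype.ext (AddMonoidHom.ext fun a => ?_)
    change unop (f.symm (f (op (ψ.1 (D.S' (D.S a)))))) = ψ.1 a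
    rw [E.S'_S, RingEquiv.symm_apply_apply, unop_op]

/-- Functionals on `^R A` correspond to functionals on `A_L` under the antipode. -/
def starDualEquiv : (E.rightBialgebroid f).StarDual ≃ E.leftBialgebroid.DualStar where
  toFun φ := ⟨((opAddEquiv (α := L)).symm.toAddMonoidHom.comp
      (f.symm.toAddEquiv.toAddMonoidHom.comp φ.1)).comp D.S, fun l a => by
    change unop (f.symm (φ.1 (D.S (D.t (op l) * a)))) = unop (f.symm (φ.1 (D.S a))) * l
    have := φ.2 (f (op l)) (D.S a)
    change φ.1 (D.S a * E.tR f (op (f (op l)))) = _ at this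
    rw [tR_apply, ← E.S_t, ← E.S_mul] at this
    rw [this]
    simp⟩
  invFun ψ := ⟨(f.toAddEquiv.toAddMonoidHom.comp
      ((opAddEquiv (α := L)).toAddMonoidHom.comp ψ.1)).comp D.S', fun r a => by
    obtain ⟨⟨l⟩, rfl⟩ := f.surjective r
    change f (op (ψ.1 (D.S' (a * E.tR f (op (f (op l))))))) = f (op l) * f (op (ψ.1 (D.S' a)))
    rw [tR_apply, E.S'_mul, E.S'_s, ← map_mul, ← op_mul]
    exact congrArg (fun x => f (op x)) (ψ.2 l (D.S' a))⟩
  left_inv φ := by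
    refine Subtype.ext (AddMonoidHom.ext fun a => ?_)
    change f (op (unop (f.symm (φ.1 (D.S (D.S' a)))))) = φ.1 a
    rw [E.S_S', op_unop, RingEquiv.apply_symm_apply]
  right_inv ψ := by
    refine Subtype.ext (AddMonoidHom.ext fun a => ?_)
    change unop (f.symm (f (op (ψ.1 (D.S' (D.S a)))))) = ψ.1 a
    rw [E.S'_S, RingEquiv.symm_apply_apply, unop_op]

theorem gammaR_Υ : E.gammaR f D.Υ = E.mkR f (∑ i, D.S (E.b i) ⊗ₜ[ℤ] D.S (E.W i)) := by
  rw [gammaR_apply]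
  simp only [D.star_Υ]

theorem right_hitDualStar_Υ (φ : (E.rightBialgebroid f).DualStar) :
    (E.rightBialgebroid f).hitDualStar φ D.Υ =
      D.S (E.leftBialgebroid.hitStarDual D.Υ (E.dualStarEquiv f φ)) := by
  rw [hitStarDual_Υ]
  change BalTensor.lift _ _ _ _ (E.gammaR f D.Υ) = _
  rw [gammaR_Υ]
  simp only [map_sum, E.S_mul, E.S_t]
  rfl

theorem right_hitStarDual_Υ (φ : (E.rightBialgebroid f).StarDual) :
    (E.rightBialgebroid f).hitStarDual φ D.Υ =
      D.S (E.leftBialgebroid.hitDualStar D.Υ (E.starDualEquiv f φ)) := by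
  rw [hitDualStar_Υ]
  change BalTensor.lift _ _ _ _ (E.gammaR f D.Υ) = _
  rw [gammaR_Υ]
  simp only [map_sum, E.S_mul]
  rfl

theorem right_hitDualStar_bijective :
    Function.Bijective fun φ : (E.rightBialgebroid f).DualStar =>
      (E.rightBialgebroid f).hitDualStar φ D.Υ := by
  simp only [right_hitDualStar_Υ]
  exact E.antipode.bijective.comp (E.hitStarDual_bijective.comp (E.dualStarEquiv f).bijective)

theorem right_hitStarDual_bijective :
    Function.Bijective fun φ : (E.rightBialgebroid f).StarDual =>
      (E.rightBialgebroid f).hitStarDual φ D.Υ := by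
  simp only [right_hitStarDual_Υ]
  exact E.antipode.bijective.comp (E.hitDualStar_bijective.comp (E.starDualEquiv f).bijective)

theorem right_hitStarDual_act (lam : (E.rightBialgebroid f).StarDual)
    (h : (E.rightBialgebroid f).hitStarDual lam D.Υ = 1) (a : A) :
    (E.rightBialgebroid f).hitStarDual ((E.rightBialgebroid f).actStarDual lam a) D.Υ =
      D.S a := by
  rw [right_hitStarDual_Υ] at h ⊢
  rw [← E.S_one] at h
  have := E.hitDualStar_act _ (E.antipode.injective h) (D.S' a)
  rw [E.S_S'] at this
  refine congrArg D.S (Eq.trans ?_ this)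
  congr 1
  refine Subtype.ext (AddMonoidHom.ext fun b => ?_)
  change unop (f.symm (lam.1 (a * D.S b))) = unop (f.symm (lam.1 (D.S (b * D.S' a))))
  rw [E.S_mul, E.S_S']

theorem right_hitDualStar_act (lam : (E.rightBialgebroid f).DualStar)
    (h : (E.rightBialgebroid f).hitDualStar lam D.Υ = 1) (a : A) :
    (E.rightBialgebroid f).hitDualStar ((E.rightBialgebroid f).actDualStar lam a) D.Υ =
      D.S' a := by
  rw [right_hitDualStar_Υ] at h ⊢
  rw [← E.S_one] at h
  have := E.hitStarDual_act _ (E.antipode.injective h) (D.S' a)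
  rw [← E.S_S' (D.S' a), ← this]
  congr 2
  refine Subtype.ext (AddMonoidHom.ext fun b => ?_)
  change unop (f.symm (lam.1 (a * D.S b))) = unop (f.symm (lam.1 (D.S (b * D.S' a))))
  rw [E.S_mul, E.S_S']

theorem rightBialgebroid_isFinite : (E.rightBialgebroid f).IsFinite := by
  constructor
  · let _ : Module Rᵐᵒᵖ A := Module.compHom A (RingHom.op (E.rightBialgebroid f).s)
    refine Module.finite_and_projective_of_dualBasis (fun i => D.S (E.b i))
      (fun i a => op (((E.dualStarEquiv f).symm (E.starDualOf (E.W i))).1 a))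
      (fun i x y => by simp) (fun i r x => congrArg op
        (((E.dualStarEquiv f).symm (E.starDualOf (E.W i))).2 (unop r) x)) (fun x => ?_)
    refine Eq.trans ?_ ((congrArg D.S (E.left (D.S' x))).trans (E.S_S' x))
    simp only [map_sum, E.S_mul]
    refine Finset.sum_congr rfl fun i _ => ?_
    change D.S (E.b i) * E.sR f (f (op _)) = _
    rw [sR_apply]
    rfl
  · let _ : Module R A := Module.compHom A (E.rightBialgebroid f).tOp
    refine Module.finite_and_projective_of_dualBasis (fun i => D.S (E.W i))
      (fun i a => ((E.starDualEquiv f).symm (E.dualStarOf (E.b i))).1 a)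
      (fun i x y => by simp)
      (fun i r x => ((E.starDualEquiv f).symm (E.dualStarOf (E.b i))).2 r x) (fun x => ?_)
    refine Eq.trans ?_ ((congrArg D.S (E.right (D.S' x))).trans (E.S_S' x))
    simp only [map_sum, E.S_mul, E.S_t]
    refine Finset.sum_congr rfl fun i _ => ?_
    change D.S (E.W i) * E.tR f (op (f (op _))) = _
    rw [tR_apply]
    rfl

theorem right_slide_right (a : A) (x : A ⊗[ℤ] A) (hx : E.mkR f x = E.gammaR f D.Υ) :
    E.mkR f ((1 ⊗ₜ[ℤ] a) * x) = E.mkR f ((D.S a ⊗ₜ[ℤ] 1) * x) := by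
  rw [mkR_eq_gammaR, E.S'_Υ] at hx
  rw [mkR_eq_iff, flipMap_mul _ E.S'_mul, flipMap_mul _ E.S'_mul, flipMap_tmul, flipMap_tmul,
    E.S'_one, E.S'_S, E.slide_left _ _ hx, E.S_S']

/-- `Υ` is a non-degenerate left integral of the right bialgebroid. -/
theorem isNondegenerateLeftIntegral :
    (E.rightBialgebroid f).IsNondegenerateLeftIntegral D.Υ where
  finite := E.rightBialgebroid_isFinite f
  bijective_dual := E.right_hitDualStar_bijective f
  bijective_star := E.right_hitStarDual_bijective f
  slide_right lam h a x hx := by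
    rw [E.right_hitStarDual_act f lam h]
    exact E.right_slide_right f a x hx
  slide_left lam h a x hx := by
    rw [E.right_hitDualStar_act f lam h]
    have := E.right_slide_right f (D.S' a) x hx
    rw [E.S_S'] at this
    exact this.symm

theorem isNondegLeftIntegralHopf :
    IsNondegLeftIntegralHopf E.leftBialgebroid (E.rightBialgebroid f) D.Υ where
  integral := E.isLeftIntegral
  bijective_dual := E.right_hitDualStar_bijective f
  bijective_star := E.right_hitStarDual_bijective f

theorem isNondegRightIntegralHopf :
    IsNondegRightIntegralHopf E.leftBialgebroid (E.rightBialgebroid f) D.Υ where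
  integral := E.isRightIntegral f
  bijective_star := E.hitStarDual_bijective
  bijective_dual := E.hitDualStar_bijective

theorem isRightPartner : IsRightPartner E.leftBialgebroid E.antipode
    (E.rightBialgebroid (RingEquiv.refl Lᵐᵒᵖ)) where
  s_eq _ := rfl
  t_eq _ := rfl
  π_eq _ := rfl
  γ_eq a _ hx := (E.gammaR_S _ a).trans (congrArg (E.flipL _) hx.symm)

end DualBasis

/-- Over a base ring `Rᵐᵒᵖ`, the left bialgebroid is the partner of the right bialgebroid over
`R`. -/
theorem DualBasis.isLeftPartner {A R : Type*} [Ring A] [Ring R] {D : FrobeniusDoubleRing A Rᵐᵒᵖ}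
    {n : ℕ} (E : D.DualBasis n) :
    IsLeftPartner (E.rightBialgebroid (RingEquiv.opOp R).symm) E.antipode E.leftBialgebroid where
  s_eq _ := rfl
  t_eq r := (E.S'_s (op r)).symm
  π_eq a := by
    change D.π a = D.π (D.S' (D.S a))
    rw [E.S'_S]
  γ_eq a x hx := E.gammaL_S _ a x hx

end FrobeniusDoubleRing

/-! ### Frobenius monads -/

/-- A Frobenius monad on a category, with its structure maps given in components.  Components are
used instead of natural transformations since the iterates of `T` then compose strictly. -/
structure FrobeniusMonad (C : Type*) [Category C] where
  T : C ⥤ C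
  μ : ∀ Y, T.obj (T.obj Y) ⟶ T.obj Y
  η : ∀ Y, Y ⟶ T.obj Y
  δ : ∀ Y, T.obj Y ⟶ T.obj (T.obj Y)
  e : ∀ Y, T.obj Y ⟶ Y
  μ_nat : ∀ {X Y} (f : X ⟶ Y), T.map (T.map f) ≫ μ Y = μ X ≫ T.map f
  η_nat : ∀ {X Y} (f : X ⟶ Y), f ≫ η Y = η X ≫ T.map f
  δ_nat : ∀ {X Y} (f : X ⟶ Y), T.map f ≫ δ Y = δ X ≫ T.map (T.map f)
  e_nat : ∀ {X Y} (f : X ⟶ Y), T.map f ≫ e Y = e X ≫ f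
  μ_assoc : ∀ Y, T.map (μ Y) ≫ μ Y = μ (T.obj Y) ≫ μ Y
  η_μ : ∀ Y, η (T.obj Y) ≫ μ Y = 𝟙 _
  map_η_μ : ∀ Y, T.map (η Y) ≫ μ Y = 𝟙 _
  δ_coassoc : ∀ Y, δ Y ≫ T.map (δ Y) = δ Y ≫ δ (T.obj Y)
  δ_e : ∀ Y, δ Y ≫ e (T.obj Y) = 𝟙 _
  δ_map_e : ∀ Y, δ Y ≫ T.map (e Y) = 𝟙 _
  map_δ_μ : ∀ Y, T.map (δ Y) ≫ μ (T.obj Y) = μ Y ≫ δ Y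
  δ_map_μ : ∀ Y, δ (T.obj Y) ≫ T.map (μ Y) = μ Y ≫ δ Y

namespace FrobeniusMonad

variable {C : Type*} [Category C] (M : FrobeniusMonad C)

theorem nat (a : M.T ⟶ M.T) {X Y : C} (f : X ⟶ Y) :
    M.T.map f ≫ a.app Y = a.app X ≫ M.T.map f := a.naturality f

/-- The convolution product of two endomorphisms of the underlying functor of a Frobenius monad:
`μ ∘ (a ⊗ b) ∘ δ`, where in `T (T Y)` the outer `T` is the first tensor factor. -/
def star (a b : M.T ⟶ M.T) : M.T ⟶ M.T where
  app Y := M.δ Y ≫ M.T.map (b.app Y) ≫ a.app (M.T.obj Y) ≫ M.μ Y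
  naturality X Y f := by
    rw [reassoc_of% M.δ_nat f, ← M.T.map_comp_assoc, M.nat b f, M.T.map_comp_assoc,
      reassoc_of% M.nat a (M.T.map f), M.μ_nat]
    simp only [Category.assoc]

/-- `e` followed by `η`, the unit of the convolution product. -/
def upsilon : M.T ⟶ M.T where
  app Y := M.e Y ≫ M.η Y
  naturality X Y f := by
    rw [reassoc_of% M.e_nat f, M.η_nat]
    simp only [Category.assoc]

/-- The transpose of `a` with respect to the Frobenius form `μ ≫ e`. -/
def antipode (a : M.T ⟶ M.T) : M.T ⟶ M.T where
  app Y := M.η (M.T.obj Y) ≫ M.δ (M.T.obj Y) ≫ M.T.map (a.app (M.T.obj Y)) ≫ M.T.map (M.μ Y) ≫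
    M.T.map (M.e Y)
  naturality X Y f := by
    rw [reassoc_of% M.η_nat (M.T.map f), reassoc_of% M.δ_nat (M.T.map f)]
    simp only [Category.assoc, ← M.T.map_comp]
    rw [reassoc_of% M.nat a (M.T.map f), reassoc_of% M.μ_nat f, M.e_nat]

/-- The transpose of `a` on the other side of the Frobenius form. -/
def antipodeInv (a : M.T ⟶ M.T) : M.T ⟶ M.T where
  app Y := M.T.map (M.η Y) ≫ M.T.map (M.δ Y) ≫ M.T.map (a.app (M.T.obj Y)) ≫ M.μ (M.T.obj Y) ≫
    M.e (M.T.obj Y)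
  naturality X Y f := by
    simp only [← M.T.map_comp_assoc]
    rw [reassoc_of% M.η_nat f, reassoc_of% M.δ_nat f, M.nat a (M.T.map f)]
    simp only [M.T.map_comp, Category.assoc]
    rw [reassoc_of% M.μ_nat (M.T.map f), M.e_nat]

variable (a b c : M.T ⟶ M.T)

theorem star_app (Y : C) :
    (M.star a b).app Y = M.δ Y ≫ M.T.map (b.app Y) ≫ a.app (M.T.obj Y) ≫ M.μ Y := rfl

theorem upsilon_app (Y : C) : M.upsilon.app Y = M.e Y ≫ M.η Y := rfl

theorem star_assoc : M.star (M.star a b) c = M.star a (M.star b c) := by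
  ext Y
  simp only [star_app, Functor.map_comp, Category.assoc]
  rw [reassoc_of% M.δ_nat (c.app Y), ← reassoc_of% M.δ_coassoc Y, reassoc_of% M.nat a (M.μ Y),
    M.μ_assoc]

theorem upsilon_star : M.star M.upsilon b = b := by
  ext Y
  simp only [star_app, upsilon_app, Category.assoc, M.η_μ, Category.comp_id]
  rw [M.e_nat, reassoc_of% M.δ_e]

theorem star_upsilon : M.star a M.upsilon = a := by
  ext Y
  simp only [star_app, upsilon_app, Category.assoc, Functor.map_comp]
  rw [reassoc_of% M.nat a (M.η Y), M.map_η_μ, Category.comp_id, reassoc_of% M.δ_map_e]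

/-- `p` is a morphism of right `T`-modules, that is, left multiplication by a point. -/
def IsLeftMul (p : M.T ⟶ M.T) : Prop := ∀ Y, p.app (M.T.obj Y) ≫ M.μ Y = M.μ Y ≫ p.app Y

/-- `q` is a morphism of left `T`-modules, that is, right multiplication by a point. -/
def IsRightMul (q : M.T ⟶ M.T) : Prop := ∀ Y, M.T.map (q.app Y) ≫ M.μ Y = M.μ Y ≫ q.app Y

variable {M}

theorem IsLeftMul.app_eq {p : M.T ⟶ M.T} (hp : M.IsLeftMul p) (Y : C) :
    p.app Y = M.η (M.T.obj Y) ≫ p.app (M.T.obj Y) ≫ M.μ Y := by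
  rw [hp, reassoc_of% M.η_μ]

theorem IsRightMul.app_eq {q : M.T ⟶ M.T} (hq : M.IsRightMul q) (Y : C) :
    q.app Y = M.T.map (M.η Y ≫ q.app Y) ≫ M.μ Y := by
  rw [M.T.map_comp, Category.assoc, hq, reassoc_of% M.map_η_μ]

theorem IsLeftMul.ext {p q : M.T ⟶ M.T} (hp : M.IsLeftMul p) (hq : M.IsLeftMul q)
    (h : ∀ Y, M.η Y ≫ p.app Y = M.η Y ≫ q.app Y) : p = q := by
  ext Y
  rw [hp.app_eq, hq.app_eq, reassoc_of% h]

theorem IsRightMul.ext {p q : M.T ⟶ M.T} (hp : M.IsRightMul p) (hq : M.IsRightMul q)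
    (h : ∀ Y, M.η Y ≫ p.app Y = M.η Y ≫ q.app Y) : p = q := by
  ext Y
  rw [hp.app_eq, hq.app_eq, h]

variable (M)

theorem isLeftMul_star_one : M.IsLeftMul (M.star a (𝟙 _)) := by
  intro Y
  simp only [star_app, NatTrans.id_app, CategoryTheory.Functor.map_id, Category.id_comp, Category.assoc]
  rw [← M.μ_assoc, ← reassoc_of% M.nat a (M.μ Y), reassoc_of% M.δ_map_μ]

theorem isRightMul_one_star : M.IsRightMul (M.star (𝟙 _) c) := by
  intro Y
  simp only [star_app, NatTrans.id_app, Category.id_comp, Category.assoc, Functor.map_comp]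
  rw [M.μ_assoc, reassoc_of% M.μ_nat (c.app Y), reassoc_of% M.map_δ_μ]

variable {M}
variable {p q : M.T ⟶ M.T}

theorem IsLeftMul.comp_comm (hp : M.IsLeftMul p) (hq : M.IsRightMul q) : p ≫ q = q ≫ p := by
  ext Y
  simp only [NatTrans.comp_app]
  rw [hp.app_eq, Category.assoc, Category.assoc, ← hq, ← reassoc_of% M.nat p (q.app Y),
    ← reassoc_of% M.η_nat (q.app Y)]

theorem IsLeftMul.star_comp (hp : M.IsLeftMul p) : M.star a b ≫ p = M.star (a ≫ p) b := by
  ext Y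
  simp only [NatTrans.comp_app, star_app, Category.assoc]
  rw [hp]

theorem IsRightMul.star_comp (hq : M.IsRightMul q) : M.star a b ≫ q = M.star a (b ≫ q) := by
  ext Y
  simp only [NatTrans.comp_app, star_app, Category.assoc, Functor.map_comp]
  rw [← hq, reassoc_of% M.nat a (q.app Y)]

theorem IsRightMul.comp_star (hq : M.IsRightMul q) : q ≫ M.star a b = M.star a (q ≫ b) := by
  ext Y
  simp only [NatTrans.comp_app, star_app, Category.assoc, Functor.map_comp]
  have h : q.app Y ≫ M.δ Y = M.δ Y ≫ M.T.map (q.app Y) := by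
    rw [hq.app_eq, Category.assoc, ← M.δ_map_μ, reassoc_of% M.δ_nat, ← M.T.map_comp]
  rw [reassoc_of% h]

/-- If `p` and `q` are left and right multiplication by the same point `z`, then
`x (z y) = (x z) y`. -/
theorem IsLeftMul.map_μ (hp : M.IsLeftMul p) (hq : M.IsRightMul q)
    (h : ∀ Y, M.η Y ≫ p.app Y = M.η Y ≫ q.app Y) (Y : C) :
    M.T.map (p.app Y) ≫ M.μ Y = q.app (M.T.obj Y) ≫ M.μ Y := by
  rw [hp.app_eq, M.T.map_comp, M.T.map_comp, Category.assoc, Category.assoc, M.μ_assoc,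
    hq.app_eq (M.T.obj Y), ← h, M.T.map_comp]
  simp only [Category.assoc]

theorem IsLeftMul.star_mid (hp : M.IsLeftMul p) (hq : M.IsRightMul q)
    (h : ∀ Y, M.η Y ≫ p.app Y = M.η Y ≫ q.app Y) :
    M.star (a ≫ q) b = M.star a (b ≫ p) := by
  ext Y
  simp only [NatTrans.comp_app, star_app, Category.assoc, Functor.map_comp]
  rw [← hp.map_μ hq h, ← reassoc_of% M.nat a (p.app Y)]

/-! ### The Frobenius form -/

variable (M)

/-- The Frobenius form `μ ≫ e` is non-degenerate. -/
theorem ext_form {Z Y : C} {f g : Z ⟶ M.T.obj Y}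
    (h : M.T.map f ≫ M.μ Y ≫ M.e Y = M.T.map g ≫ M.μ Y ≫ M.e Y) : f = g := by
  have key : ∀ f : Z ⟶ M.T.obj Y,
      M.η Z ≫ M.δ Z ≫ M.T.map (M.T.map f ≫ M.μ Y ≫ M.e Y) = f := by
    intro f
    simp only [Functor.map_comp]
    rw [← reassoc_of% M.δ_nat f, ← reassoc_of% M.η_nat f, reassoc_of% M.δ_map_μ,
      reassoc_of% M.η_μ, M.δ_map_e, Category.comp_id]
  rw [← key f, h, key g]

theorem antipode_app (Y : C) : (M.antipode a).app Y =
    M.η (M.T.obj Y) ≫ M.δ (M.T.obj Y) ≫ M.T.map (a.app (M.T.obj Y)) ≫ M.T.map (M.μ Y) ≫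
    M.T.map (M.e Y) := rfl

theorem antipodeInv_app (Y : C) : (M.antipodeInv a).app Y =
    M.T.map (M.η Y) ≫ M.T.map (M.δ Y) ≫ M.T.map (a.app (M.T.obj Y)) ≫ M.μ (M.T.obj Y) ≫
    M.e (M.T.obj Y) := rfl

theorem map_antipode_μ (Y : C) : M.T.map ((M.antipode a).app Y) ≫ M.μ Y =
    M.δ (M.T.obj Y) ≫ M.T.map (a.app (M.T.obj Y)) ≫ M.T.map (M.μ Y) ≫ M.T.map (M.e Y) := by
  rw [antipode_app]
  simp only [Functor.map_comp, Category.assoc]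
  rw [M.μ_nat (M.e Y), reassoc_of% M.μ_nat (M.μ Y), reassoc_of% M.μ_nat (a.app (M.T.obj Y)),
    reassoc_of% M.map_δ_μ, reassoc_of% M.map_η_μ]

/-- `e (x * S(a)(y)) = e (a(x) * y)`. -/
theorem map_antipode_form (Y : C) : M.T.map ((M.antipode a).app Y) ≫ M.μ Y ≫ M.e Y =
    a.app (M.T.obj Y) ≫ M.μ Y ≫ M.e Y := by
  rw [reassoc_of% M.map_antipode_μ, M.e_nat, reassoc_of% M.e_nat (M.μ Y), reassoc_of% M.e_nat,
    reassoc_of% M.δ_e]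

theorem η_δ_antipode (Y : C) : M.η Y ≫ M.δ Y ≫ (M.antipode b).app (M.T.obj Y) =
    M.η Y ≫ M.δ Y ≫ M.T.map (b.app Y) := by
  rw [antipode_app]
  simp only [← M.T.map_comp]
  rw [reassoc_of% M.η_nat (M.δ Y), reassoc_of% M.δ_nat (M.δ Y), ← M.T.map_comp,
    reassoc_of% M.nat b (M.δ Y), reassoc_of% M.map_δ_μ, M.δ_e, Category.comp_id,
    reassoc_of% M.η_nat (M.η Y), reassoc_of% M.δ_nat (M.η Y), ← M.T.map_comp,
    reassoc_of% M.nat b (M.η Y), M.map_η_μ, Category.comp_id]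

theorem δ_map_antipodeInv (Y : C) : M.δ Y ≫ M.T.map ((M.antipodeInv b).app Y) =
    M.T.map (M.η Y) ≫ M.T.map (M.δ Y) ≫ M.T.map (b.app (M.T.obj Y)) ≫ M.μ (M.T.obj Y) := by
  rw [antipodeInv_app]
  simp only [← M.T.map_comp_assoc]
  simp only [M.T.map_comp (M.T.map _), M.T.map_comp (M.μ _)]
  rw [← reassoc_of% M.δ_nat, reassoc_of% M.δ_map_μ, M.δ_map_e, Category.comp_id]

theorem η_δ_antipodeInv (Y : C) : M.η Y ≫ M.δ Y ≫ M.T.map ((M.antipodeInv b).app Y) =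
    M.η Y ≫ M.δ Y ≫ b.app (M.T.obj Y) := by
  rw [δ_map_antipodeInv]
  simp only [← M.T.map_comp_assoc]
  rw [← reassoc_of% M.η_nat, M.η_μ]
  simp only [Category.comp_id]

/-- In the convolution form `(a, c) ↦ (a ⋆ c)(1)`, precomposing the first entry with `S(b)`
amounts to precomposing the second one with `b`. -/
theorem η_star_antipode (Y : C) : M.η Y ≫ (M.star (M.antipode b ≫ a) c).app Y =
    M.η Y ≫ (M.star a (b ≫ c)).app Y := by
  simp only [star_app, NatTrans.comp_app, Functor.map_comp, Category.assoc]
  rw [reassoc_of% M.nat (M.antipode b) (c.app Y), reassoc_of% M.η_δ_antipode]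

/-- The other adjoint of `b` for the convolution form is `antipodeInv b`. -/
theorem η_star_antipodeInv (Y : C) : M.η Y ≫ (M.star (b ≫ a) c).app Y =
    M.η Y ≫ (M.star a (M.antipodeInv b ≫ c)).app Y := by
  simp only [star_app, NatTrans.comp_app, Functor.map_comp, Category.assoc]
  rw [reassoc_of% M.nat b (c.app Y), reassoc_of% M.η_δ_antipodeInv]

theorem antipode_star : M.antipode (M.star a b) = M.star (M.antipode b) (M.antipode a) := by
  ext Y
  apply M.ext_form
  rw [map_antipode_form]
  simp only [star_app, Functor.map_comp, Category.assoc]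
  rw [reassoc_of% M.μ_assoc, reassoc_of% M.map_antipode_μ b (M.T.obj Y),
    reassoc_of% M.δ_nat (M.T.map ((M.antipode a).app Y))]
  simp only [← M.T.map_comp_assoc]
  rw [reassoc_of% M.nat b (M.T.map ((M.antipode a).app Y)),
    reassoc_of% M.μ_nat ((M.antipode a).app Y), M.e_nat, reassoc_of% M.δ_nat (M.δ Y),
    ← M.T.map_comp_assoc, reassoc_of% M.nat b (M.δ Y), reassoc_of% M.map_δ_μ,
    reassoc_of% M.δ_e]
  simp only [Functor.map_comp, Category.assoc]
  rw [map_antipode_form, reassoc_of% M.nat a (M.μ Y), reassoc_of% M.μ_assoc]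

end FrobeniusMonad

/-! ### Quasi-bases -/

namespace FrobeniusMonad

variable {C : Type*} [Category C] (M : FrobeniusMonad C)

/-- `p` is left multiplication by the value of `a` at the unit. -/
def IsPointOf (p a : M.T ⟶ M.T) : Prop :=
  ∀ Y, p.app Y = M.η (M.T.obj Y) ≫ a.app (M.T.obj Y) ≫ M.μ Y

variable {M} in
theorem IsPointOf.isLeftMul {p a : M.T ⟶ M.T} (h : M.IsPointOf p a) : M.IsLeftMul p := by
  intro Y
  rw [h, h]
  simp only [Category.assoc]
  rw [← M.μ_assoc, ← reassoc_of% M.nat a (M.μ Y), ← reassoc_of% M.η_nat (M.μ Y)]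

variable {M} in
theorem IsPointOf.η_comp {p a : M.T ⟶ M.T} (h : M.IsPointOf p a) (Y : C) :
    M.η Y ≫ p.app Y = M.η Y ≫ a.app Y := by
  rw [h, reassoc_of% M.η_nat (M.η Y), reassoc_of% M.nat a (M.η Y), M.map_η_μ, Category.comp_id]

section Preadditive

variable [Preadditive C] [M.T.Additive]

/-- Families `W`, `b` of endomorphisms with `∑ W i (x) · b i (y) = Υ (x y)`; here
`Υ = e ≫ η`. -/
structure QuasiBasis (n : ℕ) where
  W : Fin n → (M.T ⟶ M.T)
  b : Fin n → (M.T ⟶ M.T)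
  sum_eq : ∀ Y, ∑ i, M.T.map ((b i).app Y) ≫ (W i).app (M.T.obj Y) ≫ M.μ Y =
    M.μ Y ≫ M.e Y ≫ M.η Y

variable {M}
variable {n : ℕ} (E : M.QuasiBasis n)

namespace QuasiBasis

/-- `∑ (a ⋆ W i)(x) · (b i)(y) = a (x y)`. -/
theorem sum_star (x : M.T ⟶ M.T) (Y : C) :
    ∑ i, M.T.map ((E.b i).app Y) ≫ (M.star x (E.W i)).app (M.T.obj Y) ≫ M.μ Y =
      M.μ Y ≫ x.app Y := by
  have h : ∀ i, M.T.map ((E.b i).app Y) ≫ (M.star x (E.W i)).app (M.T.obj Y) ≫ M.μ Y =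
      M.δ (M.T.obj Y) ≫ M.T.map (M.T.map ((E.b i).app Y) ≫ (E.W i).app (M.T.obj Y) ≫ M.μ Y) ≫
        x.app (M.T.obj Y) ≫ M.μ Y := by
    intro i
    simp only [star_app, Functor.map_comp, Category.assoc]
    rw [reassoc_of% M.nat x (M.μ Y), M.μ_assoc, reassoc_of% M.δ_nat ((E.b i).app Y)]
  simp only [h]
  rw [← Preadditive.comp_sum, ← Preadditive.sum_comp, ← Functor.map_sum, E.sum_eq]
  simp only [Functor.map_comp, Category.assoc]
  rw [reassoc_of% M.nat x (M.η Y), M.map_η_μ, Category.comp_id, reassoc_of% M.δ_map_μ,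
    reassoc_of% M.δ_map_e]

/-- `a (x) = ∑ ((a ⋆ W i)(1)) · (b i)(x)`. -/
theorem sum_left (a : M.T ⟶ M.T) (Y : C) :
    ∑ i, (E.b i).app Y ≫ M.η (M.T.obj Y) ≫ (M.star a (E.W i)).app (M.T.obj Y) ≫ M.μ Y =
      a.app Y := by
  simp only [reassoc_of% M.η_nat]
  rw [← Preadditive.comp_sum, E.sum_star, reassoc_of% M.η_μ]

omit [M.T.Additive] in
/-- `c (x) = ∑ (W i)(x) · ((b i ⋆ c)(1))`. -/
theorem sum_right (c : M.T ⟶ M.T) (Y : C) :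
    ∑ i, (E.W i).app Y ≫ M.T.map (M.η Y ≫ (M.star (E.b i) c).app Y) ≫ M.μ Y = c.app Y := by
  have h : ∀ i, (E.W i).app Y ≫ M.T.map (M.η Y ≫ (M.star (E.b i) c).app Y) ≫ M.μ Y =
      M.T.map (M.η Y) ≫ M.T.map (M.δ Y) ≫ M.T.map (M.T.map (c.app Y)) ≫
        (M.T.map ((E.b i).app (M.T.obj Y)) ≫ (E.W i).app (M.T.obj (M.T.obj Y)) ≫
          M.μ (M.T.obj Y)) ≫ M.μ Y := by
    intro i
    rw [← reassoc_of% M.nat (E.W i)]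
    simp only [star_app, Functor.map_comp, Category.assoc]
    rw [reassoc_of% M.nat (E.W i) (M.μ Y), M.μ_assoc]
  simp only [h]
  rw [← Preadditive.comp_sum, ← Preadditive.comp_sum, ← Preadditive.comp_sum,
    ← Preadditive.sum_comp, E.sum_eq]
  simp only [Category.assoc]
  rw [M.η_μ, Category.comp_id, reassoc_of% M.μ_nat (c.app Y), M.e_nat, reassoc_of% M.map_δ_μ,
    reassoc_of% M.δ_e, reassoc_of% M.map_η_μ]

/-- The identity behind the multiplicativity of the coproduct: composition distributes over
convolution up to the quasi-basis. -/
theorem sum_distrib (a x c : M.T ⟶ M.T) (Y : C) :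
    ∑ i, (M.star x (E.W i) ≫ M.star a (M.antipodeInv (E.b i) ≫ c)).app Y =
      (M.star (x ≫ a) c).app Y := by
  have h : ∀ i, (M.star x (E.W i) ≫ M.star a (M.antipodeInv (E.b i) ≫ c)).app Y =
      M.T.map (M.η Y) ≫ M.T.map (M.δ Y) ≫ (M.T.map ((E.b i).app (M.T.obj Y)) ≫
        (M.star x (E.W i)).app (M.T.obj (M.T.obj Y)) ≫ M.μ (M.T.obj Y)) ≫
        M.T.map (c.app Y) ≫ a.app (M.T.obj Y) ≫ M.μ Y := by
    intro i
    rw [NatTrans.comp_app, M.star_app a]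
    simp only [NatTrans.comp_app, Functor.map_comp, Category.assoc]
    rw [reassoc_of% M.δ_map_antipodeInv]
    simp only [← reassoc_of% M.nat (M.star x (E.W i))]
  simp only [h]
  rw [← Preadditive.comp_sum, ← Preadditive.comp_sum, ← Preadditive.sum_comp, E.sum_star]
  simp only [star_app, NatTrans.comp_app, Category.assoc]
  rw [reassoc_of% M.map_δ_μ, reassoc_of% M.map_η_μ, ← reassoc_of% M.nat x (c.app Y)]

end QuasiBasis

/-- If `∑ (V i ⊗ U i) ∘ δ = δ ∘ η ∘ e`, then `U` and `V` are dual bases for the form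
`(d, v) ↦ e ∘ (d ⋆ v)` with values in the functionals on `T`. -/
theorem sum_dual {n : ℕ} {U V : Fin n → (M.T ⟶ M.T)}
    (h : ∀ Y, ∑ i, M.δ Y ≫ M.T.map ((U i).app Y) ≫ (V i).app (M.T.obj Y) =
      M.e Y ≫ M.η Y ≫ M.δ Y) (d : M.T ⟶ M.T) (Y : C) :
    ∑ i, (M.star (M.star d (V i) ≫ M.upsilon) (𝟙 _) ≫ U i).app Y = d.app Y := by
  have h' : ∀ i, (M.star (M.star d (V i) ≫ M.upsilon) (𝟙 _) ≫ U i).app Y =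
      M.δ Y ≫ M.T.map (M.δ Y ≫ M.T.map ((U i).app Y) ≫ (V i).app (M.T.obj Y)) ≫
        d.app (M.T.obj (M.T.obj Y)) ≫ M.μ (M.T.obj Y) ≫ M.e (M.T.obj Y) := by
    intro i
    simp only [NatTrans.comp_app, star_app, upsilon_app, NatTrans.id_app, Functor.map_comp,
      CategoryTheory.Functor.map_id, Category.id_comp, Category.assoc, M.η_μ, Category.comp_id]
    rw [← M.e_nat ((U i).app Y), ← reassoc_of% M.μ_nat ((U i).app Y),
      ← reassoc_of% M.nat d (M.T.map ((U i).app Y)), reassoc_of% M.δ_coassoc,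
      ← M.T.map_comp_assoc ((V i).app _), ← M.nat (V i), M.T.map_comp_assoc]
  simp only [h']
  rw [← Preadditive.comp_sum, ← Preadditive.sum_comp, ← Functor.map_sum, h]
  simp only [Functor.map_comp, Category.assoc]
  rw [reassoc_of% M.δ_map_e, reassoc_of% M.nat d, reassoc_of% M.nat d, reassoc_of% M.map_δ_μ,
    M.δ_e, Category.comp_id, M.map_η_μ, Category.comp_id]

end Preadditive

end FrobeniusMonad

/-! ### Represented Frobenius monads -/

namespace FrobeniusMonad

variable {C : Type u₁} [Category.{v₁} C] (M : FrobeniusMonad C) [Preadditive C]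

/-- Rings `A` and `L` of endomorphisms of a Frobenius monad and of points of it: a faithful
representation `act` of `A` whose image is closed under the operations of `M`. -/
structure Representation (A L : Type*) [Ring A] [Ring L] where
  act : A → (M.T ⟶ M.T)
  act_injective : Function.Injective act
  act_add : ∀ a b, act (a + b) = act a + act b
  act_one : act 1 = 𝟙 _
  act_mul : ∀ a b, act (a * b) = act b ≫ act a
  s : L →+* A
  t : L → A
  π : A →+ L
  star : A → A → A
  Υ : A
  S : A → A
  S' : A → A
  act_star : ∀ a b, act (star a b) = M.star (act a) (act b)
  act_Υ : act Υ = M.upsilon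
  act_S : ∀ a, act (S a) = M.antipode (act a)
  act_S' : ∀ a, act (S' a) = M.antipodeInv (act a)
  π_s : ∀ l, π (s l) = l
  s_π : ∀ a, M.IsPointOf (act (s (π a))) (act a)
  t_isRightMul : ∀ l, M.IsRightMul (act (t l))
  η_t : ∀ l Y, M.η Y ≫ (act (s l)).app Y = M.η Y ≫ (act (t l)).app Y

namespace Representation

variable {M}
variable {A L : Type*} [Ring A] [Ring L] (P : M.Representation A L)

theorem s_isLeftMul (l : L) : M.IsLeftMul (P.act (P.s l)) := by
  have h := (P.s_π (P.s l)).isLeftMul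
  rwa [P.π_s] at h

theorem η_s_π (a : A) (Y : C) :
    M.η Y ≫ (P.act (P.s (P.π a))).app Y = M.η Y ≫ (P.act a).app Y :=
  (P.s_π a).η_comp Y

theorem s_injective : Function.Injective P.s := Function.LeftInverse.injective P.π_s

theorem π_eq_iff (l : L) (a : A) :
    P.π a = l ↔ ∀ Y, M.η Y ≫ (P.act a).app Y = M.η Y ≫ (P.act (P.s l)).app Y := by
  constructor
  · rintro rfl Y
    exact (P.η_s_π a Y).symm
  · intro h
    apply P.s_injective
    apply P.act_injective
    apply (P.s_isLeftMul _).ext (P.s_isLeftMul _)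
    intro Y
    rw [P.η_s_π, h]

theorem π_congr {a b : A} (h : ∀ Y, M.η Y ≫ (P.act a).app Y = M.η Y ≫ (P.act b).app Y) :
    P.π a = P.π b := by
  rw [P.π_eq_iff]
  intro Y
  rw [h, P.η_s_π]

/-- The element `t l` is the right multiplication whose value at the unit is that of `s l`. -/
theorem eq_t_iff (l : L) {a : A} (ha : M.IsRightMul (P.act a)) :
    a = P.t l ↔ ∀ Y, M.η Y ≫ (P.act a).app Y = M.η Y ≫ (P.act (P.s l)).app Y := by
  constructor
  · rintro rfl Y
    exact (P.η_t l Y).symm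
  · intro h
    apply P.act_injective
    apply ha.ext (P.t_isRightMul _)
    intro Y
    rw [h, P.η_t]

theorem act_mul_app (a b : A) (Y : C) :
    (P.act (a * b)).app Y = (P.act b).app Y ≫ (P.act a).app Y := by
  rw [P.act_mul, NatTrans.comp_app]

theorem act_add_app (a b : A) (Y : C) :
    (P.act (a + b)).app Y = (P.act a).app Y + (P.act b).app Y := by
  rw [P.act_add, NatTrans.app_add]

theorem comm (l l' : L) : P.s l * P.t l' = P.t l' * P.s l := by
  apply P.act_injective
  rw [P.act_mul, P.act_mul, (P.s_isLeftMul l).comp_comm (P.t_isRightMul l')]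

variable [M.T.Additive]

theorem star_add (a b c : A) : P.star a (b + c) = P.star a b + P.star a c := by
  apply P.act_injective
  ext Y
  simp only [P.act_add_app, P.act_star, star_app, Functor.map_add, Preadditive.comp_add,
    Preadditive.add_comp]

omit [M.T.Additive] in
theorem add_star (a b c : A) : P.star (a + b) c = P.star a c + P.star b c := by
  apply P.act_injective
  ext Y
  simp only [P.act_add_app, P.act_star, star_app, Preadditive.comp_add, Preadditive.add_comp]

omit [M.T.Additive] in
theorem comm_app (l l' : L) (Y : C) : (P.act (P.s l)).app Y ≫ (P.act (P.t l')).app Y =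
    (P.act (P.t l')).app Y ≫ (P.act (P.s l)).app Y :=
  NatTrans.congr_app ((P.s_isLeftMul l).comp_comm (P.t_isRightMul l')) Y

theorem t_add (l l' : L) : P.t (l + l') = P.t l + P.t l' := by
  refine ((P.eq_t_iff _ ?_).2 ?_).symm
  · intro Y
    simp only [P.act_add_app, Functor.map_add, Preadditive.comp_add, Preadditive.add_comp,
      P.t_isRightMul _ Y]
  · intro Y
    simp only [map_add, P.act_add_app, Preadditive.comp_add, P.η_t]

omit [M.T.Additive] in
theorem t_one : P.t 1 = 1 := by
  refine ((P.eq_t_iff _ ?_).2 ?_).symm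
  · intro Y
    simp [P.act_one]
  · intro Y
    simp

omit [M.T.Additive] in
theorem t_mul (l l' : L) : P.t (l' * l) = P.t l * P.t l' := by
  refine ((P.eq_t_iff _ ?_).2 ?_).symm
  · intro Y
    rw [P.act_mul_app, Functor.map_comp, Category.assoc, P.t_isRightMul,
      reassoc_of% P.t_isRightMul]
  · intro Y
    rw [P.act_mul_app, ← reassoc_of% P.η_t, map_mul, P.act_mul_app, P.comm_app,
      reassoc_of% P.η_t]

/-- The target map as a ring homomorphism. -/
def tHom : Lᵐᵒᵖ →+* A where
  toFun l := P.t l.unop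
  map_one' := P.t_one
  map_mul' l l' := P.t_mul l.unop l'.unop
  map_add' l l' := P.t_add l.unop l'.unop
  map_zero' := by
    have h := P.t_add 0 0
    rw [add_zero] at h
    exact left_eq_add.1 h

theorem tHom_op (l : L) : P.tHom (op l) = P.t l := rfl

/-- The double ring of a represented Frobenius monad. -/
def doubleRing : FrobeniusDoubleRing A L where
  s := P.s
  t := P.tHom
  π := P.π
  star := AddMonoidHom.toIntLinearMap (AddMonoidHom.mk' (fun a =>
    (AddMonoidHom.mk' (P.star a) (P.star_add a)).toIntLinearMap) (fun a b => by
      ext c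
      exact P.add_star a b c))
  Υ := P.Υ
  S := AddMonoidHom.mk' P.S (fun a b => by
    apply P.act_injective
    ext Y
    simp only [P.act_S, P.act_add_app, antipode_app, Functor.map_add, Preadditive.comp_add,
      Preadditive.add_comp])
  S' := AddMonoidHom.mk' P.S' (fun a b => by
    apply P.act_injective
    ext Y
    simp only [P.act_S', P.act_add_app, antipodeInv_app, Functor.map_add, Preadditive.comp_add,
      Preadditive.add_comp])
  comm := P.comm
  π_bimod l l' a := by
    rw [P.π_eq_iff]
    intro Y
    simp only [P.tHom_op, map_mul, P.act_mul_app]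
    rw [reassoc_of% P.η_t l', ← reassoc_of% P.comm_app (P.π a) l', reassoc_of% P.η_s_π]
  π_one := by rw [← map_one P.s, P.π_s]
  π_mul_s a b := P.π_congr fun Y => by
    simp only [P.act_mul_app, reassoc_of% P.η_s_π]
  π_mul_t a b := P.π_congr fun Y => by
    simp only [P.tHom_op, P.act_mul_app, ← reassoc_of% P.η_t, reassoc_of% P.η_s_π]
  mul_Υ_s a := by
    apply P.act_injective
    ext Y
    simp only [P.act_mul_app, P.act_Υ, upsilon_app, Category.assoc, P.η_s_π]
  mul_Υ_t a := by
    apply P.act_injective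
    ext Y
    simp only [P.tHom_op, P.act_mul_app, P.act_Υ, upsilon_app, Category.assoc, ← P.η_t, P.η_s_π]
  star_assoc a b c := P.act_injective (by simp [P.act_star, M.star_assoc])
  Υ_star a := P.act_injective (by simp [P.act_star, P.act_Υ, M.upsilon_star])
  star_Υ a := P.act_injective (by simp [P.act_star, P.act_Υ, M.star_upsilon])
  s_mul_star l a b := P.act_injective (by
    simp [P.act_star, P.act_mul, (P.s_isLeftMul l).star_comp])
  t_mul_star l a b := P.act_injective (by
    simp [P.act_star, P.act_mul, P.tHom_op, (P.t_isRightMul l).star_comp])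
  t_star l a b := P.act_injective (by
    simp [P.act_star, P.act_mul, P.tHom_op, (P.s_isLeftMul l).star_mid _ _ (P.t_isRightMul l)
      (P.η_t l)])
  star_mul_t l a b := P.act_injective (by
    simp [P.act_star, P.act_mul, P.tHom_op, (P.t_isRightMul l).comp_star])
  one_star a := by
    apply P.act_injective
    simp only [P.tHom_op, AddMonoidHom.coe_toIntLinearMap, AddMonoidHom.mk'_apply]
    refine IsRightMul.ext ?_ (P.t_isRightMul _) ?_
    · rw [P.act_star, P.act_one]
      exact M.isRightMul_one_star _
    · intro Y
      rw [← P.η_t, P.η_s_π]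
  star_one a := by
    apply P.act_injective
    simp only [AddMonoidHom.coe_toIntLinearMap, AddMonoidHom.mk'_apply]
    refine IsLeftMul.ext ?_ (P.s_isLeftMul _) ?_
    · rw [P.act_star, P.act_one]
      exact M.isLeftMul_star_one _
    · intro Y
      rw [P.η_s_π]
  form_S a b c := P.π_congr fun Y => by
    simp [P.act_star, P.act_mul, P.act_S, M.η_star_antipode]
  form_S' a b c := P.π_congr fun Y => by
    simp [P.act_star, P.act_mul, P.act_S', M.η_star_antipodeInv]
  S_star a b := P.act_injective (by simp [P.act_star, P.act_S, M.antipode_star])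

end Representation

end FrobeniusMonad

namespace FrobeniusMonad.Representation

variable {C : Type u₁} [Category.{v₁} C] {M : FrobeniusMonad C} [Preadditive C]
variable {A L : Type*} [Ring A] [Ring L] (P : M.Representation A L)

theorem act_sum_app {n : ℕ} (x : Fin n → A) (Y : C) :
    (P.act (∑ i, x i)).app Y = ∑ i, (P.act (x i)).app Y :=
  map_sum (AddMonoidHom.mk' (fun a => (P.act a).app Y) fun a b => P.act_add_app a b Y) _ _

variable [M.T.Additive]

omit [M.T.Additive] in
theorem act_t_π_app (a : A) (Y : C) : (P.act (P.t (P.π a))).app Y =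
    M.T.map (M.η Y ≫ (P.act a).app Y) ≫ M.μ Y := by
  rw [(P.t_isRightMul _).app_eq, ← P.η_t, P.η_s_π]

/-- Dual bases of the double ring of a represented Frobenius monad. -/
def dualBasis {n : ℕ} (W b : Fin n → A)
    (h : ∀ Y, ∑ i, M.T.map ((P.act (b i)).app Y) ≫ (P.act (W i)).app (M.T.obj Y) ≫ M.μ Y =
      M.μ Y ≫ M.e Y ≫ M.η Y) : P.doubleRing.DualBasis n where
  W := W
  b := b
  left a := by
    let E : M.QuasiBasis n := ⟨fun i => P.act (W i), fun i => P.act (b i), h⟩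
    apply P.act_injective
    ext Y
    rw [P.act_sum_app, ← E.sum_left]
    refine Finset.sum_congr rfl fun i _ => ?_
    rw [P.act_mul_app, ← P.act_star]
    exact congrArg _ (P.s_π _ Y)
  right c := by
    let E : M.QuasiBasis n := ⟨fun i => P.act (W i), fun i => P.act (b i), h⟩
    apply P.act_injective
    ext Y
    rw [P.act_sum_app, ← E.sum_right]
    refine Finset.sum_congr rfl fun i _ => ?_
    rw [P.act_mul_app, ← P.act_star, ← P.act_t_π_app]
    rfl
  distrib a x c := by
    let E : M.QuasiBasis n := ⟨fun i => P.act (W i), fun i => P.act (b i), h⟩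
    apply P.act_injective
    ext Y
    rw [P.act_sum_app]
    refine ((P.act_star _ _).symm ▸ (P.act_mul _ _).symm ▸ (E.sum_distrib _ _ _ Y).symm).trans ?_
    refine Finset.sum_congr rfl fun i _ => ?_
    rw [P.act_mul, ← P.act_S', ← P.act_mul, ← P.act_star, ← P.act_star]
    rfl

/-- The formula of `sum_dual`, in the represented ring. -/
theorem sum_mul_star_one {n : ℕ} (U V : Fin n → A)
    (h : ∀ Y, ∑ i, M.δ Y ≫ M.T.map ((P.act (U i)).app Y) ≫ (P.act (V i)).app (M.T.obj Y) =
      M.e Y ≫ M.η Y ≫ M.δ Y) (d : A) :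
    ∑ i, U i * P.star (P.Υ * P.star d (V i)) 1 = d := by
  apply P.act_injective
  ext Y
  rw [P.act_sum_app, ← sum_dual h]
  refine Finset.sum_congr rfl fun i _ => ?_
  rw [P.act_mul, P.act_star, P.act_mul, P.act_star, P.act_Υ, P.act_one]

end FrobeniusMonad.Representation

namespace FrobeniusDoubleRing.DualBasis

variable {A L R : Type*} [Ring A] [Ring L] [Ring R] {D : FrobeniusDoubleRing A L} {n : ℕ}
  (E : D.DualBasis n)

/-- A second description of the right coproduct, by dual bases `U`, `V` of the form that
corresponds to the comultiplication of the Frobenius algebra. -/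
theorem gammaR_eq (f : Lᵐᵒᵖ ≃+* R) {m : ℕ} (U V : Fin m → A)
    (h : ∀ d, ∑ i, U i * D.star (D.Υ * D.star d (V i)) 1 = d) (y : A) :
    E.gammaR f y = E.mkR f (∑ i, D.star y (V i) ⊗ₜ[ℤ] U i) := by
  symm
  rw [E.mkR_eq_gammaR, E.gammaL_eq_iff]
  intro c
  rw [map_sum, map_sum, map_sum]
  have h' := congrArg D.S' (h (D.star (D.S c) y))
  rw [map_sum, E.S'_star, E.S'_S] at h'
  rw [← h']
  refine Finset.sum_congr rfl fun i _ => ?_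
  rw [flipMap_tmul, D.testL_mk, E.star_Υ_mul_one, E.S'_mul, E.S'_s, D.star_assoc]
  simp only [E.S'_star, E.S'_S]

end FrobeniusDoubleRing.DualBasis

/-! ### Depth 2 data on a Frobenius monad -/

namespace FrobeniusMonad

variable {C : Type u₁} [Category.{v₁} C] (M : FrobeniusMonad C)

/-- The Frobenius monad of an adjoint pair of functors which are adjoint in both orders. -/
def ofAdjunctions {C D : Type*} [Category C] [Category D] {F : D ⥤ C} {G : C ⥤ D}
    (adj₁ : G ⊣ F) (adj₂ : F ⊣ G) : FrobeniusMonad C where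
  T := G ⋙ F
  μ Y := F.map (adj₁.counit.app (G.obj Y))
  η Y := adj₁.unit.app Y
  δ Y := F.map (adj₂.unit.app (G.obj Y))
  e Y := adj₂.counit.app Y
  μ_nat f := by
    simp only [Functor.comp_map, ← F.map_comp]
    exact congrArg F.map (adj₁.counit.naturality (G.map f))
  η_nat f := adj₁.unit.naturality f
  δ_nat f := by
    simp only [Functor.comp_map, ← F.map_comp]
    exact congrArg F.map (adj₂.unit.naturality (G.map f))
  e_nat f := adj₂.counit.naturality f
  μ_assoc Y := by
    simp only [Functor.comp_map, ← F.map_comp]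
    exact congrArg F.map (adj₁.counit.naturality _)
  η_μ Y := adj₁.right_triangle_components (G.obj Y)
  map_η_μ Y := by
    simp only [Functor.comp_map, ← F.map_comp]
    exact (congrArg F.map (adj₁.left_triangle_components Y)).trans (F.map_id _)
  δ_coassoc Y := by
    simp only [Functor.comp_map, ← F.map_comp]
    exact congrArg F.map (adj₂.unit.naturality _).symm
  δ_e Y := adj₂.left_triangle_components (G.obj Y)
  δ_map_e Y := by
    simp only [Functor.comp_map, ← F.map_comp]
    exact (congrArg F.map (adj₂.right_triangle_components Y)).trans (F.map_id _)
  map_δ_μ Y := by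
    simp only [Functor.comp_map, ← F.map_comp]
    exact congrArg F.map (adj₁.counit.naturality _)
  δ_map_μ Y := by
    simp only [Functor.comp_map, ← F.map_comp]
    exact congrArg F.map (adj₂.unit.naturality _).symm

variable {n : ℕ} {B : Fin n → ∀ Y, M.T.obj (M.T.obj Y) ⟶ M.T.obj Y}
  {B' : Fin n → ∀ Y, M.T.obj Y ⟶ M.T.obj (M.T.obj Y)}

/-- If `w` and `y` come from `β'` by closing up with `e` and with `x` respectively, then `y` is the
convolution of `x` and `w`. -/
theorem star_of_app {w x y : M.T ⟶ M.T} {β' : ∀ Y, M.T.obj Y ⟶ M.T.obj (M.T.obj Y)}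
    (hw : ∀ Y, w.app Y =
      M.T.map (M.η Y) ≫ M.T.map (β' Y) ≫ M.μ (M.T.obj Y) ≫ M.e (M.T.obj Y))
    (hy : ∀ Y, y.app Y =
      M.T.map (M.η Y) ≫ M.T.map (β' Y) ≫ M.μ (M.T.obj Y) ≫ x.app (M.T.obj Y) ≫ M.μ Y) :
    y = M.star x w := by
  ext Y
  rw [hy, star_app, hw]
  simp only [Functor.map_comp, Category.assoc]
  rw [← reassoc_of% M.δ_nat, ← reassoc_of% M.δ_nat, reassoc_of% M.δ_map_μ,
    reassoc_of% M.δ_map_e]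

/-- The statement dual to `star_of_app`, for maps `β` out of `T ∘ T`. -/
theorem star_of_app' {w x y : M.T ⟶ M.T} {β : ∀ Y, M.T.obj (M.T.obj Y) ⟶ M.T.obj Y}
    (hw : ∀ Y, w.app Y =
      M.η (M.T.obj Y) ≫ M.δ (M.T.obj Y) ≫ M.T.map (β Y) ≫ M.T.map (M.e Y))
    (hy : ∀ Y, y.app Y =
      M.δ Y ≫ x.app (M.T.obj Y) ≫ M.δ (M.T.obj Y) ≫ M.T.map (β Y) ≫ M.T.map (M.e Y)) :
    y = M.star x w := by
  ext Y
  rw [hy, star_app, hw]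
  simp only [Functor.map_comp, Category.assoc]
  rw [reassoc_of% M.nat x (M.T.map (M.e Y)), M.μ_nat, reassoc_of% M.nat x (M.T.map (β Y)),
    reassoc_of% M.μ_nat (β Y), reassoc_of% M.nat x (M.δ (M.T.obj Y)), reassoc_of% M.map_δ_μ,
    reassoc_of% M.nat x (M.η (M.T.obj Y)), reassoc_of% M.map_η_μ]

variable [Preadditive C] [M.T.Additive]

/-- A presentation of `T ∘ T` as a direct summand of a power of `T`, by morphisms of right
`T`-modules, gives a quasi-basis.  Only the linearity of the maps `B' i` matters. -/
theorem sum_map_comp_μ (hB : ∀ Y, ∑ i, B i Y ≫ B' i Y = 𝟙 _)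
    (hB' : ∀ i Y, B' i (M.T.obj Y) ≫ M.T.map (M.μ Y) = M.μ Y ≫ B' i Y)
    {W b : Fin n → (M.T ⟶ M.T)} (hb : ∀ i Y, (b i).app Y = M.T.map (M.η Y) ≫ B i Y)
    (hW : ∀ i Y, (W i).app Y =
      M.T.map (M.η Y) ≫ M.T.map (B' i Y) ≫ M.μ (M.T.obj Y) ≫ M.e (M.T.obj Y)) (Y : C) :
    ∑ i, M.T.map ((b i).app Y) ≫ (W i).app (M.T.obj Y) ≫ M.μ Y = M.μ Y ≫ M.e Y ≫ M.η Y := by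
  have h : ∀ i, M.T.map ((b i).app Y) ≫ (W i).app (M.T.obj Y) ≫ M.μ Y =
      M.T.map (M.T.map (M.η Y) ≫ B i Y ≫ B' i Y) ≫ M.μ (M.T.obj Y) ≫ M.e (M.T.obj Y) := by
    intro i
    rw [hb, hW]
    simp only [Functor.map_comp, Category.assoc]
    rw [← M.e_nat (M.μ Y), ← reassoc_of% M.μ_nat (M.μ Y), ← M.T.map_comp_assoc (B' i _), hB',
      M.T.map_comp_assoc, ← M.T.map_comp_assoc (M.η _), M.η_μ, M.T.map_id, Category.id_comp]
  simp only [h]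
  rw [← Preadditive.sum_comp, ← Functor.map_sum, ← Preadditive.comp_sum, hB, Category.comp_id,
    reassoc_of% M.μ_nat (M.η Y), M.e_nat]

/-- A presentation of `T ∘ T` as a direct summand of a power of `T`, by morphisms of right
`T`-comodules, gives families as in `sum_dual`.  Only the colinearity of the maps `B i` matters. -/
theorem sum_δ_comp_map (hB : ∀ Y, ∑ i, B i Y ≫ B' i Y = 𝟙 _)
    (hδ : ∀ i Y, M.T.map (M.δ Y) ≫ B i (M.T.obj Y) = B i Y ≫ M.δ Y)
    {U V : Fin n → (M.T ⟶ M.T)} (hU : ∀ i Y, (U i).app Y = B' i Y ≫ M.T.map (M.e Y))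
    (hV : ∀ i Y, (V i).app Y =
      M.η (M.T.obj Y) ≫ M.δ (M.T.obj Y) ≫ M.T.map (B i Y) ≫ M.T.map (M.e Y)) (Y : C) :
    ∑ i, M.δ Y ≫ M.T.map ((U i).app Y) ≫ (V i).app (M.T.obj Y) = M.e Y ≫ M.η Y ≫ M.δ Y := by
  have h : ∀ i, M.δ Y ≫ M.T.map ((U i).app Y) ≫ (V i).app (M.T.obj Y) =
      M.η (M.T.obj Y) ≫ M.δ (M.T.obj Y) ≫ M.T.map (B i Y ≫ B' i Y) ≫
        M.T.map (M.T.map (M.e Y)) := by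
    intro i
    rw [M.nat (V i), hV, hU]
    simp only [Functor.map_comp, Category.assoc]
    rw [reassoc_of% M.η_nat (M.δ Y), reassoc_of% M.δ_nat (M.δ Y), ← M.T.map_comp_assoc, hδ,
      M.T.map_comp_assoc, ← M.T.map_comp_assoc (M.δ Y), M.δ_e, M.T.map_id, Category.id_comp]
  simp only [h]
  rw [← Preadditive.comp_sum, ← Preadditive.comp_sum, ← Preadditive.sum_comp, ← Functor.map_sum,
    hB, M.T.map_id, Category.id_comp, ← M.δ_nat, ← reassoc_of% M.η_nat]

omit [Preadditive C] [M.T.Additive] in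
/-- Evaluating `S(a)` at the counit gives left multiplication by `a (1)`. -/
theorem δ_antipode_e (a : M.T ⟶ M.T) (Y : C) :
    M.δ Y ≫ (M.antipode a).app (M.T.obj Y) ≫ M.e (M.T.obj Y) =
      M.η (M.T.obj Y) ≫ a.app (M.T.obj Y) ≫ M.μ Y := by
  have h : ∀ Y, (M.antipode a).app Y ≫ M.e Y =
      M.η (M.T.obj Y) ≫ a.app (M.T.obj Y) ≫ M.μ Y ≫ M.e Y := by
    intro Y
    rw [antipode_app]
    simp only [← M.T.map_comp, Category.assoc]
    rw [M.e_nat, reassoc_of% M.δ_e]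
  rw [h, reassoc_of% M.η_nat (M.δ Y), reassoc_of% M.nat a (M.δ Y), reassoc_of% M.map_δ_μ, M.δ_e,
    Category.comp_id]

omit [Preadditive C] [M.T.Additive] in
/-- The antipode maps a left multiplication `p` to the right multiplication `q` with
`e ∘ p = e ∘ q`. -/
theorem antipode_eq_of_isLeftMul {p q : M.T ⟶ M.T} (hp : M.IsLeftMul p) (hq : M.IsRightMul q)
    (h : ∀ Y, p.app Y ≫ M.e Y = q.app Y ≫ M.e Y) : M.antipode p = q := by
  ext Y
  apply M.ext_form
  rw [map_antipode_form, reassoc_of% hp, reassoc_of% hq, h]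

theorem antipode_add (p q : M.T ⟶ M.T) :
    M.antipode (p + q) = M.antipode p + M.antipode q := by
  ext Y
  simp only [NatTrans.app_add, antipode_app, Functor.map_add, Preadditive.add_comp,
    Preadditive.comp_add]

end FrobeniusMonad

/-- A quasi-basis for the monad `G ⋙ F` presents `G ∘ F ∘ G` as a direct summand of a power of
`G`. -/
theorem sum_summand {C D : Type*} [Category C] [Category D] [Preadditive C] [Preadditive D]
    {F : D ⥤ C} {G : C ⥤ D} [G.Additive] (adj₁ : G ⊣ F) (adj₂ : F ⊣ G) {n : ℕ}
    {W b : Fin n → (G ⋙ F ⟶ G ⋙ F)}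
    (h : ∀ Y, ∑ i, F.map (G.map ((b i).app Y)) ≫ (W i).app (F.obj (G.obj Y)) ≫
        F.map (adj₁.counit.app (G.obj Y)) =
      F.map (adj₁.counit.app (G.obj Y)) ≫ adj₂.counit.app Y ≫ adj₁.unit.app Y) (Y : C) :
    ∑ i, (G.map ((W i).app Y) ≫ adj₁.counit.app (G.obj Y)) ≫
        (G.map (adj₁.unit.app Y ≫ F.map (adj₂.unit.app (G.obj Y)) ≫
          (b i).app (F.obj (G.obj Y))) ≫ adj₁.counit.app (G.obj (F.obj (G.obj Y)))) =
      𝟙 (G.obj (F.obj (G.obj Y))) := by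
  have h₁ : F.map (G.map (adj₁.unit.app Y)) ≫ F.map (G.map (F.map (adj₂.unit.app (G.obj Y)))) ≫
      F.map (adj₁.counit.app (G.obj (F.obj (G.obj Y)))) ≫ adj₂.counit.app (F.obj (G.obj Y)) =
      𝟙 (F.obj (G.obj Y)) := by
    let M := FrobeniusMonad.ofAdjunctions adj₁ adj₂
    have h : M.T.map (M.η Y) ≫ M.T.map (M.δ Y) ≫ M.μ (M.T.obj Y) ≫ M.e (M.T.obj Y) = 𝟙 _ := by
      rw [reassoc_of% M.map_δ_μ, M.δ_e, Category.comp_id, M.map_η_μ]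
    exact h
  have h₂ : ∀ i, (G.map ((W i).app Y) ≫ adj₁.counit.app (G.obj Y)) ≫
      (G.map (adj₁.unit.app Y ≫ F.map (adj₂.unit.app (G.obj Y)) ≫
        (b i).app (F.obj (G.obj Y))) ≫ adj₁.counit.app (G.obj (F.obj (G.obj Y)))) =
      G.map (F.map (G.map (adj₁.unit.app Y)) ≫ F.map (G.map (F.map (adj₂.unit.app (G.obj Y)))) ≫
        F.map (G.map ((b i).app (F.obj (G.obj Y)))) ≫ (W i).app (F.obj (G.obj (F.obj (G.obj Y)))) ≫
        F.map (adj₁.counit.app (G.obj (F.obj (G.obj Y))))) ≫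
        adj₁.counit.app (G.obj (F.obj (G.obj Y))) := by
    intro i
    have hW := (W i).naturality (adj₁.unit.app Y ≫ F.map (adj₂.unit.app (G.obj Y)) ≫
      (b i).app (F.obj (G.obj Y)))
    simp only [Functor.comp_map, Functor.map_comp, Functor.comp_obj, Category.assoc] at hW
    rw [reassoc_of% hW]
    have hc : ∀ {X Z : D} (f : X ⟶ Z), adj₁.counit.app X ≫ f =
        G.map (F.map f) ≫ adj₁.counit.app Z := fun f => (adj₁.counit.naturality f).symm
    simp only [Functor.map_comp, Functor.comp_obj, Category.assoc]
    rw [reassoc_of% hc (G.map (adj₁.unit.app Y)),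
      reassoc_of% hc (G.map (F.map (adj₂.unit.app (G.obj Y)))),
      reassoc_of% hc (G.map ((b i).app (F.obj (G.obj Y)))), hc]
    rfl
  simp only [h₂]
  rw [← Preadditive.sum_comp, ← Functor.map_sum, ← Preadditive.comp_sum, ← Preadditive.comp_sum, h,
    reassoc_of% h₁]
  exact adj₁.left_triangle_components _

/-! ### The Frobenius monad of a Frobenius 1-morphism -/

namespace DepthTwo

variable {𝒞 : Type u} [Bicategory.{w, v} 𝒞] {a b : 𝒞} {ι : a ⟶ b} {ιbar : b ⟶ a}

/-- The unit of the adjunction of composition functors induced by `adj`. -/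
def unitApp (adj : ιbar ⊣ ι) {c : 𝒞} (Y : c ⟶ b) : Y ⟶ (Y ≫ ιbar) ≫ ι :=
  (ρ_ Y).inv ≫ Y ◁ adj.unit ≫ (α_ Y ιbar ι).inv

/-- The counit of the adjunction of composition functors induced by `adj`. -/
def counitApp (adj : ιbar ⊣ ι) {c : 𝒞} (Z : c ⟶ a) : (Z ≫ ι) ≫ ιbar ⟶ Z :=
  (α_ Z ι ιbar).hom ≫ Z ◁ adj.counit ≫ (ρ_ Z).hom

theorem unitApp_naturality (adj : ιbar ⊣ ι) {c : 𝒞} {X Y : c ⟶ b} (f : X ⟶ Y) :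
    f ≫ unitApp adj Y = unitApp adj X ≫ f ▷ ιbar ▷ ι := by
  simp only [unitApp, Category.assoc]
  rw [rightUnitor_inv_naturality_assoc, ← whisker_exchange_assoc, associator_inv_naturality_left]

theorem counitApp_naturality (adj : ιbar ⊣ ι) {c : 𝒞} {X Y : c ⟶ a} (f : X ⟶ Y) :
    f ▷ ι ▷ ιbar ≫ counitApp adj Y = counitApp adj X ≫ f := by
  simp only [counitApp, Category.assoc]
  rw [associator_naturality_left_assoc, ← whisker_exchange_assoc, rightUnitor_naturality]

theorem unitApp_triangle (adj : ιbar ⊣ ι) {c : 𝒞} (Y : c ⟶ b) :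
    unitApp adj Y ▷ ιbar ≫ counitApp adj (Y ≫ ιbar) = 𝟙 _ := by
  calc _ = Y ◁ ((λ_ ιbar).inv ≫ leftZigzag adj.unit adj.counit ≫ (ρ_ ιbar).hom) := by
        simp only [unitApp, counitApp, leftZigzag]
        bicategory
    _ = _ := by
        rw [adj.left_triangle]
        simp

theorem counitApp_triangle (adj : ιbar ⊣ ι) {c : 𝒞} (Z : c ⟶ a) :
    unitApp adj (Z ≫ ι) ≫ counitApp adj Z ▷ ι = 𝟙 _ := by
  calc _ = Z ◁ ((ρ_ _).inv ≫ rightZigzag adj.unit adj.counit ≫ (λ_ _).hom) := by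
        simp only [unitApp, counitApp, rightZigzag]
        bicategory
    _ = _ := by
        rw [adj.right_triangle]
        simp

/-- An adjunction of 1-morphisms induces an adjunction of the composition functors. -/
def postcompAdj (c : 𝒞) (adj : ιbar ⊣ ι) : postcomp c ιbar ⊣ postcomp c ι :=
  CategoryTheory.Adjunction.mkOfUnitCounit
    { unit := { app := unitApp adj, naturality := fun _ _ f => unitApp_naturality adj f }
      counit := { app := counitApp adj, naturality := fun _ _ f => counitApp_naturality adj f }
      left_triangle := by
        ext Y
        exact (congrArg _ (Category.id_comp _)).trans (unitApp_triangle adj Y)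
      right_triangle := by
        ext Z
        exact (congrArg _ (Category.id_comp _)).trans (counitApp_triangle adj Z) }

/-- The Frobenius monad `Y ↦ (Y ≫ ῑ) ≫ ι` of a Frobenius 1-morphism. -/
abbrev frobeniusMonad (c : 𝒞) (adjL : ιbar ⊣ ι) (adjR : ι ⊣ ιbar) : FrobeniusMonad (c ⟶ b) :=
  FrobeniusMonad.ofAdjunctions (postcompAdj c adjL) (postcompAdj c adjR)

/-- The components of `act`. -/
def actApp (x : End (ιbar ≫ ι)) {c : 𝒞} (Y : c ⟶ b) : (Y ≫ ιbar) ≫ ι ⟶ (Y ≫ ιbar) ≫ ι :=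
  (α_ Y ιbar ι).hom ≫ Y ◁ x.asHom ≫ (α_ Y ιbar ι).inv

/-- The action of an endomorphism of `ῑ ≫ ι` on `Y ↦ (Y ≫ ῑ) ≫ ι`. -/
def act (c : 𝒞) (x : End (ιbar ≫ ι)) :
    postcomp c ιbar ⋙ postcomp c ι ⟶ postcomp c ιbar ⋙ postcomp c ι where
  app Y := actApp x Y
  naturality X Y f := by
    change f ▷ ιbar ▷ ι ≫ actApp x Y = actApp x X ≫ f ▷ ιbar ▷ ι
    simp only [actApp, Category.assoc]
    rw [associator_naturality_left_assoc, ← whisker_exchange_assoc, associator_inv_naturality_left]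

/-- An endomorphism of `ῑ ≫ ι` is recovered from its action on `𝟙 b`. -/
theorem act_injective : Function.Injective (act (ι := ι) (ιbar := ιbar) b) := by
  intro x y h
  have h : actApp x (𝟙 b) = actApp y (𝟙 b) := NatTrans.congr_app h (𝟙 b)
  simpa [actApp] using h

theorem act_one (c : 𝒞) : act c (1 : End (ιbar ≫ ι)) = 𝟙 _ := by
  ext Y
  change actApp (1 : End (ιbar ≫ ι)) Y = 𝟙 ((Y ≫ ιbar) ≫ ι)
  simp [actApp]

theorem act_mul (c : 𝒞) (x y : End (ιbar ≫ ι)) : act c (x * y) = act c y ≫ act c x := by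
  ext Y
  change actApp (x * y) Y = actApp y Y ≫ actApp x Y
  simp [actApp]

theorem act_add [PreadditiveBicategory 𝒞] (c : 𝒞) (x y : End (ιbar ≫ ι)) :
    act c (x + y) = act c x + act c y := by
  ext Y
  change actApp (x + y) Y = actApp x Y + actApp y Y
  simp only [actApp]
  rw [show (x + y).asHom = x.asHom + y.asHom from rfl, PreadditiveBicategory.whiskerLeft_add]
  simp

/-- The convolution product of `End (ῑ ≫ ι)`. -/
def conv (adjL : ιbar ⊣ ι) (adjR : ι ⊣ ιbar) (x y : End (ιbar ≫ ι)) : End (ιbar ≫ ι) :=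
  𝟙 (ιbar ≫ ι) ⊗≫ ιbar ◁ adjR.unit ▷ ι ⊗≫ y.asHom ▷ (ιbar ≫ ι) ⊗≫ (ιbar ≫ ι) ◁ x.asHom ⊗≫
    ιbar ◁ adjL.counit ▷ ι ⊗≫ 𝟙 (ιbar ≫ ι)

/-- The inverse of the antipode. -/
def antipodeAInv (adjL : ιbar ⊣ ι) (adjR : ι ⊣ ιbar) (x : End (ιbar ≫ ι)) : End (ιbar ≫ ι) :=
  𝟙 (ιbar ≫ ι) ⊗≫ adjL.unit ▷ (ιbar ≫ ι) ⊗≫ ιbar ◁ adjR.unit ▷ (ι ≫ ιbar ≫ ι) ⊗≫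
    (ιbar ≫ ι) ◁ x.asHom ▷ (ιbar ≫ ι) ⊗≫ (ιbar ≫ ι ≫ ιbar) ◁ adjL.counit ▷ ι ⊗≫
    (ιbar ≫ ι) ◁ adjR.counit ⊗≫ 𝟙 (ιbar ≫ ι)

variable (c : 𝒞) (adjL : ιbar ⊣ ι) (adjR : ι ⊣ ιbar) (x y : End (ιbar ≫ ι)) (Y : c ⟶ b)

theorem act_antipodeA : act c (antipodeA adjL adjR x) =
    (frobeniusMonad c adjL adjR).antipode (act c x) := by
  ext Y
  change actApp (antipodeA adjL adjR x) Y = unitApp adjL ((Y ≫ ιbar) ≫ ι) ≫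
    unitApp adjR (((Y ≫ ιbar) ≫ ι) ≫ ιbar) ▷ ι ≫ actApp x ((Y ≫ ιbar) ≫ ι) ▷ ιbar ▷ ι ≫
    counitApp adjL (Y ≫ ιbar) ▷ ι ▷ ιbar ▷ ι ≫ counitApp adjR Y ▷ ιbar ▷ ι
  simp only [actApp, unitApp, counitApp, antipodeA]
  bicategory

theorem act_antipodeAInv : act c (antipodeAInv adjL adjR x) =
    (frobeniusMonad c adjL adjR).antipodeInv (act c x) := by
  ext Y
  change actApp (antipodeAInv adjL adjR x) Y = unitApp adjL Y ▷ ιbar ▷ ι ≫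
    unitApp adjR (Y ≫ ιbar) ▷ ι ▷ ιbar ▷ ι ≫ actApp x ((Y ≫ ιbar) ≫ ι) ▷ ιbar ▷ ι ≫
    counitApp adjL (((Y ≫ ιbar) ≫ ι) ≫ ιbar) ▷ ι ≫ counitApp adjR ((Y ≫ ιbar) ≫ ι)
  simp only [actApp, unitApp, counitApp, antipodeAInv]
  bicategory

theorem act_conv : act c (conv adjL adjR x y) =
    (frobeniusMonad c adjL adjR).star (act c x) (act c y) := by
  ext Y
  change actApp (conv adjL adjR x y) Y = unitApp adjR (Y ≫ ιbar) ▷ ι ≫ actApp y Y ▷ ιbar ▷ ι ≫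
    actApp x ((Y ≫ ιbar) ≫ ι) ≫ counitApp adjL (Y ≫ ιbar) ▷ ι
  simp only [actApp, unitApp, counitApp, conv]
  bicategory

theorem act_upsilon : act c (upsilon adjL adjR) = (frobeniusMonad c adjL adjR).upsilon := by
  ext Y
  change actApp (upsilon adjL adjR) Y = counitApp adjR Y ≫ unitApp adjL Y
  simp only [actApp, unitApp, counitApp, upsilon]
  bicategory

theorem isPointOf_sL_piL :
    (frobeniusMonad c adjL adjR).IsPointOf (act c (sL ιbar (piL adjL x))) (act c x) := by
  intro Y
  change actApp (sL ιbar (piL adjL x)) Y = unitApp adjL ((Y ≫ ιbar) ≫ ι) ≫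
    actApp x ((Y ≫ ιbar) ≫ ι) ≫ counitApp adjL (Y ≫ ιbar) ▷ ι
  simp only [actApp, unitApp, counitApp, sL, piL]
  bicategory

theorem piL_sL (l : End ι) : piL adjL (sL ιbar l) = l := by
  apply (whiskerLeft_iff _ _).1
  calc 𝟙 a ◁ piL adjL (sL ιbar l) = unitApp adjL (𝟙 a ≫ ι) ≫
        ((𝟙 a ≫ ι) ≫ ιbar) ◁ l.asHom ≫ counitApp adjL (𝟙 a) ▷ ι := by
        simp only [unitApp, counitApp, piL, sL]
        bicategory
    _ = 𝟙 a ◁ l := by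
        rw [whisker_exchange, reassoc_of% counitApp_triangle]

/-- Evaluation of a 2-morphism `k : ῑ ⟶ ῑ` in the image of the composition functor. -/
theorem actApp_whiskerRight (k : ιbar ⟶ ιbar) :
    actApp (ι := ι) (End.of (k ▷ ι)) Y = (Y ◁ k) ▷ ι := by
  simp only [actApp]
  bicategory

theorem isRightMul_whiskerRight (k : ιbar ⟶ ιbar) :
    (frobeniusMonad c adjL adjR).IsRightMul (act c (End.of (k ▷ ι))) := by
  intro Y
  change actApp (End.of (k ▷ ι)) Y ▷ ιbar ▷ ι ≫ counitApp adjL (Y ≫ ιbar) ▷ ι =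
    counitApp adjL (Y ≫ ιbar) ▷ ι ≫ actApp (End.of (k ▷ ι)) Y
  rw [actApp_whiskerRight, ← comp_whiskerRight, ← comp_whiskerRight, counitApp_naturality]

theorem η_sL (l : End ι) : (frobeniusMonad c adjL adjR).η Y ≫ (act c (sL ιbar l)).app Y =
    (frobeniusMonad c adjL adjR).η Y ≫ (act c (tL adjL l)).app Y := by
  change unitApp adjL Y ≫ actApp (sL ιbar l) Y = unitApp adjL Y ≫ actApp (tL adjL l) Y
  have h₁ : actApp (sL ιbar l) Y = (Y ≫ ιbar) ◁ l.asHom := by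
    simp only [actApp, sL]
    bicategory
  have h₂ : actApp (tL adjL l) Y = (unitApp adjL Y ▷ ιbar ≫ ((Y ≫ ιbar) ◁ l.asHom) ▷ ιbar ≫
      counitApp adjL (Y ≫ ιbar)) ▷ ι := by
    simp only [actApp, tL, mate, unitApp, counitApp]
    bicategory
  rw [h₁, h₂, comp_whiskerRight, comp_whiskerRight, ← reassoc_of% unitApp_naturality,
    ← reassoc_of% unitApp_naturality, counitApp_triangle, Category.comp_id]

end DepthTwo

namespace DepthTwo

variable {𝒞 : Type u} [Bicategory.{w, v} 𝒞] {a b : 𝒞} {ι : a ⟶ b} {ιbar : b ⟶ a}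

/-! ### Transposition -/

/-- The transpose of a 2-morphism `ι ≫ ῑ ⟶ 𝟙`. -/
def transpose (adj : ιbar ⊣ ι) (f : ι ≫ ιbar ⟶ 𝟙 a) : ιbar ⟶ ιbar :=
  𝟙 ιbar ⊗≫ adj.unit ▷ ιbar ⊗≫ ιbar ◁ f ⊗≫ 𝟙 ιbar

theorem whiskerLeft_transpose (adj : ιbar ⊣ ι) (f : ι ≫ ιbar ⟶ 𝟙 a) :
    ι ◁ transpose adj f ≫ adj.counit = f := by
  calc _ = 𝟙 (ι ≫ ιbar) ⊗≫ ι ◁ adj.unit ▷ ιbar ⊗≫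
        ((ι ≫ ιbar) ◁ f ≫ adj.counit ▷ 𝟙 a) ⊗≫ 𝟙 (𝟙 a) := by
        simp only [transpose]
        bicategory
    _ = (𝟙 (ι ≫ ιbar) ⊗≫ rightZigzag adj.unit adj.counit ▷ ιbar ⊗≫ 𝟙 (ι ≫ ιbar)) ≫ f := by
        rw [whisker_exchange]
        simp only [rightZigzag]
        bicategory
    _ = f := by
        rw [adj.right_triangle]
        bicategory

theorem transpose_whiskerLeft (adj : ιbar ⊣ ι) (k : ιbar ⟶ ιbar) :
    transpose adj (ι ◁ k ≫ adj.counit) = k := by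
  calc _ = 𝟙 ιbar ⊗≫ (adj.unit ▷ ιbar ≫ (ιbar ≫ ι) ◁ k) ⊗≫ ιbar ◁ adj.counit ⊗≫ 𝟙 ιbar := by
        simp only [transpose]
        bicategory
    _ = k ≫ (𝟙 ιbar ⊗≫ leftZigzag adj.unit adj.counit ⊗≫ 𝟙 ιbar) := by
        rw [← whisker_exchange]
        simp only [leftZigzag]
        bicategory
    _ = k := by
        rw [adj.left_triangle]
        bicategory

theorem mate_eq_transpose (adj : ιbar ⊣ ι) (l : End ι) :
    mate adj l = transpose adj (l.asHom ▷ ιbar ≫ adj.counit) := by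
  simp only [mate, transpose]
  bicategory

theorem whiskerLeft_mate (adj : ιbar ⊣ ι) (l : End ι) :
    ι ◁ (mate adj l).asHom ≫ adj.counit = l.asHom ▷ ιbar ≫ adj.counit := by
  have h := whiskerLeft_transpose adj (l.asHom ▷ ιbar ≫ adj.counit)
  rwa [← mate_eq_transpose] at h

theorem mate_eq_of_whiskerLeft (adj : ιbar ⊣ ι) (l : End ι) (k : End ιbar)
    (h : ι ◁ k.asHom ≫ adj.counit = l.asHom ▷ ιbar ≫ adj.counit) : mate adj l = k := by
  rw [mate_eq_transpose, ← h]
  exact transpose_whiskerLeft adj k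

theorem mate_one (adj : ιbar ⊣ ι) : mate adj 1 = 1 :=
  mate_eq_of_whiskerLeft adj _ _ (by simp)

theorem mate_mul (adj : ιbar ⊣ ι) (l l' : End ι) :
    mate adj (l * l') = mate adj l' * mate adj l := by
  apply mate_eq_of_whiskerLeft
  have h : ∀ k k' : ιbar ⟶ ιbar, ι ◁ (k ≫ k') = ι ◁ k ≫ ι ◁ k' := by simp
  change ι ◁ ((mate adj l).asHom ≫ (mate adj l').asHom) ≫ adj.counit =
    (l'.asHom ≫ l.asHom) ▷ ιbar ≫ adj.counit
  rw [h, Category.assoc, whiskerLeft_mate, whisker_exchange_assoc, whiskerLeft_mate,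
    comp_whiskerRight, Category.assoc]

theorem mate_add [PreadditiveBicategory 𝒞] (adj : ιbar ⊣ ι) (l l' : End ι) :
    mate adj (l + l') = mate adj l + mate adj l' := by
  apply mate_eq_of_whiskerLeft
  change ι ◁ ((mate adj l).asHom + (mate adj l').asHom) ≫ adj.counit =
    (l.asHom + l'.asHom) ▷ ιbar ≫ adj.counit
  rw [PreadditiveBicategory.whiskerLeft_add, PreadditiveBicategory.add_whiskerRight,
    Preadditive.add_comp, Preadditive.add_comp, whiskerLeft_mate, whiskerLeft_mate]

theorem piR_whiskerRight (adj : ιbar ⊣ ι) (y : End (ι ≫ ιbar)) :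
    (piR adj y).asHom ▷ ιbar ≫ adj.counit = y.asHom ≫ adj.counit := by
  calc _ = 𝟙 (ι ≫ ιbar) ⊗≫ ι ◁ adj.unit ▷ ιbar ⊗≫ y.asHom ▷ (ι ≫ ιbar) ⊗≫
        (adj.counit ▷ (ι ≫ ιbar) ≫ 𝟙 a ◁ adj.counit) ⊗≫ 𝟙 (𝟙 a) := by
        simp only [piR]
        bicategory
    _ = 𝟙 (ι ≫ ιbar) ⊗≫ ι ◁ adj.unit ▷ ιbar ⊗≫ (y.asHom ▷ (ι ≫ ιbar) ≫
        (ι ≫ ιbar) ◁ adj.counit) ≫ adj.counit ▷ 𝟙 a ⊗≫ 𝟙 (𝟙 a) := by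
        rw [← whisker_exchange]
        bicategory
    _ = (𝟙 (ι ≫ ιbar) ⊗≫ ι ◁ leftZigzag adj.unit adj.counit ⊗≫ 𝟙 (ι ≫ ιbar)) ≫ y.asHom ≫
        adj.counit := by
        rw [← whisker_exchange]
        simp only [leftZigzag]
        bicategory
    _ = _ := by
        rw [adj.left_triangle]
        bicategory

theorem piR_sR (adj : ιbar ⊣ ι) (r : End ι) : piR adj (sR ιbar r) = r := by
  calc _ = 𝟙 ι ⊗≫ (ι ◁ adj.unit ≫ r.asHom ▷ (ιbar ≫ ι)) ⊗≫ adj.counit ▷ ι ⊗≫ 𝟙 ι := by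
        simp only [piR, sR]
        bicategory
    _ = r.asHom ≫ (𝟙 ι ⊗≫ rightZigzag adj.unit adj.counit ⊗≫ 𝟙 ι) := by
        rw [whisker_exchange]
        simp only [rightZigzag]
        bicategory
    _ = r.asHom := by
        rw [adj.right_triangle]
        bicategory

/-! ### The representations -/

section

variable (c : 𝒞) (adjL : ιbar ⊣ ι) (adjR : ι ⊣ ιbar)

theorem actApp_sL (l : End ι) (Y : c ⟶ b) : actApp (sL ιbar l) Y = (Y ≫ ιbar) ◁ l.asHom := by
  simp only [actApp, sL]
  bicategory

theorem isLeftMul_sL (l : End ι) : (frobeniusMonad c adjL adjR).IsLeftMul (act c (sL ιbar l)) := by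
  intro Y
  change actApp (sL ιbar l) ((Y ≫ ιbar) ≫ ι) ≫ counitApp adjL (Y ≫ ιbar) ▷ ι =
    counitApp adjL (Y ≫ ιbar) ▷ ι ≫ actApp (sL ιbar l) Y
  rw [actApp_sL, actApp_sL, whisker_exchange]

/-- The antipode maps left multiplication by a point to right multiplication by it. -/
theorem antipodeA_sL_mate (l : End ιbar) :
    antipodeA adjL adjR (sL ιbar (mate adjR l)) = End.of (l.asHom ▷ ι) := by
  apply act_injective
  rw [act_antipodeA]
  refine FrobeniusMonad.antipode_eq_of_isLeftMul _ (isLeftMul_sL b adjL adjR _)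
    (isRightMul_whiskerRight b adjL adjR l.asHom) fun Y => ?_
  change actApp (sL ιbar (mate adjR l)) Y ≫ counitApp adjR Y =
    actApp (End.of (l.asHom ▷ ι)) Y ≫ counitApp adjR Y
  simp only [actApp, sL, counitApp, Category.assoc, Iso.inv_hom_id_assoc]
  rw [← whiskerLeft_comp_assoc, ← whiskerLeft_comp_assoc, whiskerLeft_mate]

/-- For the Frobenius monad of `ῑ`, the map `t_R ∘ π_R` is evaluation at the counit. -/
theorem act_tR_piR (y : End (ι ≫ ιbar)) (Y : c ⟶ a) :
    (act c (tR adjL (piR adjL y))).app Y =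
      (frobeniusMonad c adjR adjL).δ Y ≫
        (act c y).app ((frobeniusMonad c adjR adjL).T.obj Y) ≫
        (frobeniusMonad c adjR adjL).e ((frobeniusMonad c adjR adjL).T.obj Y) := by
  change actApp (tR adjL (piR adjL y)) Y = unitApp adjL (Y ≫ ι) ▷ ιbar ≫
    actApp y ((Y ≫ ι) ≫ ιbar) ≫ counitApp adjL ((Y ≫ ι) ≫ ιbar)
  have h : mate adjL (piR adjL y) = transpose adjL (y.asHom ≫ adjL.counit) := by
    rw [mate_eq_transpose, piR_whiskerRight]
  simp only [tR]
  rw [h]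
  simp only [actApp, unitApp, counitApp, transpose]
  bicategory

variable [PreadditiveBicategory 𝒞]

instance (c : 𝒞) (f : a ⟶ b) : (postcomp c f).Additive where
  map_add {_ _ η θ} := PreadditiveBicategory.add_whiskerRight η θ f

instance : (frobeniusMonad c adjL adjR).T.Additive :=
  inferInstanceAs (postcomp c ιbar ⋙ postcomp c ι).Additive

theorem piL_add (x y : End (ιbar ≫ ι)) : piL adjL (x + y) = piL adjL x + piL adjL y := by
  change 𝟙 ι ⊗≫ ι ◁ adjL.unit ⊗≫ ι ◁ (x.asHom + y.asHom) ⊗≫ adjL.counit ▷ ι ⊗≫ 𝟙 ι =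
    (𝟙 ι ⊗≫ ι ◁ adjL.unit ⊗≫ ι ◁ x.asHom ⊗≫ adjL.counit ▷ ι ⊗≫ 𝟙 ι) +
    (𝟙 ι ⊗≫ ι ◁ adjL.unit ⊗≫ ι ◁ y.asHom ⊗≫ adjL.counit ▷ ι ⊗≫ 𝟙 ι)
  simp only [bicategoricalComp, PreadditiveBicategory.whiskerLeft_add, Preadditive.add_comp,
    Preadditive.comp_add]

theorem piR_add (x y : End (ι ≫ ιbar)) : piR adjL (x + y) = piR adjL x + piR adjL y := by
  change 𝟙 ι ⊗≫ ι ◁ adjL.unit ⊗≫ (x.asHom + y.asHom) ▷ ι ⊗≫ adjL.counit ▷ ι ⊗≫ 𝟙 ι =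
    (𝟙 ι ⊗≫ ι ◁ adjL.unit ⊗≫ x.asHom ▷ ι ⊗≫ adjL.counit ▷ ι ⊗≫ 𝟙 ι) +
    (𝟙 ι ⊗≫ ι ◁ adjL.unit ⊗≫ y.asHom ▷ ι ⊗≫ adjL.counit ▷ ι ⊗≫ 𝟙 ι)
  simp only [bicategoricalComp, PreadditiveBicategory.add_whiskerRight, Preadditive.add_comp,
    Preadditive.comp_add]

theorem antipodeA_add (x y : End (ιbar ≫ ι)) :
    antipodeA adjL adjR (x + y) = antipodeA adjL adjR x + antipodeA adjL adjR y := by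
  apply act_injective
  rw [act_antipodeA, act_add]
  refine (FrobeniusMonad.antipode_add (frobeniusMonad b adjL adjR) _ _).trans ?_
  rw [← act_antipodeA, ← act_antipodeA]
  exact (act_add _ _ _).symm

/-- The source map of `𝓐_L` as a ring homomorphism. -/
def sLHom (ι : a ⟶ b) (ιbar : b ⟶ a) : End ι →+* End (ιbar ≫ ι) :=
  RingHom.mk' ⟨⟨sL ιbar, whiskerLeft_id ιbar ι⟩, fun l l' => whiskerLeft_comp ιbar l' l⟩
    fun l l' => PreadditiveBicategory.whiskerLeft_add ιbar l l'

/-- The target map of `𝓑_R` as a ring homomorphism. -/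
def tRHom (adj : ιbar ⊣ ι) : (End ι)ᵐᵒᵖ →+* End (ι ≫ ιbar) :=
  (sLHom ιbar ι).comp (RingHom.mk' ⟨⟨fun r => mate adj r.unop, mate_one adj⟩,
    fun l l' => mate_mul adj l'.unop l.unop⟩ fun l l' => mate_add adj l.unop l'.unop)

/-- The representation of `A`, over the base ring `L = End ι`. -/
def representationA :
    (frobeniusMonad b adjL adjR).Representation (End (ιbar ≫ ι)) (End ι) where
  act := act b
  act_injective := act_injective
  act_add := act_add b
  act_one := act_one b
  act_mul := act_mul b
  s := sLHom ι ιbar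
  t := tL adjL
  π := AddMonoidHom.mk' (piL adjL) (piL_add adjL)
  star := conv adjL adjR
  Υ := upsilon adjL adjR
  S := antipodeA adjL adjR
  S' := antipodeAInv adjL adjR
  act_star := act_conv b adjL adjR
  act_Υ := act_upsilon b adjL adjR
  act_S := act_antipodeA b adjL adjR
  act_S' := act_antipodeAInv b adjL adjR
  π_s := piL_sL adjL
  s_π := isPointOf_sL_piL b adjL adjR
  t_isRightMul l := isRightMul_whiskerRight b adjL adjR (mate adjL l)
  η_t l Y := η_sL b adjL adjR Y l

/-- The representation of `B`, over the base ring `Rᵐᵒᵖ` with `R = End ι`.  It is the one of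
`A` for the Frobenius 1-morphism `ῑ`, transported along `mate adjL`. -/
def representationB :
    (frobeniusMonad a adjR adjL).Representation (End (ι ≫ ιbar)) (End ι)ᵐᵒᵖ where
  act := act a
  act_injective := act_injective
  act_add := act_add a
  act_one := act_one a
  act_mul := act_mul a
  s := tRHom adjL
  t r := tL adjR (mate adjL r.unop)
  π := AddMonoidHom.mk' (fun y => op (piR adjL (antipodeB adjL adjR y))) fun x y =>
    congrArg op ((congrArg (piR adjL) (antipodeA_add adjR adjL x y)).trans (piR_add adjL _ _))
  star := conv adjR adjL
  Υ := ell adjL adjR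
  S := antipodeB adjL adjR
  S' := antipodeAInv adjR adjL
  act_star := act_conv a adjR adjL
  act_Υ := act_upsilon a adjR adjL
  act_S := act_antipodeA a adjR adjL
  act_S' := act_antipodeAInv a adjR adjL
  π_s r := by
    have h : antipodeB adjL adjR (tRHom adjL r) = sR ιbar r.unop :=
      antipodeA_sL_mate adjR adjL r.unop
    rw [AddMonoidHom.mk'_apply, h, piR_sR, op_unop]
  s_π y Y := by
    refine (act_tR_piR a adjL adjR (antipodeB adjL adjR y) Y).trans ?_
    rw [show act a (antipodeB adjL adjR y) = _ from act_antipodeA a adjR adjL y]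
    exact FrobeniusMonad.δ_antipode_e _ _ Y
  t_isRightMul r := isRightMul_whiskerRight a adjR adjL _
  η_t r Y := η_sL a adjR adjL Y (mate adjL r.unop)

end

end DepthTwo

/-! ### Depth 2 -/

namespace DepthTwo

variable {𝒞 : Type u} [Bicategory.{w, v} 𝒞] {a b : 𝒞} {ι : a ⟶ b} {ιbar : b ⟶ a}

/-- The component at `Z` of the transformation `Z ≫ ι ≫ ῑ ≫ ι ⟶ Z ≫ ι` induced by `β`. -/
def betaApp (β : ι ≫ ιbar ≫ ι ⟶ ι) {c : 𝒞} (Z : c ⟶ a) : ((Z ≫ ι) ≫ ιbar) ≫ ι ⟶ Z ≫ ι :=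
  (α_ (Z ≫ ι) ιbar ι).hom ≫ (α_ Z ι (ιbar ≫ ι)).hom ≫ Z ◁ β

/-- The component at `Z` of the transformation `Z ≫ ι ⟶ Z ≫ ι ≫ ῑ ≫ ι` induced by `β'`. -/
def betaApp' (β' : ι ⟶ ι ≫ ιbar ≫ ι) {c : 𝒞} (Z : c ⟶ a) : Z ≫ ι ⟶ ((Z ≫ ι) ≫ ιbar) ≫ ι :=
  Z ◁ β' ≫ (α_ Z ι (ιbar ≫ ι)).inv ≫ (α_ (Z ≫ ι) ιbar ι).inv

theorem betaApp_naturality (β : ι ≫ ιbar ≫ ι ⟶ ι) {c : 𝒞} {X Z : c ⟶ a} (f : X ⟶ Z) :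
    f ▷ ι ▷ ιbar ▷ ι ≫ betaApp β Z = betaApp β X ≫ f ▷ ι := by
  simp only [betaApp, Category.assoc]
  rw [associator_naturality_left_assoc, associator_naturality_left_assoc, whisker_exchange]

theorem betaApp'_naturality (β' : ι ⟶ ι ≫ ιbar ≫ ι) {c : 𝒞} {X Z : c ⟶ a} (f : X ⟶ Z) :
    betaApp' β' X ≫ f ▷ ι ▷ ιbar ▷ ι = f ▷ ι ≫ betaApp' β' Z := by
  simp only [betaApp', Category.assoc]
  rw [← whisker_exchange_assoc, ← associator_inv_naturality_left,
    associator_inv_naturality_left_assoc]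

section

variable (c : 𝒞) (adjL : ιbar ⊣ ι) (adjR : ι ⊣ ιbar) (Y : c ⟶ b)

theorem actApp_gammaL₂ (β : ι ≫ ιbar ≫ ι ⟶ ι) :
    actApp (gammaL₂ adjL β) Y = unitApp adjL Y ▷ ιbar ▷ ι ≫ betaApp β (Y ≫ ιbar) := by
  simp only [actApp, gammaL₂, unitApp, betaApp]
  bicategory

theorem actApp_gammaL₁ (β' : ι ⟶ ι ≫ ιbar ≫ ι) (x : End (ιbar ≫ ι)) :
    actApp (gammaL₁ adjL β' x) Y = unitApp adjL Y ▷ ιbar ▷ ι ≫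
      betaApp' β' (Y ≫ ιbar) ▷ ιbar ▷ ι ≫ counitApp adjL (((Y ≫ ιbar) ≫ ι) ≫ ιbar) ▷ ι ≫
      actApp x ((Y ≫ ιbar) ≫ ι) ≫ counitApp adjL (Y ≫ ιbar) ▷ ι := by
  simp only [actApp, gammaL₁, unitApp, betaApp', counitApp]
  bicategory

/-- The first leg of `γ_R`, in terms of the Frobenius monad of `ῑ`. -/
theorem actApp_gammaR₁ (β : ιbar ≫ ι ≫ ιbar ⟶ ιbar) (y : End (ι ≫ ιbar)) (Z : c ⟶ a) :
    actApp (gammaR₁ adjL β y) Z = unitApp adjL (Z ≫ ι) ▷ ιbar ≫ actApp y ((Z ≫ ι) ≫ ιbar) ≫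
      unitApp adjL (((Z ≫ ι) ≫ ιbar) ≫ ι) ▷ ιbar ≫ betaApp β (Z ≫ ι) ▷ ι ▷ ιbar ≫
      counitApp adjL Z ▷ ι ▷ ιbar := by
  simp only [actApp, gammaR₁, unitApp, betaApp, counitApp]
  bicategory

theorem actApp_gammaR₂ (β' : ιbar ⟶ ιbar ≫ ι ≫ ιbar) (Z : c ⟶ a) :
    actApp (gammaR₂ adjL β') Z = betaApp' β' (Z ≫ ι) ≫ counitApp adjL Z ▷ ι ▷ ιbar := by
  simp only [actApp, gammaR₂, betaApp', counitApp]
  bicategory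

theorem upsilon_comp_counitApp : actApp (upsilon adjL adjR) ((Y ≫ ιbar) ≫ ι) ≫
    counitApp adjL (Y ≫ ιbar) ▷ ι = counitApp adjR ((Y ≫ ιbar) ≫ ι) := by
  have h : actApp (upsilon adjL adjR) ((Y ≫ ιbar) ≫ ι) =
      counitApp adjR ((Y ≫ ιbar) ≫ ι) ≫ unitApp adjL ((Y ≫ ιbar) ≫ ι) :=
    NatTrans.congr_app (act_upsilon c adjL adjR) ((Y ≫ ιbar) ≫ ι)
  rw [h, Category.assoc, counitApp_triangle, Category.comp_id]

theorem unitApp_comp_ell (Z : c ⟶ a) : unitApp adjL (Z ≫ ι) ▷ ιbar ≫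
    actApp (ell adjL adjR) ((Z ≫ ι) ≫ ιbar) = unitApp adjR ((Z ≫ ι) ≫ ιbar) := by
  have h : actApp (ell adjL adjR) ((Z ≫ ι) ≫ ιbar) =
      counitApp adjL ((Z ≫ ι) ≫ ιbar) ≫ unitApp adjR ((Z ≫ ι) ≫ ιbar) :=
    NatTrans.congr_app (act_upsilon c adjR adjL) ((Z ≫ ι) ≫ ιbar)
  rw [h, ← Category.assoc, unitApp_triangle, Category.id_comp]

variable [PreadditiveBicategory 𝒞]

theorem sum_betaApp (Q : SummandData (ι ≫ ιbar ≫ ι) ι) (Z : c ⟶ a) :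
    ∑ i, betaApp (Q.β i) Z ≫ betaApp' (Q.β' i) Z = 𝟙 _ := by
  have h : ∀ i, betaApp (Q.β i) Z ≫ betaApp' (Q.β' i) Z =
      (α_ (Z ≫ ι) ιbar ι).hom ≫ (α_ Z ι (ιbar ≫ ι)).hom ≫ Z ◁ (Q.β i ≫ Q.β' i) ≫
        (α_ Z ι (ιbar ≫ ι)).inv ≫ (α_ (Z ≫ ι) ιbar ι).inv := by
    intro i
    simp only [betaApp, betaApp', Category.assoc, whiskerLeft_comp]
  have hs : ∑ i, Z ◁ (Q.β i ≫ Q.β' i) = 𝟙 _ := by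
    rw [← whiskerLeft_id, ← Q.sum_eq]
    exact (map_sum (AddMonoidHom.mk' (fun f : ι ≫ ιbar ≫ ι ⟶ ι ≫ ιbar ≫ ι => Z ◁ f)
      (PreadditiveBicategory.whiskerLeft_add Z)) _ _).symm
  simp only [h]
  rw [← Preadditive.comp_sum, ← Preadditive.comp_sum, ← Preadditive.sum_comp, hs]
  simp

/-- The left D2 condition in terms of the Frobenius monad. -/
theorem sum_gammaL (Q : SummandData (ι ≫ ιbar ≫ ι) ι) :
    ∑ i, (frobeniusMonad c adjL adjR).T.map ((act c (gammaL₂ adjL (Q.β i))).app Y) ≫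
        (act c (gammaL₁ adjL (Q.β' i) (upsilon adjL adjR))).app
          ((frobeniusMonad c adjL adjR).T.obj Y) ≫ (frobeniusMonad c adjL adjR).μ Y =
      (frobeniusMonad c adjL adjR).μ Y ≫ (frobeniusMonad c adjL adjR).e Y ≫
        (frobeniusMonad c adjL adjR).η Y :=
  FrobeniusMonad.sum_map_comp_μ (frobeniusMonad c adjL adjR)
    (B := fun i Y => betaApp (Q.β i) (Y ≫ ιbar)) (B' := fun i Y => betaApp' (Q.β' i) (Y ≫ ιbar))
    (fun Y => sum_betaApp c Q (Y ≫ ιbar))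
    (fun i Y => betaApp'_naturality (Q.β' i) (counitApp adjL (Y ≫ ιbar)))
    (W := fun i => act c (gammaL₁ adjL (Q.β' i) (upsilon adjL adjR)))
    (b := fun i => act c (gammaL₂ adjL (Q.β i)))
    (fun i Y => actApp_gammaL₂ c adjL Y (Q.β i))
    (fun i Y => (actApp_gammaL₁ c adjL Y (Q.β' i) _).trans (by
      rw [upsilon_comp_counitApp]
      rfl)) Y

/-- The right D2 condition in terms of the Frobenius monad of `ῑ`. -/
theorem sum_gammaR (P : SummandData (ιbar ≫ ι ≫ ιbar) ιbar) (Z : c ⟶ a) :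
    ∑ i, (frobeniusMonad c adjR adjL).δ Z ≫
        (frobeniusMonad c adjR adjL).T.map ((act c (gammaR₂ adjL (P.β' i))).app Z) ≫
        (act c (gammaR₁ adjL (P.β i) (ell adjL adjR))).app
          ((frobeniusMonad c adjR adjL).T.obj Z) =
      (frobeniusMonad c adjR adjL).e Z ≫ (frobeniusMonad c adjR adjL).η Z ≫
        (frobeniusMonad c adjR adjL).δ Z :=
  FrobeniusMonad.sum_δ_comp_map (frobeniusMonad c adjR adjL)
    (B := fun i Z => betaApp (P.β i) (Z ≫ ι)) (B' := fun i Z => betaApp' (P.β' i) (Z ≫ ι))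
    (fun Z => sum_betaApp c P (Z ≫ ι))
    (fun i Z => betaApp_naturality (P.β i) (unitApp adjL (Z ≫ ι)))
    (U := fun i => act c (gammaR₂ adjL (P.β' i)))
    (V := fun i => act c (gammaR₁ adjL (P.β i) (ell adjL adjR)))
    (fun i Z => actApp_gammaR₂ c adjL (P.β' i) Z)
    (fun i Z => (actApp_gammaR₁ c adjL (P.β i) _ Z).trans (by
      rw [reassoc_of% unitApp_comp_ell]
      rfl)) Z

omit [PreadditiveBicategory 𝒞] in
/-- The first legs of `γ_L x` are convolutions of `x` with fixed elements. -/
theorem conv_gammaL₁ (β' : ι ⟶ ι ≫ ιbar ≫ ι) (x : End (ιbar ≫ ι)) :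
    conv adjL adjR x (gammaL₁ adjL β' (upsilon adjL adjR)) = gammaL₁ adjL β' x := by
  apply act_injective
  rw [act_conv]
  refine (FrobeniusMonad.star_of_app (frobeniusMonad b adjL adjR)
    (β' := fun Y => betaApp' β' (Y ≫ ιbar)) (fun Y => ?_) fun Y => ?_).symm
  · exact (actApp_gammaL₁ b adjL Y β' _).trans (by
      rw [upsilon_comp_counitApp]
      rfl)
  · exact actApp_gammaL₁ b adjL Y β' x

omit [PreadditiveBicategory 𝒞] in
/-- The first legs of `γ_R y` are convolutions of `y` with fixed elements. -/
theorem conv_gammaR₁ (β : ιbar ≫ ι ≫ ιbar ⟶ ιbar) (y : End (ι ≫ ιbar)) :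
    conv adjR adjL y (gammaR₁ adjL β (ell adjL adjR)) = gammaR₁ adjL β y := by
  apply act_injective
  rw [act_conv]
  refine (FrobeniusMonad.star_of_app' (frobeniusMonad a adjR adjL)
    (β := fun Y => betaApp β (Y ≫ ι)) (fun Y => ?_) fun Y => ?_).symm
  · exact (actApp_gammaR₁ a adjL β _ Y).trans (by
      rw [reassoc_of% unitApp_comp_ell]
      rfl)
  · exact actApp_gammaR₁ a adjL β y Y

end

section

variable [PreadditiveBicategory 𝒞] (adjL : ιbar ⊣ ι) (adjR : ι ⊣ ιbar)

/-- Dual bases of `A` from the left D2 condition. -/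
def dualBasisA (Q : SummandData (ι ≫ ιbar ≫ ι) ι) :
    (representationA adjL adjR).doubleRing.DualBasis Q.n :=
  (representationA adjL adjR).dualBasis
    (fun i => gammaL₁ adjL (Q.β' i) (upsilon adjL adjR)) (fun i => gammaL₂ adjL (Q.β i))
    fun Y => sum_gammaL b adjL adjR Y Q

/-- Dual bases of `B` from the left D2 condition on `ῑ`. -/
def dualBasisB (P : SummandData (ιbar ≫ ι ≫ ιbar) ιbar) :
    (representationB adjL adjR).doubleRing.DualBasis P.n :=
  (representationB adjL adjR).dualBasis
    (fun i => gammaL₁ adjR (P.β' i) (upsilon adjR adjL)) (fun i => gammaL₂ adjR (P.β i))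
    fun Y => sum_gammaL a adjR adjL Y P

end

/-- Transport of a presentation as a direct summand along isomorphisms. -/
def _root_.SummandData.ofIso {C : Type*} [Category C] [Preadditive C] {X X' Y Y' : C}
    (Q : SummandData X Y) (f : X ≅ X') (g : Y ≅ Y') : SummandData X' Y' where
  n := Q.n
  β i := f.inv ≫ Q.β i ≫ g.hom
  β' i := g.inv ≫ Q.β' i ≫ f.hom
  sum_eq := by
    have h : ∀ i, (f.inv ≫ Q.β i ≫ g.hom) ≫ g.inv ≫ Q.β' i ≫ f.hom =
        f.inv ≫ (Q.β i ≫ Q.β' i) ≫ f.hom := by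
      intro i
      simp
    simp only [h]
    rw [← Preadditive.comp_sum, ← Preadditive.sum_comp, Q.sum_eq]
    simp

/-- A Frobenius 1-morphism that is left D2 is right D2.  Applied to `ῑ`, this is also the converse,
since `IsRightD2 ι ῑ` is `IsLeftD2 ῑ ι`. -/
theorem isRightD2_of_isLeftD2 [PreadditiveBicategory 𝒞] (adjL : ιbar ⊣ ι) (adjR : ι ⊣ ιbar)
    (h : IsLeftD2 ι ιbar) : IsRightD2 ι ιbar := by
  obtain ⟨Q⟩ := h
  let R : SummandData ((postcomp b ιbar).obj ((postcomp b ι).obj ((postcomp b ιbar).obj (𝟙 b))))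
      ((postcomp b ιbar).obj (𝟙 b)) :=
    ⟨Q.n, _, _, sum_summand (postcompAdj b adjL) (postcompAdj b adjR)
      (fun Y => sum_gammaL b adjL adjR Y Q) (𝟙 b)⟩
  exact ⟨R.ofIso (α_ _ _ _ ≪≫ α_ _ _ _ ≪≫ λ_ (ιbar ≫ ι ≫ ιbar)) (λ_ ιbar)⟩

end DepthTwo

/-! ### The canonical bialgebroids -/

namespace DepthTwo

variable {𝒞 : Type u} [Bicategory.{w, v} 𝒞] [PreadditiveBicategory 𝒞] {a b : 𝒞} {ι : a ⟶ b}
  {ιbar : b ⟶ a} (adjL : ιbar ⊣ ι) (adjR : ι ⊣ ιbar)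

/-- The structure maps do not depend on the presentation that is used to define `γ_L`. -/
theorem isCanonicalLeft (Q Q' : SummandData (ι ≫ ιbar ≫ ι) ι) :
    IsCanonicalLeft adjL Q' (dualBasisA adjL adjR Q).leftBialgebroid where
  s_eq _ := rfl
  t_eq _ := rfl
  π_eq _ := rfl
  γ_eq x := by
    have h : (dualBasisA adjL adjR Q').gammaL x = (dualBasisA adjL adjR Q).gammaL x :=
      (dualBasisA adjL adjR Q).gammaL_eq_iff.2 ((dualBasisA adjL adjR Q').testL_gammaL x)
    refine h.symm.trans (((dualBasisA adjL adjR Q').gammaL_apply x).trans ?_)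
    refine congrArg _ (Finset.sum_congr rfl fun i _ => ?_)
    exact congrArg (· ⊗ₜ[ℤ] gammaL₂ adjL (Q'.β i)) (conv_gammaL₁ adjL adjR (Q'.β' i) x)

/-- The counterpart of `isCanonicalLeft`.  The right bialgebroid on `B` is the right partner for the
representation over `Rᵐᵒᵖ`, and the formula for `γ_R` is that of `gammaR_eq`. -/
theorem isCanonicalRight (P P' : SummandData (ιbar ≫ ι ≫ ιbar) ιbar) :
    IsCanonicalRight adjL P'
      ((dualBasisB adjL adjR P).rightBialgebroid (RingEquiv.opOp (End ι)).symm) where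
  s_eq r := ((dualBasisB adjL adjR P).sR_apply _ (op r)).trans (antipodeA_sL_mate adjR adjL r)
  t_eq r := rfl
  π_eq y := congrArg (piR adjL) ((dualBasisB adjL adjR P).S_S' y)
  γ_eq y := by
    refine ((dualBasisB adjL adjR P).gammaR_eq _ (fun i => gammaR₂ adjL (P'.β' i))
      (fun i => gammaR₁ adjL (P'.β i) (ell adjL adjR))
      ((representationB adjL adjR).sum_mul_star_one _ _ fun Z =>
        sum_gammaR a adjL adjR P' Z) y).trans ?_
    refine congrArg _ (Finset.sum_congr rfl fun i _ => ?_)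
    exact congrArg (· ⊗ₜ[ℤ] gammaR₂ adjL (P'.β' i)) (conv_gammaR₁ adjL adjR (P'.β i) y)

end DepthTwo

theorem mainTheorem4 {𝒞 : Type u} [Bicategory.{w, v} 𝒞] [PreadditiveBicategory 𝒞]
    {a b : 𝒞} {ι : a ⟶ b} {ιbar : b ⟶ a} (adjL : ιbar ⊣ ι) (adjR : ι ⊣ ιbar)
    (hD2 : DepthTwo.IsLeftD2 ι ιbar ∨ DepthTwo.IsRightD2 ι ιbar) :
    DepthTwo.IsLeftD2 ι ιbar ∧ DepthTwo.IsRightD2 ι ιbar ∧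
    (∃ 𝓐 : LeftBialgebroid (End (ιbar ≫ ι)) (End ι),
      (∀ Q : SummandData (ι ≫ ιbar ≫ ι) ι, DepthTwo.IsCanonicalLeft adjL Q 𝓐) ∧
      𝓐.IsNondegenerateRightIntegral (DepthTwo.upsilon adjL adjR) ∧
      ∃ S : End (ιbar ≫ ι) ≃+ End (ιbar ≫ ι),
        (∀ x, S x = DepthTwo.antipodeA adjL adjR x) ∧
        (∀ ρ : 𝓐.DualStar, 𝓐.hitDualStar (DepthTwo.upsilon adjL adjR) ρ = 1 →
          ∀ x, S x = 𝓐.hitDualStar (DepthTwo.upsilon adjL adjR) (𝓐.actDualStar x ρ)) ∧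
        (∀ x y, S (x * y) = S y * S x) ∧
        S (DepthTwo.upsilon adjL adjR) = DepthTwo.upsilon adjL adjR ∧
        ∃ 𝓐R : RightBialgebroid (End (ιbar ≫ ι)) (End ι)ᵐᵒᵖ,
          IsRightPartner 𝓐 S 𝓐R ∧ IsHopfAlgebroid 𝓐 𝓐R S ∧
          IsNondegLeftIntegralHopf 𝓐 𝓐R (DepthTwo.upsilon adjL adjR) ∧
          IsNondegRightIntegralHopf 𝓐 𝓐R (DepthTwo.upsilon adjL adjR)) ∧
    (∃ 𝓑 : RightBialgebroid (End (ι ≫ ιbar)) (End ι),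
      (∀ P : SummandData (ιbar ≫ ι ≫ ιbar) ιbar, DepthTwo.IsCanonicalRight adjL P 𝓑) ∧
      𝓑.IsNondegenerateLeftIntegral (DepthTwo.ell adjL adjR) ∧
      ∃ S : End (ι ≫ ιbar) ≃+ End (ι ≫ ιbar),
        (∀ y, S y = DepthTwo.antipodeB adjL adjR y) ∧
        (∀ lam : 𝓑.StarDual, 𝓑.hitStarDual lam (DepthTwo.ell adjL adjR) = 1 →
          ∀ y, S y = 𝓑.hitStarDual (𝓑.actStarDual lam y) (DepthTwo.ell adjL adjR)) ∧
        (∀ x y, S (x * y) = S y * S x) ∧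
        S (DepthTwo.ell adjL adjR) = DepthTwo.ell adjL adjR ∧
        ∃ 𝓑L : LeftBialgebroid (End (ι ≫ ιbar)) (End ι)ᵐᵒᵖ,
          IsLeftPartner 𝓑 S 𝓑L ∧ IsHopfAlgebroid 𝓑L 𝓑 S ∧
          IsNondegLeftIntegralHopf 𝓑L 𝓑 (DepthTwo.ell adjL adjR) ∧
          IsNondegRightIntegralHopf 𝓑L 𝓑 (DepthTwo.ell adjL adjR)) := by
  have hL : DepthTwo.IsLeftD2 ι ιbar :=
    hD2.elim id (DepthTwo.isRightD2_of_isLeftD2 adjR adjL)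
  have hR : DepthTwo.IsRightD2 ι ιbar := DepthTwo.isRightD2_of_isLeftD2 adjL adjR hL
  refine ⟨hL, hR, ?_, ?_⟩
  · obtain ⟨Q⟩ := hL
    let E := DepthTwo.dualBasisA adjL adjR Q
    exact ⟨E.leftBialgebroid, DepthTwo.isCanonicalLeft adjL adjR Q,
      E.isNondegenerateRightIntegral, E.antipode, fun _ => rfl,
      fun ρ hρ x => (E.hitDualStar_act ρ hρ x).symm, E.S_mul, E.S_Υ,
      E.rightBialgebroid (RingEquiv.refl (End ι)ᵐᵒᵖ), E.isRightPartner, E.isHopfAlgebroid _,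
      E.isNondegLeftIntegralHopf _, E.isNondegRightIntegralHopf _⟩
  · obtain ⟨P⟩ := hR
    let E := DepthTwo.dualBasisB adjL adjR P
    exact ⟨E.rightBialgebroid (RingEquiv.opOp (End ι)).symm,
      DepthTwo.isCanonicalRight adjL adjR P, E.isNondegenerateLeftIntegral _, E.antipode,
      fun _ => rfl, fun lam h y => (E.right_hitStarDual_act _ lam h y).symm, E.S_mul, E.S_Υ,
      E.leftBialgebroid, E.isLeftPartner, E.isHopfAlgebroid _, E.isNondegLeftIntegralHopf _,
      E.isNondegRightIntegralHopf _⟩
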